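/- **Setting.** Let $q\in C^2(0,2\pi)$ be a real-valued potential with $q\in L_2(0,2\pi)$ (automatic if $q$ is $C^2$ up to the endpoints). Let $\widetilde q(x)=q(x)$ for $0<x<2\pi$, $\widetilde q(x)=q(x+2\pi)$ for $-2\pi<x<0$, and $\widetilde q(x)=0$ otherwise. Put $T=\pi$, $\mathcal F^T=L_2(0,T;\mathbb R^2)$, $\mathcal H^T=L_2(-T,T)$. For a control $F=(f_1,f_2)^{\mathsf T}\in\mathcal F^T$ let $v^F\in C([0,T];L_2(\mathbb R))$ be the generalized (weak) solution of $$v_{tt}-v_{xx}+\widetilde q\,v=0\quad (x\neq 0,\ 0<t<T),\qquad v(\cdot,0)=v_t(\cdot,0)=0,$$ $$v(0+,t)-v(0-,t)=f_1(t),\qquad v_x(0+,t)-v_x(0-,t)=f_2'(t).$$ The connecting operator $C^T:\mathcal F^T\to\mathcal F^T$ is the bounded operator with $(C^TF,G)_{\mathcal F^T}=(v^F(\cdot,T),v^G(\cdot,T))_{\mathcal H^T}$ for all $F,G\in\mathcal F^T$. Write $C^T=\tfrac12(I+C)$, $(J^TF)(t)=F(T-t)$ and $\widetilde C=J^TCJ^T$.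 **Theorem 5 (Gelfand–Levitan equation).** The operator $\widetilde C$ is an integral operator, $(\widetilde CF)(t)=\int_0^{\pi}\widetilde C(t,s)F(s)\,ds$, with a $2\times2$ matrix kernel that is continuous on $[0,\pi]^2$. There is a unique matrix-valued function $m=(m_{ij})$ on $(0,\pi)^2$ that vanishes for $x>s$, is continuous on $\{0<x\le s<\pi\}$, has $m(\cdot,s)$ integrable on $(0,\pi)$ for each $s$, and satisfies $$m(x,s)+\widetilde C(x,s)+\int_0^{\pi}\widetilde C(x,\alpha)\,m(\alpha,s)\,d\alpha=0,\qquad 0<x<s<\pi.$$ This solution determines the potential: the derivatives below exist and $$q(x)=\begin{cases}\ \ 2\,\dfrac{d}{dx}\bigl(m_{11}(x,x)-m_{12}(x,x)\bigr), & x\in(0,\pi),\\[2mm] -2\,\dfrac{d}{dx}\bigl(m_{11}(2\pi-x,2\pi-x)+m_{12}(2\pi-x,2\pi-x)\bigr), & x\in(\pi,2\pi).\end{cases}$$ -/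

import Mathlib

open scoped ContDiff

noncomputable section

namespace PeriodicWave

open MeasureTheory Set

/-- The potential `q` on `(0, 2π)`, moved to the real line: `q x` on `(0, 2π)`, `q (x + 2π)` on
`(-2π, 0)`, and `0` elsewhere. -/
def linePotential (q : ℝ → ℝ) (x : ℝ) : ℝ :=
  if 0 < x ∧ x < 2 * Real.pi then q x
  else if -(2 * Real.pi) < x ∧ x < 0 then q (x + 2 * Real.pi)
  else 0

/-- The outer space `L₂(0, T; ℝ²)` of controls `F = (f₁, f₂)`; `f₁` is the coordinate `0` and
`f₂` the coordinate `1`. -/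
abbrev ControlSpace (T : ℝ) : Type :=
  Lp (EuclideanSpace ℝ (Fin 2)) 2 ((volume : Measure ℝ).restrict (Ioo 0 T))

/-- The inner space `L₂(-T, T)` of states. -/
abbrev StateSpace (T : ℝ) : Type :=
  Lp ℝ 2 ((volume : Measure ℝ).restrict (Ioo (-T) T))

/-- `v ∈ C([0, T]; L₂(ℝ))` is the generalized solution, for the control `F = (f₁, f₂)`, of
`v_tt - v_xx + q̃ v = 0` for `x ≠ 0`, `0 < t < T`, with the jump conditions
`v(0+, t) - v(0-, t) = f₁(t)`, `v_x(0+, t) - v_x(0-, t) = f₂'(t)` and with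
`v(·, 0) = v_t(·, 0) = 0`.

In the sense of distributions this says `v_tt - v_xx + q̃ v = - f₂'(t) δ(x) - f₁(t) δ'(x)`, and it
is tested here against smooth functions that vanish for `t ≥ T`; they need not vanish at `t = 0`,
which encodes the initial conditions. -/
structure IsGeneralizedSolution (q : ℝ → ℝ) (T : ℝ) (F : ControlSpace T)
    (v : ℝ → Lp ℝ 2 (volume : Measure ℝ)) : Prop where
  continuousOn : ContinuousOn v (Icc 0 T)
  initial : v 0 = 0
  weak : ∀ φ : ℝ → ℝ → ℝ, ContDiff ℝ ∞ (Function.uncurry φ) →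
    HasCompactSupport (Function.uncurry φ) → (∀ x t, T ≤ t → φ x t = 0) →
    (∫ t in (0 : ℝ)..T, ∫ x, v t x *
        (iteratedDeriv 2 (fun τ => φ x τ) t - iteratedDeriv 2 (fun y => φ y t) x
          + linePotential q x * φ x t))
      = ∫ t in (0 : ℝ)..T,
          (F t 0 * deriv (fun y => φ y t) 0 + F t 1 * deriv (fun τ => φ 0 τ) t)

/-- `W` is the control operator `W^T F = v^F(·, T)`: for every control there is a generalized
solution, and `W F` is its state at time `T`. -/
def IsControlOperator (q : ℝ → ℝ) (T : ℝ) (W : ControlSpace T →L[ℝ] StateSpace T) : Prop :=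
  ∀ F : ControlSpace T,
    (∃ v, IsGeneralizedSolution q T F v) ∧
    ∀ v, IsGeneralizedSolution q T F v →
      (v T : ℝ → ℝ) =ᵐ[volume.restrict (Ioo (-T) T)] (W F : ℝ → ℝ)

/-- `A` is the connecting operator `C^T`, given by the form
`(C^T F, G) = (v^F(·, T), v^G(·, T))`. -/
def IsConnectingOperator (q : ℝ → ℝ) (T : ℝ) (A : ControlSpace T →L[ℝ] ControlSpace T) : Prop :=
  ∃ W : ControlSpace T →L[ℝ] StateSpace T, IsControlOperator q T W ∧
    ∀ F G : ControlSpace T, inner ℝ (A F) G = inner ℝ (W F) (W G)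

theorem measurePreserving_reflect (T : ℝ) :
    MeasurePreserving (fun t : ℝ => T - t) ((volume : Measure ℝ).restrict (Ioo 0 T))
      ((volume : Measure ℝ).restrict (Ioo 0 T)) := by
  have h := (Measure.measurePreserving_sub_left (volume : Measure ℝ) T).restrict_preimage
    (measurableSet_Ioo (a := (0 : ℝ)) (b := T))
  simpa using h

/-- The time reversal `(J^T F)(t) = F(T - t)`. -/
def timeReversal (T : ℝ) : ControlSpace T →L[ℝ] ControlSpace T :=
  (Lp.compMeasurePreservingₗᵢ ℝ (fun t : ℝ => T - t)
    (measurePreserving_reflect T)).toContinuousLinearMap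

theorem timeReversal_apply (T : ℝ) (F : ControlSpace T) :
    (timeReversal T F : ℝ → EuclideanSpace ℝ (Fin 2))
      =ᵐ[volume.restrict (Ioo 0 T)] fun t => F (T - t) :=
  Lp.coeFn_compMeasurePreserving F (measurePreserving_reflect T)

/-- `A` is the integral operator `(A F)(t) = ∫₀ᵀ k(t, s) F(s) ds`. -/
def HasKernel (T : ℝ) (A : ControlSpace T →L[ℝ] ControlSpace T)
    (k : ℝ → ℝ → Matrix (Fin 2) (Fin 2) ℝ) : Prop :=
  ∀ F : ControlSpace T, ∀ᵐ t ∂((volume : Measure ℝ).restrict (Ioo 0 T)),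
    ∀ i, A F t i = ∫ s in (0 : ℝ)..T, ∑ j, k t s i j * F s j

/-- `k` is the continuous kernel of `C̃ = J^T C J^T`, where `C^T = (1/2) (I + C)` is the connecting
operator. -/
def IsGelfandLevitanKernel (q : ℝ → ℝ) (T : ℝ) (k : ℝ → ℝ → Matrix (Fin 2) (Fin 2) ℝ) : Prop :=
  ContinuousOn (Function.uncurry k) (Icc 0 T ×ˢ Icc 0 T) ∧
    ∃ A C : ControlSpace T →L[ℝ] ControlSpace T,
      IsConnectingOperator q T A ∧
      A = (1 / 2 : ℝ) • (ContinuousLinearMap.id ℝ (ControlSpace T) + C) ∧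
      HasKernel T (timeReversal T ∘L C ∘L timeReversal T) k

/-- `m` is a solution of the Gelfand–Levitan equation with kernel `k`: a matrix function on
`(0, π)²` that vanishes for `x > s`, is continuous on `0 < x ≤ s < π`, and satisfies
`m(x, s) + k(x, s) + ∫₀^π k(x, α) m(α, s) dα = 0` for `0 < x < s < π`, where the integral makes
sense. -/
structure IsGelfandLevitanSolution (k m : ℝ → ℝ → Matrix (Fin 2) (Fin 2) ℝ) : Prop where
  continuousOn : ContinuousOn (Function.uncurry m) {p | 0 < p.1 ∧ p.1 ≤ p.2 ∧ p.2 < Real.pi}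
  triangular : ∀ x s, 0 < s → s < x → x < Real.pi → m x s = 0
  integrable : ∀ s ∈ Ioo 0 Real.pi, ∀ i j,
    IntervalIntegrable (fun α => m α s i j) volume 0 Real.pi
  equation : ∀ x s, 0 < x → x < s → s < Real.pi → ∀ i j,
    m x s i j + k x s i j + ∫ α in (0 : ℝ)..Real.pi, (k x α * m α s) i j = 0

end PeriodicWave

end

/-! The theorem rests on one factorization. Let K be the upper triangular Volterra operator with
kernel `jumpMatrix`, K* its adjoint and J the time reversal. Then I + C̃ = (I + K*)(I + K), and m is
the kernel of (I + K)⁻¹ - I.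

The wave produced by a control is explicit up to a continuous kernel. A pulse in one component of
the control emits delta functions along the rays t = |x|, with coefficients `cp` and `cm` equal to
±1/2, followed by a tail inside the cone. In the characteristic variables ξ = (t + x)/2, η = (t -
x)/2 the tail u solves the Goursat problem u_ξη = -p u, which is solvable by a weighted fixed point
although p is only integrable (`exists_goursat_solution`). `goursat_weak_identity` says that rays
plus tail form a fundamental solution; superposing pulses then gives a generalized solution for
every L₂ control (`exists_control_solution`). It is the only one, by duality with the free wave
equation and Gronwall (`eq_zero_of_homogeneous`), so the control operator W is determined.

At time T, with the control reversed, the states at x and -x involve F(x) and an integral of F over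
(x, T). Their difference and the negative of their sum are the two components of (F + KF)(x), hence
(WJF, WJG) = 1/2 ((I + K)F, (I + K)G) (`inner_reversedState`). Since C^T = W*W, this gives the
factorization, and C̃ has the kernel of K + K* + K*K, which is `factoredKernel`. It is continuous
across the diagonal because K(x, x) is a symmetric matrix. Another continuous kernel agrees with it
on the open square (`HasKernel.eqOn`).

For triangular m the equation for the column m(·, s) lives on (0, s), and a lower-times-upper
factorization restricts to (0, s) with the same kernel. If I + m inverts I + K, then (I + K*)(I +
K)(I + m) = I + K*, whose integral kernel vanishes above the diagonal: this is the Gelfand–Levitan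
equation (`factoredKernel_resolvent`). Uniqueness holds because both Volterra factors are injective
on (0, s) (`eq_zero_of_factoredKernel`). On the diagonal m = -K, and the Goursat data on the axes
make m₁₁ - m₁₂ and m₁₁ + m₁₂ half the primitives of q̃(y) and q̃(-y), so differentiation returns q.
-/

noncomputable section

namespace PeriodicWave

open MeasureTheory Set

/-! ### Gronwall inequalities, Volterra resolvents and factored kernels -/

section Volterra

/-- Gronwall is applied to the primitive of Y: it starts at 0 and its derivative is at most M times
itself. Y is first extended by constants so that the primitive is differentiable at the end points
too. -/
theorem eq_zero_of_le_mul_integral {Y : ℝ → ℝ} {a M : ℝ} (hY : ContinuousOn Y (Icc 0 a))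
    (h0 : ∀ x ∈ Icc 0 a, 0 ≤ Y x) (h : ∀ x ∈ Icc 0 a, Y x ≤ M * ∫ t in (0 : ℝ)..x, Y t) :
    ∀ x ∈ Icc 0 a, Y x = 0 := by
  rcases lt_or_ge a 0 with ha | ha
  · intro x hx; exact absurd (hx.1.trans hx.2) (not_le.2 ha)
  set Z : ℝ → ℝ := IccExtend ha (fun t : Icc (0 : ℝ) a => Y t) with hZ
  have hZc : Continuous Z := (continuousOn_iff_continuous_domRestrict.1 hY).Icc_extend'
  have hZY : ∀ x ∈ Icc 0 a, Z x = Y x := fun x hx => IccExtend_of_mem _ _ hx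
  have hint : ∀ x ∈ Icc 0 a, ∫ t in (0 : ℝ)..x, Y t = ∫ t in (0 : ℝ)..x, Z t := by
    intro x hx
    refine intervalIntegral.integral_congr fun t ht => ?_
    rw [uIcc_of_le hx.1] at ht
    exact (hZY t ⟨ht.1, ht.2.trans hx.2⟩).symm
  have hN0 : ∀ x ∈ Icc 0 a, 0 ≤ ∫ t in (0 : ℝ)..x, Z t := fun x hx =>
    intervalIntegral.integral_nonneg hx.1 fun t ht => by
      rw [hZY t ⟨ht.1, ht.2.trans hx.2⟩]; exact h0 t ⟨ht.1, ht.2.trans hx.2⟩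
  have key := eq_zero_of_abs_deriv_le_mul_abs_self_of_eq_zero_right
    (f := fun x => ∫ t in (0 : ℝ)..x, Z t) (f' := Z) (K := M) (a := 0) (b := a)
    (intervalIntegral.continuous_primitive (fun _ _ => hZc.intervalIntegrable _ _) 0).continuousOn
    (fun x _ => (hZc.integral_hasStrictDerivAt 0 x).hasDerivAt.hasDerivWithinAt) (by simp)
    (fun x hx => by
      have hx' : x ∈ Icc 0 a := ⟨hx.1, hx.2.le⟩
      rw [Real.norm_of_nonneg (hN0 x hx'), hZY x hx', Real.norm_of_nonneg (h0 x hx'), ← hint x hx']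
      exact h x hx')
  intro x hx
  have h1 := h x hx
  rw [hint x hx, key x hx, mul_zero] at h1
  exact le_antisymm h1 (h0 x hx)

/-- Here y is only integrable, so Gronwall runs on the continuous function x ↦ ∫₀ˣ ‖y‖, which
inherits the inequality after one more integration. The columns of a solution m are only assumed
integrable, whence this generality. -/
theorem eq_zero_of_norm_le_mul_integral {E : Type*} [NormedAddCommGroup E] {y : ℝ → E} {a M : ℝ}
    (hy : IntervalIntegrable y volume 0 a)
    (h : ∀ x ∈ Ioo 0 a, ‖y x‖ ≤ M * ∫ t in (0 : ℝ)..x, ‖y t‖) : ∀ x ∈ Ioo 0 a, y x = 0 := by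
  rcases le_or_gt a 0 with ha | ha
  · intro x hx; exact absurd (hx.1.trans hx.2) (not_lt.2 ha)
  have hn := hy.norm
  have hc : ContinuousOn (fun x => ∫ t in (0 : ℝ)..x, ‖y t‖) (Icc 0 a) := by
    have := intervalIntegral.continuousOn_primitive_interval (μ := volume) (f := fun t => ‖y t‖)
      (a := 0) (b := a) ((intervalIntegrable_iff').1 hn)
    rwa [uIcc_of_le ha.le] at this
  have hsub : ∀ x ∈ Icc 0 a, IntervalIntegrable (fun t => ‖y t‖) volume 0 x := fun x hx =>
    hn.mono_set (by rw [uIcc_of_le ha.le, uIcc_of_le hx.1]; exact Icc_subset_Icc_right hx.2)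
  have key := eq_zero_of_le_mul_integral (M := M) hc
    (fun x hx => intervalIntegral.integral_nonneg hx.1 fun t _ => norm_nonneg _)
    (fun x hx => by
      rw [← intervalIntegral.integral_const_mul]
      refine intervalIntegral.integral_mono_on_of_le_Ioo hx.1 (hsub x hx) ?_ ?_
      · refine (ContinuousOn.intervalIntegrable ?_).const_mul _
        rw [uIcc_of_le hx.1]
        exact hc.mono (Icc_subset_Icc_right hx.2)
      · intro t ht
        exact h t ⟨ht.1, ht.2.trans_le hx.2⟩)
  intro x hx
  have h1 := h x hx
  rw [key x ⟨hx.1.le, hx.2.le⟩, mul_zero] at h1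
  exact norm_le_zero_iff.1 h1

theorem exists_fixedPoint_boundedContinuous {Z E : Type*} [TopologicalSpace Z]
    [NormedAddCommGroup E] [CompleteSpace E]
    (A : BoundedContinuousFunction Z E → BoundedContinuousFunction Z E)
    (hA : ∀ u v z, ‖A u z - A v z‖ ≤ 1 / 2 * ‖u - v‖) : ∃ u, A u = u := by
  have hc : ContractingWith (1 / 2) A := by
    refine ⟨by norm_num, LipschitzWith.of_dist_le_mul fun u v => ?_⟩
    rw [dist_eq_norm, dist_eq_norm]
    refine (BoundedContinuousFunction.norm_le (by positivity)).2 fun z => ?_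
    simpa using hA u v z
  exact ⟨_, hc.fixedPoint_isFixedPt⟩

theorem integral_exp_neg_mul_le {c b : ℝ} (hc : 0 < c) :
    ∫ t in (0 : ℝ)..b, Real.exp (-(c * t)) ≤ 1 / c := by
  have h : ∀ t, HasDerivAt (fun t => -(1 / c) * Real.exp (-(c * t))) (Real.exp (-(c * t))) t := by
    intro t
    have := (((hasDerivAt_id t).const_mul c).neg.exp).const_mul (-(1 / c))
    refine this.congr_deriv ?_
    simp only [Pi.neg_apply, id_eq]
    field_simp
  rw [intervalIntegral.integral_eq_sub_of_hasDerivAt (fun t _ => h t)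
    ((by fun_prop : Continuous fun t => Real.exp (-(c * t))).intervalIntegrable _ _)]
  have : 0 < 1 / c * Real.exp (-(c * b)) := by positivity
  simp; simp at this; linarith

/-- With m(x, s) = exp(c(s - x)) u(x, s) and α = x + τ, the integral operator acquires the weight
exp(-cτ) and becomes a contraction on bounded continuous functions for large c. -/
theorem exists_volterra_resolvent {R : Type*} [NormedRing R] [NormedAlgebra ℝ R] [CompleteSpace R]
    {K : ℝ → ℝ → R} (hK : Continuous (Function.uncurry K)) {T : ℝ} (hT : 0 ≤ T) :
    ∃ m : ℝ → ℝ → R, Continuous (Function.uncurry m) ∧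
      ∀ x s, 0 ≤ x → x ≤ s → s ≤ T → m x s + K x s + ∫ α in x..s, K x α * m α s = 0 := by
  -- Clamping both arguments to [0, T] makes the kernel bounded on the whole plane and changes
  -- nothing on the square.
  set r : ℝ → ℝ := fun x => max 0 (min x T) with hr
  have hrc : Continuous r := by fun_prop
  have hrT : ∀ x, r x ∈ Icc 0 T := fun x => ⟨le_max_left _ _, max_le hT (min_le_right _ _)⟩
  have hrx : ∀ x ∈ Icc 0 T, r x = x := fun x hx => by simp [hr, hx.1, hx.2]
  obtain ⟨M, hM⟩ : ∃ M, ∀ z ∈ Icc (0 : ℝ) T ×ˢ Icc (0 : ℝ) T, ‖Function.uncurry K z‖ ≤ M :=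
    (isCompact_Icc.prod isCompact_Icc).exists_bound_of_continuousOn hK.continuousOn
  set Kb : ℝ → ℝ → R := fun x s => K (r x) (r s) with hKb
  have hKbc : Continuous (Function.uncurry Kb) :=
    hK.comp ((hrc.comp continuous_fst).prodMk (hrc.comp continuous_snd))
  have hKbM : ∀ x s, ‖Kb x s‖ ≤ M := fun x s => hM (r x, r s) ⟨hrT x, hrT s⟩
  have hM0 : 0 ≤ M := (norm_nonneg _).trans (hKbM 0 0)
  -- This gives M / c ≤ 1/2; the added 1 keeps c positive when M = 0.
  set c : ℝ := 2 * (M + 1) with hc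
  have hc0 : 0 < c := by positivity
  let I : BoundedContinuousFunction (ℝ × ℝ) R → ℝ × ℝ → R := fun u z =>
    ∫ τ in (0 : ℝ)..max (z.2 - z.1) 0,
      Real.exp (-(c * τ)) • (Kb z.1 (z.1 + τ) * u (z.1 + τ, z.2))
  have hIi : ∀ (u : BoundedContinuousFunction (ℝ × ℝ) R), Continuous (Function.uncurry
      fun (z : ℝ × ℝ) τ => Real.exp (-(c * τ)) • (Kb z.1 (z.1 + τ) * u (z.1 + τ, z.2))) := by
    intro u
    have h1 : Continuous fun w : (ℝ × ℝ) × ℝ => Kb w.1.1 (w.1.1 + w.2) :=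
      hKbc.comp (f := fun w : (ℝ × ℝ) × ℝ => (w.1.1, w.1.1 + w.2)) (by fun_prop)
    have h2 : Continuous fun w : (ℝ × ℝ) × ℝ => u (w.1.1 + w.2, w.1.2) :=
      u.continuous.comp (by fun_prop)
    exact Continuous.smul (by fun_prop) (h1.mul h2)
  have hIc : ∀ u, Continuous (I u) := fun u =>
    intervalIntegral.continuous_parametric_intervalIntegral_of_continuous (hIi u) (by fun_prop)
  have hIb : ∀ u z, ‖I u z‖ ≤ 1 / 2 * ‖u‖ := by
    intro u z
    have hle : ‖I u z‖ ≤ ∫ τ in (0 : ℝ)..max (z.2 - z.1) 0, Real.exp (-(c * τ)) * (M * ‖u‖) := by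
      refine intervalIntegral.norm_integral_le_of_norm_le (le_max_right _ _)
        (Filter.Eventually.of_forall fun τ _ => ?_)
        ((by fun_prop : Continuous fun τ => Real.exp (-(c * τ)) * (M * ‖u‖)).intervalIntegrable _ _)
      rw [norm_smul, Real.norm_of_nonneg (Real.exp_pos _).le]
      refine mul_le_mul_of_nonneg_left ?_ (Real.exp_pos _).le
      exact (norm_mul_le _ _).trans
        (mul_le_mul (hKbM _ _) (u.norm_coe_le_norm _) (norm_nonneg _) hM0)
    rw [intervalIntegral.integral_mul_const] at hle
    refine hle.trans ((mul_le_mul_of_nonneg_right (integral_exp_neg_mul_le hc0)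
      (by positivity)).trans ?_)
    rw [← mul_assoc]
    refine mul_le_mul_of_nonneg_right ?_ (norm_nonneg _)
    rw [hc, div_mul_eq_mul_div, div_le_div_iff₀ (by positivity) (by norm_num)]
    linarith
  have hIsub : ∀ u v z, I u z - I v z = I (u - v) z := by
    intro u v z
    have hi : ∀ u : BoundedContinuousFunction (ℝ × ℝ) R, IntervalIntegrable
        (fun τ => Real.exp (-(c * τ)) • (Kb z.1 (z.1 + τ) * u (z.1 + τ, z.2)))
        volume 0 (max (z.2 - z.1) 0) := fun u =>
      ((hIi u).comp (Continuous.prodMk_right z)).intervalIntegrable _ _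
    simp only [I]
    rw [← intervalIntegral.integral_sub (hi u) (hi v)]
    simp [mul_sub, smul_sub]
  let g : ℝ × ℝ → R := fun z => Real.exp (-(c * max (z.2 - z.1) 0)) • Kb z.1 z.2
  have hgc : Continuous g := Continuous.smul (by fun_prop) (hKbc.comp (by fun_prop))
  have hgb : ∀ z, ‖g z‖ ≤ M := by
    intro z
    rw [norm_smul, Real.norm_of_nonneg (Real.exp_pos _).le]
    have : Real.exp (-(c * max (z.2 - z.1) 0)) ≤ 1 := by
      rw [Real.exp_le_one_iff]
      have : 0 ≤ c * max (z.2 - z.1) 0 := mul_nonneg hc0.le (le_max_right _ _)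
      linarith
    exact (mul_le_mul this (hKbM _ _) (norm_nonneg _) zero_le_one).trans (by simp)
  obtain ⟨u, hu⟩ := exists_fixedPoint_boundedContinuous (fun u =>
    BoundedContinuousFunction.ofNormedAddCommGroup (fun z => -g z - I u z)
      (hgc.neg.sub (hIc u)) (M + 1 / 2 * ‖u‖) (fun z => (norm_sub_le _ _).trans
        (add_le_add (by rw [norm_neg]; exact hgb z) (hIb u z)))) (fun u v z => by
      have : (-g z - I u z) - (-g z - I v z) = -(I (u - v) z) := by rw [← hIsub]; abel
      simp only [BoundedContinuousFunction.coe_ofNormedAddCommGroup, this, norm_neg]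
      exact hIb _ _)
  have hu' : ∀ z, u z = -g z - I u z := fun z => by
    conv_lhs => rw [← hu]
    rfl
  refine ⟨fun x s => Real.exp (c * (s - x)) • u (x, s), ?_, ?_⟩
  · exact Continuous.smul (by fun_prop) (u.continuous.comp (by fun_prop))
  · intro x s hx hxs hs
    have h1 : ∫ α in x..s, K x α * Real.exp (c * (s - α)) • u (α, s)
        = Real.exp (c * (s - x)) • I u (x, s) := by
      have h2 : I u (x, s) = ∫ α in x..s, Real.exp (-(c * (α - x))) • (Kb x α * u (α, s)) := by
        simp only [I]
        rw [max_eq_left (by linarith)]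
        have := intervalIntegral.integral_comp_add_left (a := 0) (b := s - x)
          (fun α => Real.exp (-(c * (α - x))) • (Kb x α * u (α, s))) x
        simpa using this
      rw [h2, ← intervalIntegral.integral_smul]
      refine intervalIntegral.integral_congr fun α hα => ?_
      rw [uIcc_of_le hxs] at hα
      simp only [hKb, hrx x ⟨hx, hxs.trans hs⟩, hrx α ⟨hx.trans hα.1, hα.2.trans hs⟩]
      rw [smul_smul, ← Real.exp_add, mul_smul_comm]
      ring_nf
    rw [h1]
    beta_reduce
    rw [hu' (x, s)]
    simp only [g, hKb, hrx x ⟨hx, hxs.trans hs⟩, hrx s ⟨hx.trans hxs, hs⟩]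
    rw [max_eq_left (by linarith), smul_sub, smul_neg, smul_smul, ← Real.exp_add]
    simp
    abel

theorem integrable_triangle_mul {R : Type*} [NormedRing R] [NormedAlgebra ℝ R]
    {f : ℝ × ℝ → R} (hf : Continuous f) {d : ℝ → R} {s a : ℝ}
    (hd : IntegrableOn d (Ioc 0 s)) :
    Integrable (fun z : ℝ × ℝ => {w : ℝ × ℝ | w.2 ≤ w.1}.indicator (fun w => f w * d w.1) z)
      ((volume.restrict (Ioc 0 s)).prod (volume.restrict (Ioc 0 a))) := by
  obtain ⟨M, hM⟩ : ∃ M, ∀ z ∈ Icc (0 : ℝ) s ×ˢ Icc (0 : ℝ) a, ‖f z‖ ≤ M :=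
    (isCompact_Icc.prod isCompact_Icc).exists_bound_of_continuousOn hf.continuousOn
  have hd' : Integrable (fun z : ℝ × ℝ => d z.1)
      ((volume.restrict (Ioc 0 s)).prod (volume.restrict (Ioc 0 a))) := Integrable.comp_fst hd _
  refine (Integrable.indicator ?_ (measurableSet_le measurable_snd measurable_fst))
  refine Integrable.mono' (hd'.norm.const_mul M)
    (hf.aestronglyMeasurable.mul hd'.aestronglyMeasurable) ?_
  rw [Measure.prod_restrict]
  filter_upwards [ae_restrict_mem (measurableSet_Ioc.prod measurableSet_Ioc)] with z hz
  exact (norm_mul_le _ _).trans (mul_le_mul_of_nonneg_right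
    (hM z ⟨Ioc_subset_Icc_self hz.1, Ioc_subset_Icc_self hz.2⟩) (norm_nonneg _))

theorem setIntegral_indicator_ge {E : Type*} [NormedAddCommGroup E] [NormedSpace ℝ E]
    {f : ℝ → E} {b s : ℝ} (hb : 0 ≤ b) (hbs : b ≤ s) :
    ∫ α in Ioc 0 s, (Ici b).indicator f α = ∫ α in b..s, f α := by
  rw [intervalIntegral.integral_of_le hbs,
    setIntegral_indicator measurableSet_Ici,
    ← integral_Icc_eq_integral_Ioc (x := b)]
  refine setIntegral_congr_set ?_
  rcases hb.eq_or_lt with rfl | hb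
  · have h : Ioc 0 s ∩ Ici (0 : ℝ) = Ioc 0 s := by ext; simp; intros; linarith
    rw [h]; exact Ioc_ae_eq_Icc
  · have h : Ioc 0 s ∩ Ici b = Icc b s := by
      ext; simp; constructor
      · rintro ⟨⟨_, h⟩, h'⟩; exact ⟨h', h⟩
      · rintro ⟨h, h'⟩; exact ⟨⟨by linarith, h'⟩, h⟩
    exact Filter.EventuallyEq.of_eq h

theorem setIntegral_indicator_le {E : Type*} [NormedAddCommGroup E] [NormedSpace ℝ E]
    {f : ℝ → E} {b x : ℝ} (hb : 0 ≤ b) (hx : 0 ≤ x) :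
    ∫ α in Ioc 0 x, (Iic b).indicator f α = ∫ α in (0 : ℝ)..min x b, f α := by
  rw [intervalIntegral.integral_of_le (le_min hx hb),
    setIntegral_indicator measurableSet_Iic]
  congr 2
  ext; simp

variable {R : Type*} [NormedRing R] [NormedAlgebra ℝ R]

/-- The kernel of `(I + L)(I + K) - I`, for `K` an upper and `L` a lower triangular kernel. -/
def factoredKernel (K L : ℝ → ℝ → R) (x α : ℝ) : R :=
  (if x ≤ α then K x α else L x α) + ∫ β in (0 : ℝ)..min x α, L x β * K β α

/-- Fubini on the region β ≤ min x α. Since the lower triangular factor stands on the left, β never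
reaches past min x α, and the same kernel describes the product on every interval (0, s). -/
theorem integral_factoredKernel_mul [CompleteSpace R] {K L : ℝ → ℝ → R}
    (hK : Continuous (Function.uncurry K))
    (hL : Continuous (Function.uncurry L)) {d : ℝ → R} {s x : ℝ} (hx : x ∈ Ioo 0 s)
    (hd : IntervalIntegrable d volume 0 s) :
    ∫ α in (0 : ℝ)..s, factoredKernel K L x α * d α
      = (∫ α in x..s, K x α * d α) + (∫ α in (0 : ℝ)..x, L x α * d α)
        + ∫ β in (0 : ℝ)..x, L x β * ∫ α in β..s, K β α * d α := by
  have hs : 0 ≤ s := hx.1.le.trans hx.2.le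
  have hd0 : IntegrableOn d (Ioc 0 s) := (intervalIntegrable_iff_integrableOn_Ioc_of_le hs).1 hd
  have hKx : Continuous (K x) := hK.comp (Continuous.prodMk_right x)
  have hLx : Continuous (L x) := hL.comp (Continuous.prodMk_right x)
  have hd1 : IntervalIntegrable d volume 0 x := hd.mono_set (by
    rw [uIcc_of_le hs, uIcc_of_le hx.1.le]; exact Icc_subset_Icc_right hx.2.le)
  have hd2 : IntervalIntegrable d volume x s := hd.mono_set (by
    rw [uIcc_of_le hs, uIcc_of_le hx.2.le]; exact Icc_subset_Icc_left hx.1.le)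
  have hf : Continuous fun z : ℝ × ℝ => L x z.2 * K z.2 z.1 :=
    (hLx.comp continuous_snd).mul (hK.comp (by fun_prop : Continuous fun z : ℝ × ℝ => (z.2, z.1)))
  have hI := integrable_triangle_mul hf (a := x) hd0
  have hswap := integral_integral_swap (f := fun α β => {w : ℝ × ℝ | w.2 ≤ w.1}.indicator
    (fun w => L x w.2 * K w.2 w.1 * d w.1) (α, β)) hI
  have h1 : ∫ β in Ioc 0 x, ∫ α in Ioc 0 s,
      {w : ℝ × ℝ | w.2 ≤ w.1}.indicator (fun w => L x w.2 * K w.2 w.1 * d w.1) (α, β)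
      = ∫ β in (0 : ℝ)..x, L x β * ∫ α in β..s, K β α * d α := by
    rw [intervalIntegral.integral_of_le hx.1.le]
    refine setIntegral_congr_fun measurableSet_Ioc fun β hβ => ?_
    have : ∀ α, {w : ℝ × ℝ | w.2 ≤ w.1}.indicator (fun w => L x w.2 * K w.2 w.1 * d w.1) (α, β)
        = (Ici β).indicator (fun α => L x β * (K β α * d α)) α := by
      intro α; simp [indicator, mul_assoc]
    simp only [this]
    rw [setIntegral_indicator_ge hβ.1.le (hβ.2.trans hx.2.le)]
    simp only [intervalIntegral.integral_of_le (hβ.2.trans hx.2.le)]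
    refine integral_const_mul_of_integrable ?_
    exact And.left ((hd.mono_set (by
      rw [uIcc_of_le hs, uIcc_of_le (hβ.2.trans hx.2.le)]
      exact Icc_subset_Icc_left hβ.1.le)).continuousOn_mul
        (hK.comp (Continuous.prodMk_right β)).continuousOn)
  have h2 : ∀ α ∈ Ioc 0 s, ∫ β in Ioc 0 x,
      {w : ℝ × ℝ | w.2 ≤ w.1}.indicator (fun w => L x w.2 * K w.2 w.1 * d w.1) (α, β)
      = (∫ β in (0 : ℝ)..min x α, L x β * K β α) * d α := by
    intro α hα
    have : ∀ β, {w : ℝ × ℝ | w.2 ≤ w.1}.indicator (fun w => L x w.2 * K w.2 w.1 * d w.1) (α, β)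
        = (Iic α).indicator (fun β => L x β * K β α * d α) β := by
      intro α; simp [indicator]
    simp only [this]
    rw [setIntegral_indicator_le hα.1.le hx.1.le]
    simp only [intervalIntegral.integral_of_le (le_min hx.1.le hα.1.le)]
    refine integral_mul_const_of_integrable ?_
    exact ((hf.comp (Continuous.prodMk_right α)).intervalIntegrable _ _).1
  have h3 : ∫ α in (0 : ℝ)..s, (∫ β in (0 : ℝ)..min x α, L x β * K β α) * d α
      = ∫ β in (0 : ℝ)..x, L x β * ∫ α in β..s, K β α * d α := by
    rw [← h1, ← hswap, intervalIntegral.integral_of_le hs]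
    exact (setIntegral_congr_fun measurableSet_Ioc h2).symm
  have hi3 : IntervalIntegrable (fun α => (∫ β in (0 : ℝ)..min x α, L x β * K β α) * d α)
      volume 0 s := by
    rw [intervalIntegrable_iff_integrableOn_Ioc_of_le hs]
    exact (integrableOn_congr_fun h2 measurableSet_Ioc).1 hI.integral_prod_left
  have hi1 : IntervalIntegrable (fun α => (if x ≤ α then K x α else L x α) * d α) volume 0 x := by
    refine (hd1.continuousOn_mul hLx.continuousOn).congr_ae ?_
    rw [uIoc_of_le hx.1.le, ← restrict_Ioo_eq_restrict_Ioc]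
    filter_upwards [ae_restrict_mem measurableSet_Ioo] with α hα
    rw [if_neg (not_le.2 hα.2)]
  have hi2 : IntervalIntegrable (fun α => (if x ≤ α then K x α else L x α) * d α) volume x s := by
    refine (hd2.continuousOn_mul hKx.continuousOn).congr_ae ?_
    rw [uIoc_of_le hx.2.le]
    filter_upwards [ae_restrict_mem measurableSet_Ioc] with α hα
    rw [if_pos hα.1.le]
  have hs1 : ∫ α in (0 : ℝ)..s, (if x ≤ α then K x α else L x α) * d α
      = (∫ α in x..s, K x α * d α) + (∫ α in (0 : ℝ)..x, L x α * d α) := by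
    rw [← intervalIntegral.integral_add_adjacent_intervals hi1 hi2, add_comm]
    congr 1
    · refine intervalIntegral.integral_congr fun α hα => ?_
      rw [uIcc_of_le hx.2.le] at hα
      simp [hα.1]
    · refine intervalIntegral.integral_congr_ae ?_
      have : ∀ᵐ α : ℝ, α ≠ x := by simp [ae_iff]
      filter_upwards [this] with α hα hα'
      rw [uIoc_of_le hx.1.le] at hα'
      rw [if_neg (not_le.2 (lt_of_le_of_ne hα'.2 hα))]
  simp only [factoredKernel, add_mul]
  rw [intervalIntegral.integral_add (hi1.trans hi2) hi3, hs1, h3]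

/-- Apply I + L to (I + K)(I + m) = I: only the kernel of L is left, and it is zero for x < s.
Concretely, the inner integral equals -m - K and all terms containing L cancel. -/
theorem factoredKernel_resolvent [CompleteSpace R] {K L m : ℝ → ℝ → R} {T : ℝ}
    (hK : Continuous (Function.uncurry K)) (hL : Continuous (Function.uncurry L))
    (hm : Continuous (Function.uncurry m))
    (h : ∀ x s, 0 ≤ x → x ≤ s → s ≤ T → m x s + K x s + ∫ α in x..s, K x α * m α s = 0)
    {x s : ℝ} (hx : x ∈ Ioo 0 s) (hs : s ≤ T) :
    m x s + factoredKernel K L x s + ∫ α in (0 : ℝ)..s, factoredKernel K L x α * m α s = 0 := by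
  have hms : Continuous fun α => m α s := hm.comp (Continuous.prodMk_left s)
  have hKs : Continuous fun α => K α s := hK.comp (Continuous.prodMk_left s)
  have hLx : Continuous (L x) := hL.comp (Continuous.prodMk_right x)
  rw [integral_factoredKernel_mul hK hL hx (hms.intervalIntegrable _ _)]
  have h1 : ∫ β in (0 : ℝ)..x, L x β * ∫ α in β..s, K β α * m α s
      = ∫ β in (0 : ℝ)..x, (-(L x β * m β s) - L x β * K β s) := by
    refine intervalIntegral.integral_congr fun β hβ => ?_
    rw [uIcc_of_le hx.1.le] at hβ
    have := h β s hβ.1 (hβ.2.trans hx.2.le) hs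
    have h' : ∫ α in β..s, K β α * m α s = -m β s - K β s := by
      rw [eq_neg_of_add_eq_zero_right this]; abel
    simp only [h', mul_sub, mul_neg]
  have h3 : IntervalIntegrable (fun β => -(L x β * m β s)) volume 0 x :=
    (hLx.mul hms).neg.intervalIntegrable _ _
  have h4 : IntervalIntegrable (fun β => L x β * K β s) volume 0 x :=
    (hLx.mul hKs).intervalIntegrable _ _
  rw [h1, intervalIntegral.integral_sub h3 h4, intervalIntegral.integral_neg]
  have h2 := h x s hx.1.le hx.2.le hs
  simp only [factoredKernel, if_pos hx.2.le, min_eq_left hx.2.le]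
  rw [← h2]; abel

/-- The function y = (I + K)d satisfies y = -Ly, a forward Volterra equation, so y = 0. Then d = -Kd
is a backward Volterra equation. -/
theorem eq_zero_of_factoredKernel [CompleteSpace R] {K L : ℝ → ℝ → R}
    (hK : Continuous (Function.uncurry K)) (hL : Continuous (Function.uncurry L)) {d : ℝ → R}
    {s : ℝ} (hd : IntervalIntegrable d volume 0 s)
    (h : ∀ x ∈ Ioo 0 s, d x + ∫ α in (0 : ℝ)..s, factoredKernel K L x α * d α = 0) :
    ∀ x ∈ Ioo 0 s, d x = 0 := by
  rcases le_or_gt s 0 with hs0 | hs0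
  · intro x hx; exact absurd (hx.1.trans hx.2) (not_lt.2 hs0)
  have hd0 : IntegrableOn d (Ioc 0 s) :=
    (intervalIntegrable_iff_integrableOn_Ioc_of_le hs0.le).1 hd
  obtain ⟨M, hM⟩ : ∃ M, ∀ z ∈ Icc (0 : ℝ) s ×ˢ Icc (0 : ℝ) s, ‖Function.uncurry K z‖ ≤ M :=
    (isCompact_Icc.prod isCompact_Icc).exists_bound_of_continuousOn hK.continuousOn
  obtain ⟨N, hN⟩ : ∃ N, ∀ z ∈ Icc (0 : ℝ) s ×ˢ Icc (0 : ℝ) s, ‖Function.uncurry L z‖ ≤ N :=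
    (isCompact_Icc.prod isCompact_Icc).exists_bound_of_continuousOn hL.continuousOn
  have hKd : IntervalIntegrable (fun β => ∫ α in β..s, K β α * d α) volume 0 s := by
    have hI := (integrable_triangle_mul (f := fun z : ℝ × ℝ => K z.2 z.1)
      (hK.comp (by fun_prop : Continuous fun z : ℝ × ℝ => (z.2, z.1))) (a := s)
      hd0).integral_prod_right
    rw [intervalIntegrable_iff_integrableOn_Ioc_of_le hs0.le]
    refine (integrableOn_congr_fun (fun β hβ => ?_) measurableSet_Ioc).1 hI
    rw [← setIntegral_indicator_ge hβ.1.le hβ.2]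
    simp only [indicator, mem_ofPred_eq, mem_Ici]
  set y : ℝ → R := fun x => d x + ∫ α in x..s, K x α * d α with hy
  have hyi : IntervalIntegrable y volume 0 s := hd.add hKd
  have hsub : ∀ x ∈ Ioo 0 s, uIcc 0 x ⊆ uIcc 0 s := fun x hx => by
    rw [uIcc_of_le hs0.le, uIcc_of_le hx.1.le]; exact Icc_subset_Icc_right hx.2.le
  have hy0 : ∀ x ∈ Ioo 0 s, y x = 0 := by
    refine eq_zero_of_norm_le_mul_integral (M := N) hyi fun x hx => ?_
    have hLx : Continuous (L x) := hL.comp (Continuous.prodMk_right x)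
    have h1 := h x hx
    rw [integral_factoredKernel_mul hK hL hx hd] at h1
    have h2 : y x = -∫ β in (0 : ℝ)..x, L x β * y β := by
      simp only [hy, mul_add]
      rw [intervalIntegral.integral_add ((hd.mono_set (hsub x hx)).continuousOn_mul hLx.continuousOn)
        ((hKd.mono_set (hsub x hx)).continuousOn_mul hLx.continuousOn), eq_neg_iff_add_eq_zero,
        ← h1]
      abel
    rw [h2, norm_neg, ← intervalIntegral.integral_const_mul]
    refine intervalIntegral.norm_integral_le_of_norm_le hx.1.le
      (Filter.Eventually.of_forall fun β hβ => ?_) ((hyi.mono_set (hsub x hx)).norm.const_mul N)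
    exact (norm_mul_le _ _).trans (mul_le_mul_of_nonneg_right
      (hN (x, β) ⟨⟨hx.1.le, hx.2.le⟩, hβ.1.le, hβ.2.trans hx.2.le⟩) (norm_nonneg _))
  -- The reflection x = s - t turns the backward equation into a forward one, to which the same
  -- Gronwall inequality applies.
  have key : ∀ t ∈ Ioo 0 s, d (s - t) = 0 := by
    have hdr : IntervalIntegrable (fun t => d (s - t)) volume 0 s := by
      have := hd.comp_sub_left s
      simpa using this.symm
    refine eq_zero_of_norm_le_mul_integral (M := M) hdr fun t ht => ?_
    have ht' : s - t ∈ Ioo 0 s := ⟨by linarith [ht.2], by linarith [ht.1]⟩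
    have h1 := eq_neg_of_add_eq_zero_left (hy0 (s - t) ht')
    have h2 : ∫ β in (0 : ℝ)..t, ‖d (s - β)‖ = ∫ α in (s - t)..s, ‖d α‖ := by
      have := intervalIntegral.integral_comp_sub_left (a := 0) (b := t) (fun α => ‖d α‖) s
      simpa using this
    rw [h1, norm_neg, h2, ← intervalIntegral.integral_const_mul]
    refine intervalIntegral.norm_integral_le_of_norm_le ht'.2.le
      (Filter.Eventually.of_forall fun α hα => ?_) (IntervalIntegrable.const_mul ?_ M)
    · exact (norm_mul_le _ _).trans (mul_le_mul_of_nonneg_right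
        (hM (s - t, α) ⟨⟨ht'.1.le, ht'.2.le⟩, ht'.1.le.trans hα.1.le, hα.2⟩) (norm_nonneg _))
    · refine (hd.mono_set ?_).norm
      rw [uIcc_of_le hs0.le, uIcc_of_le ht'.2.le]; exact Icc_subset_Icc_left ht'.1.le
  intro x hx
  have := key (s - x) ⟨by linarith [hx.2], by linarith [hx.1]⟩
  simpa using this

end Volterra

/-! ### The Goursat problem with an integrable potential -/

section Goursat

variable {p : ℝ → ℝ}

/-- By translation invariance the bound does not depend on a or b. This uniformity does the work
that boundedness of p would otherwise do. -/
theorem abs_integral_comp_sub_mul_le (hp : Integrable p) {h : ℝ → ℝ} {C a b : ℝ} (hC0 : 0 ≤ C)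
    (hC : ∀ y ∈ uIoc 0 b, |h y| ≤ C) :
    |∫ y in (0 : ℝ)..b, p (a - y) * h y| ≤ C * ∫ y, |p y| := by
  have hi : Integrable fun y => C * |p (a - y)| := (hp.comp_sub_left a).abs.const_mul C
  calc ‖∫ y in (0 : ℝ)..b, p (a - y) * h y‖
      ≤ ∫ y in uIoc 0 b, ‖p (a - y) * h y‖ :=
        intervalIntegral.norm_integral_le_integral_norm_uIoc
    _ ≤ ∫ y in uIoc 0 b, C * |p (a - y)| := by
        refine integral_mono_of_nonneg (Filter.Eventually.of_forall fun _ => norm_nonneg _)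
          hi.integrableOn ?_
        filter_upwards [ae_restrict_mem measurableSet_uIoc] with y hy
        rw [norm_mul, mul_comm]
        exact mul_le_mul_of_nonneg_right (hC y hy) (abs_nonneg _)
    _ ≤ ∫ y, C * |p (a - y)| := setIntegral_le_integral hi
        (Filter.Eventually.of_forall fun _ => mul_nonneg hC0 (abs_nonneg _))
    _ = C * ∫ y, |p y| := by
        rw [integral_const_mul, integral_sub_left_eq_self (fun y => |p y|) volume a]

/-- The inner integral is continuous in its end point for each a, and bounded uniformly in a by a
multiple of the L₁ norm of p, so dominated convergence for parametric primitives applies. -/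
theorem continuous_integral_comp_sub_mul (hpm : Measurable p) (hp : Integrable p)
    {h : ℝ → ℝ → ℝ} (hh : Continuous (Function.uncurry h)) :
    Continuous fun z : ℝ × ℝ => ∫ a in (0 : ℝ)..z.1, ∫ b in (0 : ℝ)..z.2, p (a - b) * h a b := by
  have hJ : ∀ a, Continuous fun η => ∫ b in (0 : ℝ)..η, p (a - b) * h a b := by
    intro a
    refine intervalIntegral.continuous_primitive (fun c d => ?_) 0
    exact (hp.comp_sub_left a).intervalIntegrable.mul_continuousOn
      (hh.comp (Continuous.prodMk_right a)).continuousOn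
  have hJm : ∀ η, StronglyMeasurable fun a => ∫ b in (0 : ℝ)..η, p (a - b) * h a b := by
    intro η
    have hm : StronglyMeasurable fun z : ℝ × ℝ => p (z.1 - z.2) * h z.1 z.2 :=
      ((hpm.comp (measurable_fst.sub measurable_snd)).mul hh.measurable).stronglyMeasurable
    simp only [intervalIntegral]
    exact hm.integral_prod_right.sub hm.integral_prod_right
  have key : Continuous fun w : ℝ × ℝ =>
      ∫ a in (0 : ℝ)..w.2, ∫ b in (0 : ℝ)..w.1, p (a - b) * h a b := by
    rw [continuous_iff_continuousAt]
    rintro ⟨η₀, ξ₀⟩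
    set N : ℝ := |η₀| + 1
    set A : ℝ := |ξ₀| + 1
    obtain ⟨C, hC⟩ : ∃ C, ∀ z ∈ Icc (-A) A ×ˢ Icc (-N) N, ‖Function.uncurry h z‖ ≤ C :=
      (isCompact_Icc.prod isCompact_Icc).exists_bound_of_continuousOn hh.continuousOn
    have hA : 0 < A := by positivity
    have hN : 0 < N := by positivity
    have hC0 : 0 ≤ C := (norm_nonneg _).trans
      (hC (0, 0) ⟨⟨by linarith, by linarith⟩, by linarith, by linarith⟩)
    have hξ := abs_le.1 (le_refl |ξ₀|)
    refine intervalIntegral.continuousAt_parametric_primitive_of_dominated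
      (F := fun η a => ∫ b in (0 : ℝ)..η, p (a - b) * h a b) (fun _ => C * ∫ y, |p y|) (-A) A
      (fun η => (hJm η).aestronglyMeasurable) ?_ intervalIntegrable_const
      (Filter.Eventually.of_forall fun a => (hJ a).continuousAt) ?_ ?_ (by simp)
    · have : ∀ᶠ η in nhds η₀, |η| < N :=
        continuous_abs.continuousAt.eventually_lt continuousAt_const (by simp [N])
      filter_upwards [this] with η hη
      filter_upwards [ae_restrict_mem measurableSet_uIoc] with a ha
      rw [uIoc_of_le (by linarith)] at ha
      have hη' := abs_lt.1 hη
      refine abs_integral_comp_sub_mul_le hp hC0 fun y hy => hC (a, y) ⟨⟨ha.1.le, ha.2⟩, ?_⟩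
      rcases le_total 0 η with h0 | h0
      · rw [uIoc_of_le h0] at hy
        exact ⟨by linarith [hy.1], by linarith [hy.2]⟩
      · rw [uIoc_of_ge h0] at hy
        exact ⟨by linarith [hy.1], by linarith [hy.2]⟩
    · constructor <;> linarith
    · constructor <;> simp only [A] <;> linarith [hξ.1, hξ.2]
  exact key.comp continuous_swap

/-- The integration in η can cost the full norm P = ∫ |p|, so smallness comes from the one in ξ:
with u = exp(cξ) w the operator acting on w has norm at most P / c, below 1/2. Replacing ξ and η by
their positive parts lets it act on bounded functions on the whole plane. -/
theorem exists_goursat_solution (hpm : Measurable p) (hp : Integrable p) (cp cm : ℝ) :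
    ∃ u : ℝ → ℝ → ℝ, Continuous (Function.uncurry u) ∧ ∀ ξ η, 0 ≤ ξ → 0 ≤ η →
      u ξ η = -(1 / 2) * (cp * (∫ y in (0 : ℝ)..ξ, p y) + cm * ∫ y in (0 : ℝ)..η, p (-y))
        - ∫ a in (0 : ℝ)..ξ, ∫ b in (0 : ℝ)..η, p (a - b) * u a b := by
  set P : ℝ := ∫ y, |p y| with hP
  have hP0 : 0 ≤ P := integral_nonneg fun _ => abs_nonneg _
  set c : ℝ := 2 * (P + 1) with hc
  have hc0 : 0 < c := by positivity
  let g : ℝ × ℝ → ℝ := fun z =>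
    -(1 / 2) * (cp * (∫ y in (0 : ℝ)..z.1, p y) + cm * ∫ y in (0 : ℝ)..z.2, p (-y))
  have hgc : Continuous g := by
    have h1 := intervalIntegral.continuous_primitive
      (fun a b => hp.intervalIntegrable (a := a) (b := b)) 0
    have h2 := intervalIntegral.continuous_primitive
      (fun a b => hp.comp_neg.intervalIntegrable (a := a) (b := b)) 0
    exact continuous_const.mul ((continuous_const.mul (h1.comp continuous_fst)).add
      (continuous_const.mul (h2.comp continuous_snd)))
  have hgb : ∀ z, |g z| ≤ (|cp| + |cm|) * P := by
    intro z
    have h1 : ‖∫ y in (0 : ℝ)..z.1, p y‖ ≤ P := by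
      refine intervalIntegral.norm_integral_le_integral_norm_uIoc.trans ?_
      exact setIntegral_le_integral hp.norm (Filter.Eventually.of_forall fun _ => norm_nonneg _)
    have h2 : ‖∫ y in (0 : ℝ)..z.2, p (-y)‖ ≤ P := by
      refine intervalIntegral.norm_integral_le_integral_norm_uIoc.trans ?_
      rw [hP, ← integral_neg_eq_self (fun y => |p y|)]
      exact setIntegral_le_integral hp.comp_neg.norm
        (Filter.Eventually.of_forall fun _ => norm_nonneg _)
    have h3 := mul_le_mul_of_nonneg_left h1 (abs_nonneg cp)
    have h4 := mul_le_mul_of_nonneg_left h2 (abs_nonneg cm)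
    have h5 := abs_add_le (cp * ∫ y in (0 : ℝ)..z.1, p y) (cm * ∫ y in (0 : ℝ)..z.2, p (-y))
    rw [Real.norm_eq_abs] at h3 h4
    simp only [g]
    rw [abs_mul, abs_neg, abs_of_pos (by norm_num : (0 : ℝ) < 1 / 2)]
    rw [abs_mul, abs_mul] at h5
    have h6 : 0 ≤ (|cp| + |cm|) * P := by positivity
    linarith [h6]
  let I : BoundedContinuousFunction (ℝ × ℝ) ℝ → ℝ × ℝ → ℝ := fun u z =>
    ∫ a in (0 : ℝ)..max z.1 0, ∫ b in (0 : ℝ)..max z.2 0, p (a - b) * (Real.exp (c * a) * u (a, b))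
  have hIc : ∀ u, Continuous (I u) := by
    intro u
    have h := continuous_integral_comp_sub_mul hpm hp (h := fun a b => Real.exp (c * a) * u (a, b))
      (Continuous.mul (by fun_prop) u.continuous)
    exact h.comp (by fun_prop : Continuous fun z : ℝ × ℝ => (max z.1 0, max z.2 0))
  have hIsub : ∀ u v z, I u z - I v z = I (u - v) z := by
    intro u v z
    have h1 : ∀ (u : BoundedContinuousFunction (ℝ × ℝ) ℝ) a d, IntervalIntegrable
        (fun b => p (a - b) * (Real.exp (c * a) * u (a, b))) volume 0 d := fun u a d =>
      (hp.comp_sub_left a).intervalIntegrable.mul_continuousOn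
        (continuous_const.mul (u.continuous.comp (Continuous.prodMk_right a))).continuousOn
    have h2 : ∀ (u : BoundedContinuousFunction (ℝ × ℝ) ℝ) d e, IntervalIntegrable
        (fun a => ∫ b in (0 : ℝ)..d, p (a - b) * (Real.exp (c * a) * u (a, b))) volume 0 e := by
      intro u d e
      have hm : StronglyMeasurable fun z : ℝ × ℝ =>
          p (z.1 - z.2) * (Real.exp (c * z.1) * u z) :=
        ((hpm.comp (measurable_fst.sub measurable_snd)).mul
          (Continuous.mul (by fun_prop) u.continuous).measurable).stronglyMeasurable
      have hm' : StronglyMeasurable fun a =>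
          ∫ b in (0 : ℝ)..d, p (a - b) * (Real.exp (c * a) * u (a, b)) := by
        simp only [intervalIntegral]
        exact hm.integral_prod_right.sub hm.integral_prod_right
      refine (Continuous.intervalIntegrable (u := fun a => Real.exp (c * a) * ‖u‖ * P)
        (by fun_prop) 0 e).mono_fun hm'.aestronglyMeasurable
        (Filter.Eventually.of_forall fun a => ?_)
      refine (abs_integral_comp_sub_mul_le hp (by positivity) fun y _ => ?_).trans (le_abs_self _)
      rw [abs_mul, abs_of_pos (Real.exp_pos _)]
      exact mul_le_mul_of_nonneg_left (u.norm_coe_le_norm _) (Real.exp_pos _).le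
    simp only [I]
    rw [← intervalIntegral.integral_sub (h2 u _ _) (h2 v _ _)]
    refine intervalIntegral.integral_congr fun a _ => ?_
    rw [← intervalIntegral.integral_sub (h1 u _ _) (h1 v _ _)]
    simp [mul_sub]
  have hIb : ∀ u z, Real.exp (-(c * max z.1 0)) * |I u z| ≤ 1 / 2 * ‖u‖ := by
    intro u z
    set x := max z.1 0 with hx
    have hx0 : 0 ≤ x := le_max_right _ _
    have hle : ‖I u z‖ ≤ ∫ a in (0 : ℝ)..x, Real.exp (c * a) * ‖u‖ * P := by
      have hi : Continuous fun a => Real.exp (c * a) * ‖u‖ * P := by fun_prop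
      refine intervalIntegral.norm_integral_le_of_norm_le hx0
        (Filter.Eventually.of_forall fun a _ => ?_)
        (hi.intervalIntegrable _ _)
      refine abs_integral_comp_sub_mul_le hp (by positivity) fun y _ => ?_
      rw [abs_mul, abs_of_pos (Real.exp_pos _)]
      exact mul_le_mul_of_nonneg_left (u.norm_coe_le_norm _) (Real.exp_pos _).le
    have h3 : Real.exp (-(c * x)) * ∫ a in (0 : ℝ)..x, Real.exp (c * a) * ‖u‖ * P
        = (∫ a in (0 : ℝ)..x, Real.exp (-(c * a))) * (‖u‖ * P) := by
      rw [← intervalIntegral.integral_const_mul, ← intervalIntegral.integral_mul_const]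
      have := intervalIntegral.integral_comp_sub_left (a := 0) (b := x)
        (fun a => Real.exp (-(c * a)) * (‖u‖ * P)) x
      rw [sub_self, sub_zero] at this
      rw [← this]
      refine intervalIntegral.integral_congr fun a _ => ?_
      have he : Real.exp (-(c * (x - a))) = Real.exp (-(c * x)) * Real.exp (c * a) := by
        rw [← Real.exp_add]; congr 1; ring
      rw [he]; ring
    refine (mul_le_mul_of_nonneg_left hle (Real.exp_pos _).le).trans ?_
    rw [h3]
    refine (mul_le_mul_of_nonneg_right (integral_exp_neg_mul_le hc0) (by positivity)).trans ?_
    rw [mul_comm ‖u‖, ← mul_assoc]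
    refine mul_le_mul_of_nonneg_right ?_ (norm_nonneg _)
    rw [hc, div_mul_eq_mul_div, div_le_div_iff₀ (by positivity) (by norm_num)]
    linarith
  have hexp1 : ∀ x : ℝ, Real.exp (-(c * max x 0)) ≤ 1 := fun x => by
    rw [Real.exp_le_one_iff]
    have : 0 ≤ c * max x 0 := mul_nonneg hc0.le (le_max_right _ _)
    linarith
  obtain ⟨u, hu⟩ := exists_fixedPoint_boundedContinuous (fun u =>
    BoundedContinuousFunction.ofNormedAddCommGroup
      (fun z => Real.exp (-(c * max z.1 0)) * (g (max z.1 0, max z.2 0) - I u z))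
      (Continuous.mul (by fun_prop) ((hgc.comp (by fun_prop)).sub (hIc u)))
      ((|cp| + |cm|) * P + 1 / 2 * ‖u‖) (fun z => by
        rw [mul_sub]
        refine (norm_sub_le _ _).trans (add_le_add ?_ ?_)
        · rw [norm_mul, Real.norm_of_nonneg (Real.exp_pos _).le]
          exact (mul_le_mul (hexp1 _) (hgb _) (abs_nonneg _) zero_le_one).trans (by simp)
        · rw [norm_mul, Real.norm_of_nonneg (Real.exp_pos _).le]
          exact hIb u z)) (fun u v z => by
      have : ∀ e w : ℝ, e * (w - I u z) - e * (w - I v z) = -(e * I (u - v) z) := fun e w => by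
        rw [← hIsub]; ring
      simp only [BoundedContinuousFunction.coe_ofNormedAddCommGroup, this, norm_neg]
      rw [norm_mul, Real.norm_of_nonneg (Real.exp_pos _).le]
      exact hIb _ _)
  have hu' : ∀ z, u z = Real.exp (-(c * max z.1 0)) * (g (max z.1 0, max z.2 0) - I u z) :=
    fun z => by conv_lhs => rw [← hu]
                rfl
  refine ⟨fun ξ η => Real.exp (c * ξ) * u (ξ, η), ?_, ?_⟩
  · exact Continuous.mul (by fun_prop) u.continuous
  · intro ξ η hξ hη
    beta_reduce
    rw [hu']
    simp only [I, g, max_eq_left hξ, max_eq_left hη]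
    rw [← mul_assoc, ← Real.exp_add]
    simp

end Goursat

/-! ### Test functions in characteristic coordinates -/

section TestFunction

theorem continuous_comp_uncurry {Z E : Type*} [TopologicalSpace Z] [TopologicalSpace E]
    {f : ℝ → ℝ → E} (hf : Continuous (Function.uncurry f)) {g k : Z → ℝ} (hg : Continuous g)
    (hk : Continuous k) : Continuous fun z => f (g z) (k z) :=
  hf.comp (hg.prodMk hk)

/-- The wave operator `φ_tt - φ_xx`. -/
def wave (φ : ℝ → ℝ → ℝ) (x t : ℝ) : ℝ :=
  iteratedDeriv 2 (fun τ => φ x τ) t - iteratedDeriv 2 (fun y => φ y t) x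

variable {φ : ℝ → ℝ → ℝ}

theorem hasDerivAt_comp_line (hφ : ContDiff ℝ ∞ (Function.uncurry φ)) {γ : ℝ → ℝ × ℝ} {v : ℝ × ℝ}
    {s : ℝ} (hγ : HasDerivAt γ v s) :
    HasDerivAt (fun s => φ (γ s).1 (γ s).2) (fderiv ℝ (Function.uncurry φ) (γ s) v) s :=
  ((hφ.differentiable (by simp)).differentiableAt.hasFDerivAt).comp_hasDerivAt s hγ

theorem hasDerivAt_fderiv_comp_line (hφ : ContDiff ℝ ∞ (Function.uncurry φ)) {γ : ℝ → ℝ × ℝ}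
    {v : ℝ × ℝ} {s : ℝ} (hγ : HasDerivAt γ v s) (w : ℝ × ℝ) :
    HasDerivAt (fun s => fderiv ℝ (Function.uncurry φ) (γ s) w)
      (fderiv ℝ (fderiv ℝ (Function.uncurry φ)) (γ s) v w) s := by
  have h : ContDiff ℝ ∞ (fderiv ℝ (Function.uncurry φ)) := hφ.fderiv_right (by simp)
  have h1 := ((h.differentiable (by simp)).differentiableAt.hasFDerivAt).comp_hasDerivAt s hγ
  exact h1.clm_apply (hasDerivAt_const s w) |>.congr_deriv (by simp)

theorem deriv_fst_eq_fderiv (hφ : ContDiff ℝ ∞ (Function.uncurry φ)) (x t : ℝ) :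
    deriv (fun y => φ y t) x = fderiv ℝ (Function.uncurry φ) (x, t) (1, 0) :=
  (hasDerivAt_comp_line hφ (γ := fun y => (y, t)) (s := x)
    ((hasDerivAt_id x).prodMk (hasDerivAt_const x t))).deriv

theorem deriv_snd_eq_fderiv (hφ : ContDiff ℝ ∞ (Function.uncurry φ)) (x t : ℝ) :
    deriv (fun τ => φ x τ) t = fderiv ℝ (Function.uncurry φ) (x, t) (0, 1) :=
  (hasDerivAt_comp_line hφ (γ := fun y => (x, y)) (s := t)
    ((hasDerivAt_const t x).prodMk (hasDerivAt_id t))).deriv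

theorem wave_eq_fderiv (hφ : ContDiff ℝ ∞ (Function.uncurry φ)) (x t : ℝ) :
    wave φ x t = fderiv ℝ (fderiv ℝ (Function.uncurry φ)) (x, t) (0, 1) (0, 1)
      - fderiv ℝ (fderiv ℝ (Function.uncurry φ)) (x, t) (1, 0) (1, 0) := by
  have h1 : deriv (fun τ => φ x τ) = fun t => fderiv ℝ (Function.uncurry φ) (x, t) (0, 1) :=
    funext fun t => deriv_snd_eq_fderiv hφ x t
  have h2 : deriv (fun y => φ y t) = fun x => fderiv ℝ (Function.uncurry φ) (x, t) (1, 0) :=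
    funext fun x => deriv_fst_eq_fderiv hφ x t
  have h3 : ∀ f : ℝ → ℝ, iteratedDeriv 2 f = deriv (deriv f) := fun f => by
    rw [iteratedDeriv_succ, iteratedDeriv_one]
  rw [wave, h3, h3, h1, h2,
    (hasDerivAt_fderiv_comp_line hφ (γ := fun y => (x, y)) (s := t)
      ((hasDerivAt_const t x).prodMk (hasDerivAt_id t)) _).deriv,
    (hasDerivAt_fderiv_comp_line hφ (γ := fun y => (y, t)) (s := x)
      ((hasDerivAt_id x).prodMk (hasDerivAt_const x t)) _).deriv]

/-- The directions (1, 1) and (-1, 1) are ∂_ξ and ∂_η for x = ξ - η, t = ξ + η. The cross terms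
cancel by symmetry of the second derivative, so the wave operator is ∂_ξ∂_η. -/
theorem wave_eq_fderiv_characteristic (hφ : ContDiff ℝ ∞ (Function.uncurry φ)) (x t : ℝ) :
    fderiv ℝ (fderiv ℝ (Function.uncurry φ)) (x, t) (1, 1) (-1, 1) = wave φ x t ∧
      fderiv ℝ (fderiv ℝ (Function.uncurry φ)) (x, t) (-1, 1) (1, 1) = wave φ x t := by
  have hsymm : IsSymmSndFDerivAt ℝ (Function.uncurry φ) (x, t) :=
    hφ.contDiffAt.isSymmSndFDerivAt
    (by simpa using WithTop.coe_le_coe.2 (le_top : (2 : ℕ∞) ≤ ⊤))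
  have e1 : ((1, 1) : ℝ × ℝ) = (1, 0) + (0, 1) := by simp
  have e2 : ((-1, 1) : ℝ × ℝ) = -(1, 0) + (0, 1) := by simp
  have h := hsymm.eq (1, 0) (0, 1)
  constructor
  · rw [wave_eq_fderiv hφ, e1, e2]
    simp only [map_add, map_neg, add_apply]
    rw [h]; ring
  · rw [wave_eq_fderiv hφ, e1, e2]
    simp only [map_add, map_neg, add_apply, neg_apply]
    rw [h]; ring

theorem continuous_wave (hφ : ContDiff ℝ ∞ (Function.uncurry φ)) :
    Continuous (Function.uncurry (wave φ)) := by
  have h : ContDiff ℝ ∞ (fderiv ℝ (Function.uncurry φ)) := hφ.fderiv_right (by simp)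
  have h2 : Continuous (fderiv ℝ (fderiv ℝ (Function.uncurry φ))) := h.continuous_fderiv (by simp)
  have : Function.uncurry (wave φ) = fun z : ℝ × ℝ =>
      fderiv ℝ (fderiv ℝ (Function.uncurry φ)) z (0, 1) (0, 1)
      - fderiv ℝ (fderiv ℝ (Function.uncurry φ)) z (1, 0) (1, 0) := by
    ext z; exact wave_eq_fderiv hφ z.1 z.2
  rw [this]
  fun_prop

theorem continuous_fderiv_apply (hφ : ContDiff ℝ ∞ (Function.uncurry φ)) (w : ℝ × ℝ) :
    Continuous fun z => fderiv ℝ (Function.uncurry φ) z w :=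
  (hφ.continuous_fderiv (by simp)).clm_apply continuous_const

theorem hasDerivAt_right (ξ η : ℝ) :
    HasDerivAt (fun ξ : ℝ => ((ξ - η, ξ + η) : ℝ × ℝ)) (1, 1) ξ :=
  ((hasDerivAt_id ξ).sub_const η).prodMk ((hasDerivAt_id ξ).add_const η)

theorem hasDerivAt_left (ξ η : ℝ) :
    HasDerivAt (fun η : ℝ => ((ξ - η, ξ + η) : ℝ × ℝ)) (-1, 1) η :=
  ((hasDerivAt_id η).const_sub ξ).prodMk ((hasDerivAt_id η).const_add ξ)

/-- A test function: smooth, and zero outside the square of half side `R`. -/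
structure IsTest (φ : ℝ → ℝ → ℝ) (R : ℝ) : Prop where
  smooth : ContDiff ℝ ∞ (Function.uncurry φ)
  support : ∀ x t, R ≤ |x| ∨ R ≤ |t| → φ x t = 0
  fderiv_zero : ∀ x t, R ≤ |x| ∨ R ≤ |t| → fderiv ℝ (Function.uncurry φ) (x, t) = 0
  wave_zero : ∀ x t, R ≤ |x| ∨ R ≤ |t| → wave φ x t = 0

theorem exists_isTest (hφ : ContDiff ℝ ∞ (Function.uncurry φ))
    (hs : HasCompactSupport (Function.uncurry φ)) : ∃ R₀, ∀ R, R₀ ≤ R → IsTest φ R := by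
  obtain ⟨C, hC⟩ := hs.isBounded.exists_norm_le
  have hn : ∀ R, C + 1 ≤ R → ∀ x t : ℝ, R ≤ |x| ∨ R ≤ |t| →
      (x, t) ∉ tsupport (Function.uncurry φ) := by
    intro R hR x t h hmem
    have := hC _ hmem
    rw [Prod.norm_def] at this
    rcases h with h | h
    · have := (le_max_left _ _).trans this; rw [Real.norm_eq_abs] at this; linarith
    · have := (le_max_right _ _).trans this; rw [Real.norm_eq_abs] at this; simp at this; linarith
  have hz : ∀ z, z ∉ tsupport (Function.uncurry φ) → fderiv ℝ (Function.uncurry φ) z = 0 :=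
    fun z hz => image_eq_zero_of_notMem_tsupport fun h => hz (tsupport_fderiv_subset ℝ h)
  have hz2 : ∀ z, z ∉ tsupport (Function.uncurry φ) →
      fderiv ℝ (fderiv ℝ (Function.uncurry φ)) z = 0 := fun z hz =>
    image_eq_zero_of_notMem_tsupport fun h =>
      hz (tsupport_fderiv_subset ℝ (tsupport_fderiv_subset ℝ h))
  refine ⟨C + 1, fun R hR => ⟨hφ, fun x t h => ?_, fun x t h => hz _ (hn R hR x t h),
    fun x t h => ?_⟩⟩
  · exact image_eq_zero_of_notMem_tsupport (f := Function.uncurry φ) (hn R hR x t h)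
  · rw [wave_eq_fderiv hφ, hz2 _ (hn R hR x t h)]; simp

variable {R : ℝ}

/-- A test function supported in the square of half side R in (x, t) therefore vanishes for ξ ≥ R,
and the boundary terms at the upper limit R below are all zero. -/
theorem le_abs_or_of_le_fst {ξ η R : ℝ} (h : R ≤ ξ) : R ≤ |ξ - η| ∨ R ≤ |ξ + η| := by
  rcases le_total 0 η with h0 | h0
  · right; exact (by linarith : R ≤ ξ + η).trans (le_abs_self _)
  · left; exact (by linarith : R ≤ ξ - η).trans (le_abs_self _)

theorem le_abs_or_of_le_snd {ξ η R : ℝ} (h : R ≤ η) : R ≤ |ξ - η| ∨ R ≤ |ξ + η| := by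
  rw [add_comm, abs_sub_comm]; exact le_abs_or_of_le_fst h

namespace IsTest

theorem integral_wave_fst (h : IsTest φ R) (ξ η : ℝ) :
    ∫ a in ξ..R, wave φ (a - η) (a + η)
      = -fderiv ℝ (Function.uncurry φ) (ξ - η, ξ + η) (-1, 1) := by
  rw [intervalIntegral.integral_eq_sub_of_hasDerivAt
    (f := fun a => fderiv ℝ (Function.uncurry φ) (a - η, a + η) (-1, 1))]
  · simp [h.fderiv_zero _ _ (le_abs_or_of_le_fst (η := η) le_rfl)]
  · intro a _
    rw [← (wave_eq_fderiv_characteristic h.smooth _ _).1]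
    exact hasDerivAt_fderiv_comp_line h.smooth (hasDerivAt_right a η) (-1, 1)
  · exact (continuous_comp_uncurry (continuous_wave h.smooth) (by fun_prop)
      (by fun_prop)).intervalIntegrable _ _

theorem integral_wave_snd (h : IsTest φ R) (ξ η : ℝ) :
    ∫ b in η..R, wave φ (ξ - b) (ξ + b)
      = -fderiv ℝ (Function.uncurry φ) (ξ - η, ξ + η) (1, 1) := by
  rw [intervalIntegral.integral_eq_sub_of_hasDerivAt
    (f := fun b => fderiv ℝ (Function.uncurry φ) (ξ - b, ξ + b) (1, 1))]
  · simp [h.fderiv_zero _ _ (le_abs_or_of_le_snd (ξ := ξ) le_rfl)]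
  · intro b _
    rw [← (wave_eq_fderiv_characteristic h.smooth _ _).2]
    exact hasDerivAt_fderiv_comp_line h.smooth (hasDerivAt_left ξ b) (1, 1)
  · exact (continuous_comp_uncurry (continuous_wave h.smooth) (by fun_prop)
      (by fun_prop)).intervalIntegrable _ _

theorem integral_fderiv_fst (h : IsTest φ R) (ξ η : ℝ) :
    ∫ a in ξ..R, fderiv ℝ (Function.uncurry φ) (a - η, a + η) (1, 1) = -φ (ξ - η) (ξ + η) := by
  rw [intervalIntegral.integral_eq_sub_of_hasDerivAt (f := fun a => φ (a - η) (a + η))]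
  · simp [h.support _ _ (le_abs_or_of_le_fst (η := η) le_rfl)]
  · intro a _
    exact hasDerivAt_comp_line h.smooth (hasDerivAt_right a η)
  · exact ((continuous_fderiv_apply h.smooth (1, 1)).comp
      (by fun_prop : Continuous fun a => (a - η, a + η))).intervalIntegrable _ _

theorem integral_fderiv_snd (h : IsTest φ R) (ξ η : ℝ) :
    ∫ b in η..R, fderiv ℝ (Function.uncurry φ) (ξ - b, ξ + b) (-1, 1) = -φ (ξ - η) (ξ + η) := by
  rw [intervalIntegral.integral_eq_sub_of_hasDerivAt (f := fun b => φ (ξ - b) (ξ + b))]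
  · simp [h.support _ _ (le_abs_or_of_le_snd (ξ := ξ) le_rfl)]
  · intro b _
    exact hasDerivAt_comp_line h.smooth (hasDerivAt_left ξ b)
  · exact ((continuous_fderiv_apply h.smooth (-1, 1)).comp
      (by fun_prop : Continuous fun b => (ξ - b, ξ + b))).intervalIntegrable _ _

end IsTest

/-- Integration by parts in the form of Fubini on a triangle, so that f and g need only be
integrable. -/
theorem integral_primitive_mul {f g : ℝ → ℝ} {R : ℝ} (hR : 0 ≤ R)
    (hf : IntervalIntegrable f volume 0 R) (hg : IntervalIntegrable g volume 0 R) :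
    ∫ ξ in (0 : ℝ)..R, (∫ y in (0 : ℝ)..ξ, f y) * g ξ
      = ∫ y in (0 : ℝ)..R, f y * ∫ ξ in y..R, g ξ := by
  have hI : Integrable (fun z : ℝ × ℝ => {w : ℝ × ℝ | w.2 ≤ w.1}.indicator
      (fun w => f w.2 * g w.1) (z.1, z.2))
      ((volume.restrict (Ioc 0 R)).prod (volume.restrict (Ioc 0 R))) := by
    refine Integrable.indicator ?_ (measurableSet_le measurable_snd measurable_fst)
    have := (hg.1.mul_prod hf.1)
    exact this.congr (Filter.Eventually.of_forall fun z => mul_comm _ _)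
  have hswap := integral_integral_swap (f := fun ξ y => {w : ℝ × ℝ | w.2 ≤ w.1}.indicator
    (fun w => f w.2 * g w.1) (ξ, y)) hI
  rw [intervalIntegral.integral_of_le hR, intervalIntegral.integral_of_le hR]
  have h1 : ∀ ξ ∈ Ioc 0 R, ∫ y in Ioc 0 R, {w : ℝ × ℝ | w.2 ≤ w.1}.indicator
      (fun w => f w.2 * g w.1) (ξ, y) = (∫ y in (0 : ℝ)..ξ, f y) * g ξ := by
    intro ξ hξ
    have : ∀ y, {w : ℝ × ℝ | w.2 ≤ w.1}.indicator (fun w => f w.2 * g w.1) (ξ, y)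
        = (Iic ξ).indicator (fun y => f y * g ξ) y := by
      intro y; simp [indicator]
    simp only [this]
    rw [setIntegral_indicator_le hξ.1.le hR, min_eq_right hξ.2,
      intervalIntegral.integral_mul_const]
  have h2 : ∀ y ∈ Ioc 0 R, ∫ ξ in Ioc 0 R, {w : ℝ × ℝ | w.2 ≤ w.1}.indicator
      (fun w => f w.2 * g w.1) (ξ, y) = f y * ∫ ξ in y..R, g ξ := by
    intro y hy
    have : ∀ ξ, {w : ℝ × ℝ | w.2 ≤ w.1}.indicator (fun w => f w.2 * g w.1) (ξ, y)
        = (Ici y).indicator (fun ξ => f y * g ξ) ξ := by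
      intro ξ; simp [indicator]
    simp only [this]
    rw [setIntegral_indicator_ge hy.1.le hy.2, intervalIntegral.integral_const_mul]
  rw [← setIntegral_congr_fun measurableSet_Ioc h1, hswap]
  exact setIntegral_congr_fun measurableSet_Ioc h2

theorem intervalIntegral_swap {f : ℝ → ℝ → ℝ} {R C : ℝ} (hR : 0 ≤ R)
    (hf : AEStronglyMeasurable (Function.uncurry f)
      ((volume.restrict (Ioc 0 R)).prod (volume.restrict (Ioc 0 R))))
    (hC : ∀ a ∈ Ioc 0 R, ∀ b ∈ Ioc 0 R, ‖f a b‖ ≤ C) :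
    ∫ a in (0 : ℝ)..R, ∫ b in (0 : ℝ)..R, f a b = ∫ b in (0 : ℝ)..R, ∫ a in (0 : ℝ)..R, f a b := by
  simp only [intervalIntegral.integral_of_le hR]
  refine integral_integral_swap (Integrable.of_bound hf C ?_)
  rw [Measure.prod_restrict]
  filter_upwards [ae_restrict_mem (measurableSet_Ioc.prod measurableSet_Ioc)] with z hz
  exact hC _ hz.1 _ hz.2

theorem stronglyMeasurable_integral_comp_sub_mul {p : ℝ → ℝ} (hpm : Measurable p)
    {h : ℝ → ℝ → ℝ} (hh : Continuous (Function.uncurry h)) :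
    StronglyMeasurable fun z : ℝ × ℝ => ∫ b in (0 : ℝ)..z.2, p (z.1 - b) * h z.1 b := by
  have hm : StronglyMeasurable fun w : (ℝ × ℝ) × ℝ => p (w.1.1 - w.2) * h w.1.1 w.2 :=
    ((hpm.comp (by fun_prop)).mul (hh.comp (by fun_prop :
      Continuous fun w : (ℝ × ℝ) × ℝ => (w.1.1, w.2))).measurable).stronglyMeasurable
  have e : ∀ z : ℝ × ℝ, ∫ b in (0 : ℝ)..z.2, p (z.1 - b) * h z.1 b
      = (∫ b, {w : (ℝ × ℝ) × ℝ | w.2 ∈ Ioc 0 w.1.2}.indicator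
          (fun w => p (w.1.1 - w.2) * h w.1.1 w.2) (z, b))
        - ∫ b, {w : (ℝ × ℝ) × ℝ | w.2 ∈ Ioc w.1.2 0}.indicator
          (fun w => p (w.1.1 - w.2) * h w.1.1 w.2) (z, b) := by
    intro z
    rw [intervalIntegral, ← integral_indicator measurableSet_Ioc,
      ← integral_indicator measurableSet_Ioc]
    rfl
  simp only [e]
  have m1 : MeasurableSet {w : (ℝ × ℝ) × ℝ | w.2 ∈ Ioc 0 w.1.2} :=
    (measurableSet_lt measurable_const measurable_snd).inter
      (measurableSet_le measurable_snd measurable_fst.snd)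
  have m2 : MeasurableSet {w : (ℝ × ℝ) × ℝ | w.2 ∈ Ioc w.1.2 0} :=
    (measurableSet_lt measurable_fst.snd measurable_snd).inter
      (measurableSet_le measurable_snd measurable_const)
  exact (hm.indicator m1).integral_prod_right'.sub (hm.indicator m2).integral_prod_right'

theorem exists_bound_Icc_prod {h : ℝ → ℝ → ℝ} (hh : Continuous (Function.uncurry h)) (R : ℝ) :
    ∃ C, 0 ≤ C ∧ ∀ a ∈ Icc 0 R, ∀ b ∈ Icc 0 R, ‖h a b‖ ≤ C := by
  obtain ⟨C, hC⟩ : ∃ C, ∀ z ∈ Icc 0 R ×ˢ Icc 0 R, ‖Function.uncurry h z‖ ≤ C :=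
    (isCompact_Icc.prod isCompact_Icc).exists_bound_of_continuousOn hh.continuousOn
  exact ⟨max C 0, le_max_right _ _, fun a ha b hb => (hC (a, b) ⟨ha, hb⟩).trans (le_max_left _ _)⟩

theorem intervalIntegral_swap_of_continuous {f : ℝ → ℝ → ℝ}
    (hf : Continuous (Function.uncurry f)) {R : ℝ} (hR : 0 ≤ R) :
    ∫ a in (0 : ℝ)..R, ∫ b in (0 : ℝ)..R, f a b = ∫ b in (0 : ℝ)..R, ∫ a in (0 : ℝ)..R, f a b := by
  obtain ⟨C, -, hC⟩ := exists_bound_Icc_prod hf R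
  exact intervalIntegral_swap hR hf.aestronglyMeasurable
    (fun a ha b hb => hC a (Ioc_subset_Icc_self ha) b (Ioc_subset_Icc_self hb))

/-! ### The fundamental solution, tested weakly -/

section Identity

variable {p : ℝ → ℝ}

theorem intervalIntegrable_integral_comp_sub_mul (hpm : Measurable p) (hp : Integrable p)
    {h : ℝ → ℝ → ℝ} (hh : Continuous (Function.uncurry h)) {η R : ℝ} (hR : 0 ≤ R)
    (hη : η ∈ Icc 0 R) :
    IntervalIntegrable (fun a => ∫ b in (0 : ℝ)..η, p (a - b) * h a b) volume 0 R := by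
  obtain ⟨C, hC0, hC⟩ := exists_bound_Icc_prod hh R
  refine (intervalIntegrable_const (c := C * ∫ y, |p y|)).mono_fun'
    ((stronglyMeasurable_integral_comp_sub_mul hpm hh).comp_measurable
      (measurable_id.prodMk measurable_const)).aestronglyMeasurable ?_
  filter_upwards [ae_restrict_mem measurableSet_uIoc] with a ha
  rw [uIoc_of_le hR] at ha
  refine abs_integral_comp_sub_mul_le hp hC0 fun y hy => ?_
  rw [uIoc_of_le hη.1] at hy
  exact hC a ⟨ha.1.le, ha.2⟩ y ⟨hy.1.le, hy.2.trans hη.2⟩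

theorem intervalIntegrable_comp_sub_mul (hp : Integrable p) {h : ℝ → ℝ → ℝ}
    (hh : Continuous (Function.uncurry h)) (a c d : ℝ) :
    IntervalIntegrable (fun b => p (a - b) * h a b) volume c d :=
  (hp.comp_sub_left a).intervalIntegrable.mul_continuousOn
    (hh.comp (Continuous.prodMk_right a)).continuousOn

/-- Two integrations by parts, one in each characteristic variable, move both primitives onto ∂_ξ∂_η
φ and leave φ itself. The exchanges of integrals are justified by the uniform L₁ bound, since p(a -
b) is not continuous. -/
theorem integral_double_primitive_mul_wave (hpm : Measurable p) (hp : Integrable p)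
    {u : ℝ → ℝ → ℝ} (hu : Continuous (Function.uncurry u)) (hR : 0 ≤ R) (h : IsTest φ R) :
    ∫ ξ in (0 : ℝ)..R, ∫ η in (0 : ℝ)..R,
        (∫ a in (0 : ℝ)..ξ, ∫ b in (0 : ℝ)..η, p (a - b) * u a b) * wave φ (ξ - η) (ξ + η)
      = ∫ a in (0 : ℝ)..R, ∫ b in (0 : ℝ)..R, p (a - b) * u a b * φ (a - b) (a + b) := by
  have hW : Continuous fun z : ℝ × ℝ => wave φ (z.1 - z.2) (z.1 + z.2) :=
    continuous_comp_uncurry (continuous_wave h.smooth) (by fun_prop) (by fun_prop)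
  have hD : Continuous fun z : ℝ × ℝ => fderiv ℝ (Function.uncurry φ) (z.1 - z.2, z.1 + z.2) (-1, 1) :=
    (continuous_fderiv_apply h.smooth _).comp
      (by fun_prop : Continuous fun z : ℝ × ℝ => (z.1 - z.2, z.1 + z.2))
  have hDc : Continuous (Function.uncurry fun ξ η =>
      (∫ a in (0 : ℝ)..ξ, ∫ b in (0 : ℝ)..η, p (a - b) * u a b) * wave φ (ξ - η) (ξ + η)) :=
    Continuous.mul (continuous_integral_comp_sub_mul hpm hp hu) hW
  rw [intervalIntegral_swap_of_continuous hDc hR]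
  have e1 : ∀ η ∈ uIcc 0 R, ∫ ξ in (0 : ℝ)..R,
      (∫ a in (0 : ℝ)..ξ, ∫ b in (0 : ℝ)..η, p (a - b) * u a b) * wave φ (ξ - η) (ξ + η)
      = ∫ a in (0 : ℝ)..R, (∫ b in (0 : ℝ)..η, p (a - b) * u a b)
          * -fderiv ℝ (Function.uncurry φ) (a - η, a + η) (-1, 1) := by
    intro η hη
    rw [uIcc_of_le hR] at hη
    rw [integral_primitive_mul hR (intervalIntegrable_integral_comp_sub_mul hpm hp hu hR hη)
      (g := fun ξ => wave φ (ξ - η) (ξ + η))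
      ((hW.comp (Continuous.prodMk_left η)).intervalIntegrable _ _)]
    simp only [h.integral_wave_fst]
  rw [intervalIntegral.integral_congr e1]
  obtain ⟨C₂, hC₂0, hC₂⟩ := exists_bound_Icc_prod hu R
  obtain ⟨C₃, hC₃0, hC₃⟩ := exists_bound_Icc_prod (h := fun a b =>
    fderiv ℝ (Function.uncurry φ) (a - b, a + b) (-1, 1)) hD R
  rw [← intervalIntegral_swap (C := C₂ * (∫ y, |p y|) * C₃) (f := fun a η =>
      (∫ b in (0 : ℝ)..η, p (a - b) * u a b)
          * -fderiv ℝ (Function.uncurry φ) (a - η, a + η) (-1, 1)) hR]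
  · refine intervalIntegral.integral_congr fun a _ => ?_
    rw [integral_primitive_mul hR (intervalIntegrable_comp_sub_mul hp hu a 0 R)
      (g := fun b => -fderiv ℝ (Function.uncurry φ) (a - b, a + b) (-1, 1))
      ((hD.comp (Continuous.prodMk_right a)).neg.intervalIntegrable _ _)]
    refine intervalIntegral.integral_congr fun b _ => ?_
    have := h.integral_fderiv_snd a b
    rw [intervalIntegral.integral_neg, this, neg_neg]
  · exact StronglyMeasurable.aestronglyMeasurable (StronglyMeasurable.mul
      (stronglyMeasurable_integral_comp_sub_mul hpm hu) hD.neg.stronglyMeasurable)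
  · intro a ha b hb
    rw [norm_mul, norm_neg]
    refine mul_le_mul (abs_integral_comp_sub_mul_le hp hC₂0 fun y hy => ?_)
      (hC₃ a (Ioc_subset_Icc_self ha) b (Ioc_subset_Icc_self hb)) (norm_nonneg _)
      (mul_nonneg hC₂0 (integral_nonneg fun _ => abs_nonneg _))
    rw [uIoc_of_le hb.1.le] at hy
    exact hC₂ a (Ioc_subset_Icc_self ha) y ⟨hy.1.le, hy.2.trans hb.2⟩

/-- The primitive does not depend on η, so integrating the wave operator over η leaves minus the
derivative of φ along the ray η = 0; integration by parts along that ray does the rest. -/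
theorem integral_primitive_fst_mul_wave (hp : Integrable p) (hR : 0 ≤ R) (h : IsTest φ R) :
    ∫ ξ in (0 : ℝ)..R, ∫ η in (0 : ℝ)..R, (∫ y in (0 : ℝ)..ξ, p y) * wave φ (ξ - η) (ξ + η)
      = ∫ x in (0 : ℝ)..R, p x * φ x x := by
  have e1 : ∀ ξ, ∫ η in (0 : ℝ)..R, (∫ y in (0 : ℝ)..ξ, p y) * wave φ (ξ - η) (ξ + η)
      = (∫ y in (0 : ℝ)..ξ, p y) * -fderiv ℝ (Function.uncurry φ) (ξ, ξ) (1, 1) := by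
    intro ξ
    rw [intervalIntegral.integral_const_mul, h.integral_wave_snd ξ 0, sub_zero, add_zero]
  have hc : Continuous fun ξ => -fderiv ℝ (Function.uncurry φ) (ξ, ξ) (1, 1) :=
    ((continuous_fderiv_apply h.smooth _).comp
      (by fun_prop : Continuous fun ξ : ℝ => (ξ, ξ))).neg
  simp only [e1]
  rw [integral_primitive_mul hR hp.intervalIntegrable (hc.intervalIntegrable _ _)]
  refine intervalIntegral.integral_congr fun y _ => ?_
  have := h.integral_fderiv_fst y 0
  simp only [sub_zero, add_zero] at this
  rw [intervalIntegral.integral_neg, this, neg_neg]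

theorem integral_primitive_snd_mul_wave (hp : Integrable p) (hR : 0 ≤ R) (h : IsTest φ R) :
    ∫ ξ in (0 : ℝ)..R, ∫ η in (0 : ℝ)..R, (∫ y in (0 : ℝ)..η, p (-y)) * wave φ (ξ - η) (ξ + η)
      = ∫ x in (0 : ℝ)..R, p (-x) * φ (-x) x := by
  have hW : Continuous fun z : ℝ × ℝ => wave φ (z.1 - z.2) (z.1 + z.2) :=
    continuous_comp_uncurry (continuous_wave h.smooth) (by fun_prop) (by fun_prop)
  have hP : Continuous fun η => ∫ y in (0 : ℝ)..η, p (-y) :=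
    intervalIntegral.continuous_primitive
      (fun a b => hp.comp_neg.intervalIntegrable (a := a) (b := b)) 0
  have hc1 : Continuous (Function.uncurry fun ξ η =>
      (∫ y in (0 : ℝ)..η, p (-y)) * wave φ (ξ - η) (ξ + η)) :=
    Continuous.mul (hP.comp continuous_snd) hW
  rw [intervalIntegral_swap_of_continuous hc1 hR]
  have e1 : ∀ η, ∫ ξ in (0 : ℝ)..R, (∫ y in (0 : ℝ)..η, p (-y)) * wave φ (ξ - η) (ξ + η)
      = (∫ y in (0 : ℝ)..η, p (-y)) * -fderiv ℝ (Function.uncurry φ) (-η, η) (-1, 1) := by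
    intro η
    rw [intervalIntegral.integral_const_mul, h.integral_wave_fst 0 η, zero_sub, zero_add]
  have hc : Continuous fun η => -fderiv ℝ (Function.uncurry φ) (-η, η) (-1, 1) :=
    ((continuous_fderiv_apply h.smooth _).comp
      (by fun_prop : Continuous fun ξ : ℝ => (-ξ, ξ))).neg
  simp only [e1]
  rw [integral_primitive_mul hR hp.comp_neg.intervalIntegrable (hc.intervalIntegrable _ _)]
  refine intervalIntegral.integral_congr fun y _ => ?_
  have := h.integral_fderiv_snd 0 y
  simp only [zero_sub, zero_add] at this
  rw [intervalIntegral.integral_neg, this, neg_neg]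

theorem intervalIntegrable_of_continuous_prod {f : ℝ → ℝ → ℝ}
    (hf : Continuous (Function.uncurry f)) {R : ℝ} :
    IntervalIntegrable (fun ξ => ∫ η in (0 : ℝ)..R, f ξ η) volume 0 R :=
  (intervalIntegral.continuous_parametric_intervalIntegral_of_continuous hf
    continuous_const).intervalIntegrable _ _

/-- The Goursat kernel `u`, together with the singular part carried by the characteristics through
the origin, is a fundamental solution of the wave operator with potential `p`. -/
theorem goursat_weak_identity (hpm : Measurable p) (hp : Integrable p) {cp cm : ℝ}
    {u : ℝ → ℝ → ℝ} (hu : Continuous (Function.uncurry u))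
    (hg : ∀ ξ η, 0 ≤ ξ → 0 ≤ η →
      u ξ η = -(1 / 2) * (cp * (∫ y in (0 : ℝ)..ξ, p y) + cm * ∫ y in (0 : ℝ)..η, p (-y))
        - ∫ a in (0 : ℝ)..ξ, ∫ b in (0 : ℝ)..η, p (a - b) * u a b)
    (hR : 0 ≤ R) (h : IsTest φ R) :
    2 * (∫ ξ in (0 : ℝ)..R, ∫ η in (0 : ℝ)..R,
        u ξ η * (wave φ (ξ - η) (ξ + η) + p (ξ - η) * φ (ξ - η) (ξ + η)))
      + cp * (∫ x in (0 : ℝ)..R, (wave φ x x + p x * φ x x))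
      + cm * (∫ x in (0 : ℝ)..R, (wave φ (-x) x + p (-x) * φ (-x) x))
      = -cp * fderiv ℝ (Function.uncurry φ) (0, 0) (-1, 1)
        - cm * fderiv ℝ (Function.uncurry φ) (0, 0) (1, 1) := by
  have hW : Continuous fun z : ℝ × ℝ => wave φ (z.1 - z.2) (z.1 + z.2) :=
    continuous_comp_uncurry (continuous_wave h.smooth) (by fun_prop) (by fun_prop)
  have hφ : Continuous fun z : ℝ × ℝ => φ (z.1 - z.2) (z.1 + z.2) :=
    continuous_comp_uncurry h.smooth.continuous (by fun_prop) (by fun_prop)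
  have hP1 : Continuous fun ξ => ∫ y in (0 : ℝ)..ξ, p y :=
    intervalIntegral.continuous_primitive (fun a b => hp.intervalIntegrable (a := a) (b := b)) 0
  have hP2 : Continuous fun η => ∫ y in (0 : ℝ)..η, p (-y) :=
    intervalIntegral.continuous_primitive
      (fun a b => hp.comp_neg.intervalIntegrable (a := a) (b := b)) 0
  have huφ : Continuous (Function.uncurry fun ξ η => u ξ η * φ (ξ - η) (ξ + η)) := hu.mul hφ
  set A : ℝ → ℝ → ℝ := fun ξ η => (∫ y in (0 : ℝ)..ξ, p y) * wave φ (ξ - η) (ξ + η) with hA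
  set B : ℝ → ℝ → ℝ := fun ξ η => (∫ y in (0 : ℝ)..η, p (-y)) * wave φ (ξ - η) (ξ + η) with hB
  set D : ℝ → ℝ → ℝ := fun ξ η =>
    (∫ a in (0 : ℝ)..ξ, ∫ b in (0 : ℝ)..η, p (a - b) * u a b) * wave φ (ξ - η) (ξ + η) with hD
  set E : ℝ → ℝ → ℝ := fun ξ η => p (ξ - η) * (u ξ η * φ (ξ - η) (ξ + η)) with hE
  have hAc : Continuous (Function.uncurry A) :=
    Continuous.mul (hP1.comp continuous_fst) hW
  have hBc : Continuous (Function.uncurry B) :=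
    Continuous.mul (hP2.comp continuous_snd) hW
  have hDc : Continuous (Function.uncurry D) :=
    Continuous.mul (continuous_integral_comp_sub_mul hpm hp hu) hW
  have hsplit : ∫ ξ in (0 : ℝ)..R, ∫ η in (0 : ℝ)..R,
        u ξ η * (wave φ (ξ - η) (ξ + η) + p (ξ - η) * φ (ξ - η) (ξ + η))
      = -(1 / 2) * cp * (∫ ξ in (0 : ℝ)..R, ∫ η in (0 : ℝ)..R, A ξ η)
        + -(1 / 2) * cm * (∫ ξ in (0 : ℝ)..R, ∫ η in (0 : ℝ)..R, B ξ η)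
        - (∫ ξ in (0 : ℝ)..R, ∫ η in (0 : ℝ)..R, D ξ η)
        + ∫ ξ in (0 : ℝ)..R, ∫ η in (0 : ℝ)..R, E ξ η := by
    rw [← intervalIntegral.integral_const_mul, ← intervalIntegral.integral_const_mul,
      ← intervalIntegral.integral_add
        ((intervalIntegrable_of_continuous_prod hAc).const_mul _)
        ((intervalIntegrable_of_continuous_prod hBc).const_mul _),
      ← intervalIntegral.integral_sub
        (((intervalIntegrable_of_continuous_prod hAc).const_mul _).add
        ((intervalIntegrable_of_continuous_prod hBc).const_mul _))
        (intervalIntegrable_of_continuous_prod hDc),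
      ← intervalIntegral.integral_add
        ((((intervalIntegrable_of_continuous_prod hAc).const_mul _).add
        ((intervalIntegrable_of_continuous_prod hBc).const_mul _)).sub
        (intervalIntegrable_of_continuous_prod hDc))
        (intervalIntegrable_integral_comp_sub_mul hpm hp huφ hR ⟨hR, le_rfl⟩)]
    refine intervalIntegral.integral_congr fun ξ hξ => ?_
    rw [uIcc_of_le hR] at hξ
    have iA : IntervalIntegrable (A ξ) volume 0 R :=
      (hAc.comp (Continuous.prodMk_right ξ)).intervalIntegrable _ _
    have iB : IntervalIntegrable (B ξ) volume 0 R :=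
      (hBc.comp (Continuous.prodMk_right ξ)).intervalIntegrable _ _
    have iD : IntervalIntegrable (D ξ) volume 0 R :=
      (hDc.comp (Continuous.prodMk_right ξ)).intervalIntegrable _ _
    have iE : IntervalIntegrable (E ξ) volume 0 R :=
      intervalIntegrable_comp_sub_mul hp huφ ξ 0 R
    rw [← intervalIntegral.integral_const_mul, ← intervalIntegral.integral_const_mul,
      ← intervalIntegral.integral_add (iA.const_mul _) (iB.const_mul _),
      ← intervalIntegral.integral_sub ((iA.const_mul _).add (iB.const_mul _)) iD,
      ← intervalIntegral.integral_add (((iA.const_mul _).add (iB.const_mul _)).sub iD) iE]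
    refine intervalIntegral.integral_congr fun η hη => ?_
    rw [uIcc_of_le hR] at hη
    simp only [hA, hB, hD, hE]
    have := hg ξ η hξ.1 hη.1
    rw [mul_add]
    -- Only the u multiplying the wave operator is expanded; the u multiplying p φ must stay in
    -- order to cancel against the double primitive.
    nth_rw 1 [this]
    ring
  -- This cancellation is the equation u_ξη = -p u in weak form. The single primitives will likewise
  -- cancel p φ on the two rays, so that only derivatives of φ at the origin survive.
  have hE' : ∫ ξ in (0 : ℝ)..R, ∫ η in (0 : ℝ)..R, D ξ η
      = ∫ ξ in (0 : ℝ)..R, ∫ η in (0 : ℝ)..R, E ξ η := by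
    rw [integral_double_primitive_mul_wave hpm hp hu hR h]
    simp only [hE, mul_assoc]
  have hl1 : ∫ x in (0 : ℝ)..R, (wave φ x x + p x * φ x x)
      = -fderiv ℝ (Function.uncurry φ) (0, 0) (-1, 1) + ∫ x in (0 : ℝ)..R, p x * φ x x := by
    have h1 := h.integral_wave_fst 0 0
    simp only [sub_zero, add_zero] at h1
    rw [intervalIntegral.integral_add, h1]
    · exact (continuous_comp_uncurry (continuous_wave h.smooth) (by fun_prop)
      (by fun_prop)).intervalIntegrable _ _
    · exact hp.intervalIntegrable.mul_continuousOn
        (continuous_comp_uncurry h.smooth.continuous (by fun_prop)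
        (by fun_prop)).continuousOn
  have hl2 : ∫ x in (0 : ℝ)..R, (wave φ (-x) x + p (-x) * φ (-x) x)
      = -fderiv ℝ (Function.uncurry φ) (0, 0) (1, 1) + ∫ x in (0 : ℝ)..R, p (-x) * φ (-x) x := by
    have h1 := h.integral_wave_snd 0 0
    simp only [sub_zero, add_zero, zero_sub, zero_add] at h1
    rw [intervalIntegral.integral_add, h1]
    · exact (continuous_comp_uncurry (continuous_wave h.smooth) (by fun_prop)
      (by fun_prop)).intervalIntegrable _ _
    · exact hp.comp_neg.intervalIntegrable.mul_continuousOn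
        (continuous_comp_uncurry h.smooth.continuous (by fun_prop)
        (by fun_prop)).continuousOn
  rw [hsplit, hE', hl1, hl2, integral_primitive_fst_mul_wave hp hR h,
    integral_primitive_snd_mul_wave hp hR h]
  ring

end Identity

end TestFunction

/-! ### Bounded operators between L₂ spaces given by pointwise formulas -/

section LpOperator

variable {α β E F : Type*} [MeasurableSpace α] [MeasurableSpace β] [NormedAddCommGroup E]
  [NormedSpace ℝ E] [NormedAddCommGroup F] [NormedSpace ℝ F] {μ : Measure α} {ν : Measure β}

theorem exists_continuousLinearMap_Lp (Ψ : Lp E 2 ν → α → F) (C : NNReal)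
    (hm : ∀ f, AEStronglyMeasurable (Ψ f) μ)
    (hadd : ∀ f g, Ψ (f + g) =ᵐ[μ] Ψ f + Ψ g)
    (hsmul : ∀ (c : ℝ) f, Ψ (c • f) =ᵐ[μ] c • Ψ f)
    (hb : ∀ f, eLpNorm (Ψ f) 2 μ ≤ C * ‖f‖ₑ) :
    ∃ A : Lp E 2 ν →L[ℝ] Lp F 2 μ, ∀ f, A f =ᵐ[μ] Ψ f := by
  have hL : ∀ f, MemLp (Ψ f) 2 μ := fun f =>
    ⟨hm f, (hb f).trans_lt (ENNReal.mul_lt_top ENNReal.coe_lt_top enorm_lt_top)⟩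
  let A₀ : Lp E 2 ν →ₗ[ℝ] Lp F 2 μ :=
    { toFun := fun f => (hL f).toLp _
      map_add' := fun f g => by
        rw [← MemLp.toLp_add]
        exact (MemLp.toLp_eq_toLp_iff _ _).2 (hadd f g)
      map_smul' := fun c f => by
        rw [RingHom.id_apply, ← MemLp.toLp_const_smul]
        exact (MemLp.toLp_eq_toLp_iff _ _).2 (hsmul c f) }
  refine ⟨A₀.mkContinuous C fun f => ?_, fun f => MemLp.coeFn_toLp (hL f)⟩
  change ‖(hL f).toLp _‖ ≤ _
  rw [Lp.norm_toLp]
  refine ENNReal.toReal_le_of_le_ofReal (by positivity) ((hb f).trans ?_)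
  rw [ENNReal.ofReal_mul (by positivity), ENNReal.ofReal_coe_nnreal, ofReal_norm]

/-- The kernel is dominated by a product a(x) b(s), so Cauchy–Schwarz in s bounds the operator norm
by the product of the L₂ norms of a and b. -/
theorem exists_kernelOperator [SFinite ν] {κ : α → β → (E →L[ℝ] F)}
    (hκ : StronglyMeasurable (Function.uncurry κ)) {a : α → ℝ} {b : β → ℝ} (ha : MemLp a 2 μ)
    (hb : MemLp b 2 ν) (ha0 : ∀ x, 0 ≤ a x) (hb0 : ∀ s, 0 ≤ b s)
    (hab : ∀ x s, ‖κ x s‖ ≤ a x * b s) :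
    ∃ A : Lp E 2 ν →L[ℝ] Lp F 2 μ, ∀ g, A g =ᵐ[μ] fun x => ∫ s, κ x s (g s) ∂ν := by
  have hbg : ∀ g : Lp E 2 ν, Integrable (fun s => b s * ‖g s‖) ν := fun g =>
    hb.integrable_mul (Lp.memLp g).norm
  have hmx : ∀ (g : Lp E 2 ν) x, AEStronglyMeasurable (fun s => κ x s (g s)) ν := fun g x =>
    isBoundedBilinearMap_apply.continuous.comp_aestronglyMeasurable
      ((hκ.comp_measurable measurable_prodMk_left).aestronglyMeasurable.prodMk
        (Lp.aestronglyMeasurable g))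
  have hle : ∀ (g : Lp E 2 ν) x s, ‖κ x s (g s)‖ ≤ a x * (b s * ‖g s‖) := fun g x s => by
    rw [← mul_assoc]
    exact ((κ x s).le_opNorm _).trans (mul_le_mul_of_nonneg_right (hab x s) (norm_nonneg _))
  have hi : ∀ (g : Lp E 2 ν) x, Integrable (fun s => κ x s (g s)) ν := fun g x =>
    ((hbg g).const_mul (a x)).mono' (hmx g x) (Filter.Eventually.of_forall (hle g x))
  have hCS : ∀ g : Lp E 2 ν, ∫ s, b s * ‖g s‖ ∂ν ≤ (eLpNorm b 2 ν).toReal * ‖g‖ := by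
    intro g
    have h1 := integral_mul_le_Lp_mul_Lq_of_nonneg (μ := ν) (p := 2) (q := 2) (f := b)
      (g := fun s => ‖g s‖) Real.HolderConjugate.two_two (Filter.Eventually.of_forall hb0)
      (Filter.Eventually.of_forall fun _ => norm_nonneg _) (by simpa using hb)
      (by simpa using (Lp.memLp g).norm)
    refine h1.trans (le_of_eq ?_)
    congr 1
    · rw [hb.eLpNorm_eq_integral_rpow_norm (by simp) (by simp), ENNReal.toReal_ofReal (by positivity)]
      simp
    · rw [Lp.norm_def, (Lp.memLp g).eLpNorm_eq_integral_rpow_norm (by simp) (by simp),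
        ENNReal.toReal_ofReal (by positivity)]
      simp
  refine exists_continuousLinearMap_Lp (fun g x => ∫ s, κ x s (g s) ∂ν)
    ((eLpNorm b 2 ν).toNNReal * (eLpNorm a 2 μ).toNNReal) (fun g => ?_) (fun f g => ?_)
    (fun c g => ?_) (fun g => ?_)
  · have : AEStronglyMeasurable (fun z : α × β => κ z.1 z.2 (g z.2)) (μ.prod ν) :=
      isBoundedBilinearMap_apply.continuous.comp_aestronglyMeasurable
        (hκ.aestronglyMeasurable.prodMk (Lp.aestronglyMeasurable g).comp_snd)
    exact this.integral_prod_right'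
  · refine Filter.Eventually.of_forall fun x => ?_
    simp only [Pi.add_apply]
    rw [← integral_add (hi f x) (hi g x)]
    refine integral_congr_ae ?_
    filter_upwards [Lp.coeFn_add f g] with s hs
    rw [hs, Pi.add_apply, map_add]
  · refine Filter.Eventually.of_forall fun x => ?_
    simp only [Pi.smul_apply]
    rw [← integral_smul]
    refine integral_congr_ae ?_
    filter_upwards [Lp.coeFn_smul c g] with s hs
    rw [hs, Pi.smul_apply, map_smul]
  · have h1 : ∀ x, ‖∫ s, κ x s (g s) ∂ν‖ ≤ ((eLpNorm b 2 ν).toReal * ‖g‖) * ‖a x‖ := by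
      intro x
      refine (norm_integral_le_of_norm_le ((hbg g).const_mul (a x))
        (Filter.Eventually.of_forall (hle g x))).trans ?_
      rw [integral_const_mul, mul_comm, Real.norm_of_nonneg (ha0 x)]
      exact mul_le_mul_of_nonneg_right (hCS g) (ha0 x)
    refine (eLpNorm_le_mul_eLpNorm_of_ae_le_mul (Filter.Eventually.of_forall h1) 2).trans
      (le_of_eq ?_)
    rw [ENNReal.ofReal_mul ENNReal.toReal_nonneg, ENNReal.ofReal_toReal hb.2.ne,
      ofReal_norm, ENNReal.coe_mul, ENNReal.coe_toNNReal hb.2.ne,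
      ENNReal.coe_toNNReal ha.2.ne]
    ring

theorem exists_extendByZero {s : Set α} (hs : MeasurableSet s) :
    ∃ A : Lp E 2 (μ.restrict s) →L[ℝ] Lp E 2 μ, ∀ f, A f =ᵐ[μ] s.indicator f := by
  refine exists_continuousLinearMap_Lp (fun f => s.indicator f) 1 (fun f => ?_) (fun f g => ?_)
    (fun c f => ?_) (fun f => ?_)
  · exact (aestronglyMeasurable_indicator_iff hs).2 (Lp.aestronglyMeasurable f)
  · rw [← indicator_add']
    exact (ae_eq_restrict_iff_indicator_ae_eq hs).1 (Lp.coeFn_add f g)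
  · have h : c • s.indicator (f : α → E) = s.indicator (c • (f : α → E)) :=
      (indicator_const_smul s c f).symm
    rw [h]
    exact (ae_eq_restrict_iff_indicator_ae_eq hs).1 (Lp.coeFn_smul c f)
  · rw [eLpNorm_indicator_eq_eLpNorm_restrict hs, Lp.enorm_def]
    simp

/-- The preimage of a null set S lies in S ∪ -S. This carries almost everywhere identities through x
↦ |x|, which does not preserve measure. -/
theorem quasiMeasurePreserving_abs :
    Measure.QuasiMeasurePreserving (fun x : ℝ => |x|) volume volume := by
  refine ⟨by fun_prop, Measure.AbsolutelyContinuous.mk fun s hs h0 => ?_⟩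
  rw [Measure.map_apply (by fun_prop) hs]
  have h1 : volume ((fun x : ℝ => -x) ⁻¹' s) = 0 := by
    rw [(Measure.measurePreserving_neg volume).measure_preimage hs.nullMeasurableSet, h0]
  refine measure_mono_null (fun x hx => ?_) (measure_union_null h0 h1)
  rcases abs_choice x with h | h
  · left; simpa [h] using hx
  · right; simpa [h] using hx

/-- Boundedness follows from |g(|x|)| ≤ |g(x)| + |g(-x)|; this is where the factor 2 comes from. -/
theorem exists_evenExtension {c : ℝ → ℝ} (hc : Measurable c) {C : NNReal} (hC : ∀ x, |c x| ≤ C) :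
    ∃ A : Lp ℝ 2 (volume : Measure ℝ) →L[ℝ] Lp ℝ 2 (volume : Measure ℝ),
      ∀ g, A g =ᵐ[volume] fun x => c x * g |x| := by
  have hneg : MeasurePreserving (fun x : ℝ => -x) volume volume :=
    Measure.measurePreserving_neg volume
  refine exists_continuousLinearMap_Lp (fun g x => c x * g |x|) (C * 2) (fun g => ?_)
    (fun f g => ?_) (fun r g => ?_) (fun g => ?_)
  · exact hc.aestronglyMeasurable.mul
      ((Lp.aestronglyMeasurable g).comp_quasiMeasurePreserving quasiMeasurePreserving_abs)
  · filter_upwards [quasiMeasurePreserving_abs.ae (Lp.coeFn_add f g)] with x hx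
    simp only [Pi.add_apply] at hx ⊢
    rw [hx]; ring
  · filter_upwards [quasiMeasurePreserving_abs.ae (Lp.coeFn_smul r g)] with x hx
    simp only [Pi.smul_apply, smul_eq_mul] at hx ⊢
    rw [hx]; ring
  · have hg := Lp.aestronglyMeasurable g
    have h1 : ∀ x, ‖c x * g |x|‖ ≤ C * ‖(fun y => ‖g y‖ + ‖g (-y)‖) x‖ := by
      intro x
      rw [norm_mul]
      refine mul_le_mul (hC x) ?_ (norm_nonneg _) C.2
      change ‖g |x|‖ ≤ ‖(‖g x‖ + ‖g (-x)‖)‖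
      rw [Real.norm_of_nonneg (add_nonneg (norm_nonneg _) (norm_nonneg _))]
      rcases abs_choice x with h | h <;> rw [h]
      · exact le_add_of_nonneg_right (norm_nonneg _)
      · exact le_add_of_nonneg_left (norm_nonneg _)
    refine (eLpNorm_le_mul_eLpNorm_of_ae_le_mul (Filter.Eventually.of_forall h1) 2).trans ?_
    rw [ENNReal.ofReal_coe_nnreal, ENNReal.coe_mul, mul_assoc]
    gcongr
    refine (eLpNorm_add_le hg.norm (hg.comp_measurePreserving hneg).norm (by norm_num)).trans ?_
    rw [eLpNorm_norm, eLpNorm_norm]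
    have := eLpNorm_comp_measurePreserving (p := 2) hg hneg
    rw [this, ← Lp.enorm_def, ENNReal.coe_ofNat, two_mul]

end LpOperator

/-! ### Fubini for superpositions, and the change to characteristic coordinates -/

section Superposition

/-- The shear (z, t) ↦ (z, t - s(z)) preserves measure and moves the delay from the control f to the
test quantity Λ. For the waves s(z) is |x| on the rays and the second coordinate in the cone. -/
theorem integral_convolution_swap {Z : Type*} [MeasurableSpace Z] {ν : Measure Z} [SFinite ν]
    {κ s X : Z → ℝ} (hκ : Measurable κ) (hs : Measurable s) (hX : Measurable X) {Λ : ℝ → ℝ → ℝ}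
    (hΛ : Measurable (Function.uncurry Λ)) {f : ℝ → ℝ} (hf : Integrable f) {N : Z → ℝ}
    (hN : Integrable N ν) (hb : ∀ z t, |κ z * Λ (X z) t| ≤ N z) :
    Integrable (fun w : Z × ℝ => κ w.1 * f (w.2 - s w.1) * Λ (X w.1) w.2) (ν.prod volume) ∧
      Integrable (fun σ => f σ * ∫ z, κ z * Λ (X z) (σ + s z) ∂ν) ∧
      ∫ t, ∫ z, κ z * f (t - s z) * Λ (X z) t ∂ν
        = ∫ σ, f σ * ∫ z, κ z * Λ (X z) (σ + s z) ∂ν := by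
  set G : Z × ℝ → ℝ := fun w => f w.2 * (κ w.1 * Λ (X w.1) (w.2 + s w.1)) with hG
  have hGi : Integrable G (ν.prod volume) := by
    refine (hN.mul_prod hf.norm).mono' ?_ (Filter.Eventually.of_forall fun w => ?_)
    · refine hf.aestronglyMeasurable.comp_snd.mul (Measurable.aestronglyMeasurable ?_)
      exact (hκ.comp measurable_fst).mul (hΛ.comp ((hX.comp measurable_fst).prodMk
        (measurable_snd.add (hs.comp measurable_fst))))
    · rw [hG, norm_mul, mul_comm]
      exact mul_le_mul_of_nonneg_right (hb _ _) (norm_nonneg _)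
  have hmp : MeasurePreserving (fun w : Z × ℝ => (w.1, w.2 - s w.1)) (ν.prod volume)
      (ν.prod volume) :=
    (MeasurePreserving.id ν).skew_product (g := fun z t => t - s z)
      (measurable_snd.sub (hs.comp measurable_fst))
      (Filter.Eventually.of_forall fun z => (measurePreserving_sub_right volume (s z)).map_eq)
  have e : (fun w : Z × ℝ => κ w.1 * f (w.2 - s w.1) * Λ (X w.1) w.2)
      = G ∘ fun w => (w.1, w.2 - s w.1) := by
    ext w
    simp only [hG, Function.comp_apply, sub_add_cancel]
    ring
  have hi : Integrable (fun w : Z × ℝ => κ w.1 * f (w.2 - s w.1) * Λ (X w.1) w.2)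
      (ν.prod volume) := by
    rw [e]; exact hmp.integrable_comp_of_integrable hGi
  have hin : ∀ σ, ∫ z, G (z, σ) ∂ν = f σ * ∫ z, κ z * Λ (X z) (σ + s z) ∂ν := fun σ => by
    simp only [hG]
    exact integral_const_mul _ _
  refine ⟨hi, ?_, ?_⟩
  · simp only [← hin]
    exact hGi.integral_prod_right
  have h1 := integral_integral_swap (f := fun z t => κ z * f (t - s z) * Λ (X z) t) hi
  have h2 := integral_integral_swap (f := fun z σ => G (z, σ)) hGi
  rw [← h1]
  have h3 : ∀ z, ∫ t, κ z * f (t - s z) * Λ (X z) t = ∫ σ, G (z, σ) := by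
    intro z
    rw [← integral_sub_right_eq_self (fun σ => G (z, σ)) (s z)]
    refine integral_congr_ae (Filter.Eventually.of_forall fun t => ?_)
    simp only [hG, sub_add_cancel]
    ring
  simp only [h3]
  rw [h2]
  simp only [hin]

theorem integral_characteristic_coordinates (g : ℝ × ℝ → ℝ)
    (hg : AEStronglyMeasurable g volume) :
    ∫ z, g z = 2 * ∫ w : ℝ × ℝ, g (w.1 - w.2, w.1 + w.2) := by
  let L : (ℝ × ℝ) →ₗ[ℝ] (ℝ × ℝ) :=
    Matrix.toLin (Module.Basis.finTwoProd ℝ) (Module.Basis.finTwoProd ℝ) !![1, -1; 1, 1]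
  have hdet : LinearMap.det L = 2 := by
    simp only [L, LinearMap.det_toLin, Matrix.det_fin_two_of]; norm_num
  have hL : ∀ w : ℝ × ℝ, L w = (w.1 - w.2, w.1 + w.2) := by
    intro w
    simp only [L]
    rw [Matrix.toLin_finTwoProd_apply]
    ext
    · simp; ring
    · simp
  have hmap : Measure.map L (volume : Measure (ℝ × ℝ)) = ENNReal.ofReal |(2 : ℝ)⁻¹| • volume := by
    have := Measure.map_linearMap_addHaar_eq_smul_addHaar (volume : Measure (ℝ × ℝ)) (f := L)
      (by rw [hdet]; norm_num)
    rwa [hdet] at this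
  have hLm : AEMeasurable L (volume : Measure (ℝ × ℝ)) :=
    (L.continuous_of_finiteDimensional).measurable.aemeasurable
  have h1 : ∫ w : ℝ × ℝ, g (L w) = ∫ z, g z ∂(Measure.map L volume) := by
    rw [integral_map hLm]
    rw [hmap]
    exact hg.smul_measure _
  simp only [hL] at h1
  rw [h1, hmap, integral_smul_measure, ENNReal.toReal_ofReal (abs_nonneg _)]
  rw [abs_of_pos (by norm_num : (0 : ℝ) < 2⁻¹), smul_eq_mul, ← mul_assoc]
  norm_num

end Superposition

/-! ### The weak equation for superposed pulses -/

section WeakIdentity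

theorem measurable_comp_uncurry {Z : Type*} [MeasurableSpace Z] {f : ℝ → ℝ → ℝ}
    (hf : Measurable (Function.uncurry f)) {g k : Z → ℝ} (hg : Measurable g)
    (hk : Measurable k) : Measurable fun z => f (g z) (k z) :=
  hf.comp (hg.prodMk hk)

theorem isTest_translate {φ : ℝ → ℝ → ℝ} (hφ : ContDiff ℝ ∞ (Function.uncurry φ))
    (hs : HasCompactSupport (Function.uncurry φ)) (σ : ℝ) :
    ∃ R₀, ∀ R, R₀ ≤ R → IsTest (fun x t => φ x (t + σ)) R := by
  have e : Function.uncurry (fun x t => φ x (t + σ))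
      = Function.uncurry φ ∘ (Homeomorph.addRight ((0, σ) : ℝ × ℝ)) := by
    ext ⟨x, t⟩; simp [Function.uncurry]
  refine exists_isTest ?_ ?_
  · rw [e]
    exact hφ.comp (contDiff_id.add contDiff_const)
  · rw [e]
    exact hs.comp_homeomorph _

theorem wave_translate (φ : ℝ → ℝ → ℝ) (σ x t : ℝ) :
    wave (fun x t => φ x (t + σ)) x t = wave φ x (t + σ) := by
  simp only [wave]
  rw [iteratedDeriv_comp_add_const 2 (fun τ => φ x τ) σ]

theorem fderiv_translate (φ : ℝ → ℝ → ℝ) (σ : ℝ) :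
    fderiv ℝ (Function.uncurry fun x t => φ x (t + σ)) (0, 0)
      = fderiv ℝ (Function.uncurry φ) (0, σ) := by
  have e : Function.uncurry (fun x t => φ x (t + σ))
      = fun z => Function.uncurry φ (z + (0, σ)) := by
    ext ⟨x, t⟩; simp [Function.uncurry]
  rw [e, fderiv_comp_add_right]
  simp

theorem wave_eq_zero_of_lt {φ : ℝ → ℝ → ℝ} {T : ℝ}
    (hT : ∀ x t, T ≤ t → φ x t = 0) {x t : ℝ} (ht : T < t) : wave φ x t = 0 := by
  have h1 : (fun τ => φ x τ) =ᶠ[nhds t] fun _ => 0 := by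
    filter_upwards [lt_mem_nhds ht] with τ hτ using hT x τ hτ.le
  have h2 : (fun y => φ y t) = fun _ => 0 := funext fun y => hT y t ht.le
  rw [wave, h1.iteratedDeriv_eq, h2]
  simp

/-- The wave operator with potential `p`. -/
def waveWithPotential (p : ℝ → ℝ) (φ : ℝ → ℝ → ℝ) (x t : ℝ) : ℝ := wave φ x t + p x * φ x t

/-- The coefficient of the singular part on the two sides of the origin. -/
def sideCoeff (cp cm x : ℝ) : ℝ := if 0 < x then cp else cm

/-- The Goursat kernel in the variables `(x, s)`, cut off to `|x| < s < T`. -/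
def coneKernel (u : ℝ → ℝ → ℝ) (T x s : ℝ) : ℝ :=
  if |x| < s ∧ s < T then u ((s + x) / 2) ((s - x) / 2) else 0

variable {p : ℝ → ℝ} {φ : ℝ → ℝ → ℝ} {u : ℝ → ℝ → ℝ} {cp cm R T : ℝ}

theorem measurable_sideCoeff : Measurable (sideCoeff cp cm) :=
  Measurable.ite measurableSet_Ioi measurable_const measurable_const

theorem abs_sideCoeff_le (x : ℝ) : |sideCoeff cp cm x| ≤ |cp| + |cm| := by
  rw [sideCoeff]; split_ifs <;> linarith [abs_nonneg cp, abs_nonneg cm]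

theorem measurable_coneKernel (hu : Continuous (Function.uncurry u)) :
    Measurable (Function.uncurry (coneKernel u T)) := by
  refine Measurable.ite ?_ ?_ measurable_const
  · exact (measurableSet_lt measurable_fst.abs measurable_snd).inter
      (measurableSet_lt measurable_snd measurable_const)
  · exact (continuous_comp_uncurry hu (by fun_prop) (by fun_prop)).measurable

theorem exists_bound_coneKernel (hu : Continuous (Function.uncurry u)) (T : ℝ) :
    ∃ C, 0 ≤ C ∧ ∀ x s, |coneKernel u T x s|
      ≤ C * ((Ioo (-T) T).indicator 1 x * (Ioo 0 T).indicator 1 s) := by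
  obtain ⟨C, hC0, hC⟩ := exists_bound_Icc_prod hu T
  refine ⟨C, hC0, fun x s => ?_⟩
  rw [coneKernel]
  split_ifs with h
  · have hx := abs_lt.1 h.1
    have h0 : 0 < s := (abs_nonneg x).trans_lt h.1
    rw [indicator_of_mem (mem_Ioo.2 ⟨by linarith, by linarith⟩ : x ∈ Ioo (-T) T),
      indicator_of_mem (mem_Ioo.2 ⟨h0, h.2⟩ : s ∈ Ioo 0 T)]
    simpa using hC ((s + x) / 2) ⟨by linarith, by linarith⟩ ((s - x) / 2)
      ⟨by linarith, by linarith⟩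
  · rw [abs_zero]
    exact mul_nonneg hC0 (mul_nonneg (indicator_nonneg (fun _ _ => zero_le_one) _)
      (indicator_nonneg (fun _ _ => zero_le_one) _))

theorem measurable_waveWithPotential (hpm : Measurable p)
    (hφ : ContDiff ℝ ∞ (Function.uncurry φ)) :
    Measurable (Function.uncurry (waveWithPotential p φ)) :=
  (continuous_wave hφ).measurable.add ((hpm.comp measurable_fst).mul hφ.continuous.measurable)

theorem exists_forall_abs_le (hφ : ContDiff ℝ ∞ (Function.uncurry φ)) (hR : IsTest φ R) :
    ∃ B, 0 ≤ B ∧ ∀ x t, |wave φ x t| ≤ B ∧ |φ x t| ≤ B := by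
  have hK : IsCompact (Icc (-R) R ×ˢ Icc (-R) R) := isCompact_Icc.prod isCompact_Icc
  obtain ⟨B₁, hB₁⟩ := hK.exists_bound_of_continuousOn (continuous_wave hφ).continuousOn
  obtain ⟨B₂, hB₂⟩ := hK.exists_bound_of_continuousOn hφ.continuous.continuousOn
  refine ⟨max (max B₁ B₂) 0, le_max_right _ _, fun x t => ?_⟩
  by_cases h : R ≤ |x| ∨ R ≤ |t|
  · rw [hR.support x t h, hR.wave_zero x t h]; simp
  · push Not at h
    have hm : (x, t) ∈ Icc (-R) R ×ˢ Icc (-R) R :=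
      ⟨⟨(abs_lt.1 h.1).1.le, (abs_lt.1 h.1).2.le⟩, (abs_lt.1 h.2).1.le, (abs_lt.1 h.2).2.le⟩
    exact ⟨(hB₁ _ hm).trans ((le_max_left _ _).trans (le_max_left _ _)),
      (hB₂ _ hm).trans ((le_max_right _ _).trans (le_max_left _ _))⟩

theorem exists_integrable_bound (hp : Integrable p) (hφ : ContDiff ℝ ∞ (Function.uncurry φ))
    (hR : IsTest φ R) :
    ∃ n : ℝ → ℝ, Integrable n ∧ ∀ x t, |waveWithPotential p φ x t| ≤ n x := by
  obtain ⟨B, hB0, hB⟩ := exists_forall_abs_le hφ hR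
  refine ⟨fun x => (Icc (-R) R).indicator (fun _ => B) x + B * |p x|,
    Integrable.add ?_ (hp.abs.const_mul B), fun x t => ?_⟩
  · exact (integrable_indicator_iff measurableSet_Icc).2 (integrableOn_const (hs := by simp))
  · refine (abs_add_le _ _).trans (add_le_add ?_ ?_)
    · by_cases h : R ≤ |x|
      · rw [hR.wave_zero x t (Or.inl h), abs_zero]
        exact indicator_nonneg (fun _ _ => hB0) _
      · have h := abs_lt.1 (not_le.1 h)
        rw [indicator_of_mem (mem_Icc.2 ⟨h.1.le, h.2.le⟩ : x ∈ Icc (-R) R)]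
        exact (hB x t).1
    · rw [abs_mul, mul_comm]
      exact mul_le_mul_of_nonneg_right (hB x t).2 (abs_nonneg _)

theorem setIntegral_Ioi_eq_intervalIntegral {g : ℝ → ℝ} (hR : 0 ≤ R)
    (h : ∀ x, R ≤ x → g x = 0) : ∫ x in Ioi 0, g x = ∫ x in (0 : ℝ)..R, g x := by
  rw [intervalIntegral.integral_of_le hR]
  refine (setIntegral_eq_of_subset_of_forall_sdiff_eq_zero measurableSet_Ioi Ioc_subset_Ioi_self
    fun x hx => h x ?_)
  have h1 := hx.2
  by_contra h2
  exact h1 ⟨hx.1, (not_le.1 h2).le⟩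

theorem integral_sideCoeff_mul (hpm : Measurable p) (hp : Integrable p) (hR : 0 ≤ R)
    (h : IsTest φ R) :
    ∫ x, sideCoeff cp cm x * waveWithPotential p φ x |x|
      = cp * (∫ x in (0 : ℝ)..R, waveWithPotential p φ x x)
        + cm * ∫ x in (0 : ℝ)..R, waveWithPotential p φ (-x) x := by
  obtain ⟨n, hn, hb⟩ := exists_integrable_bound hp h.smooth h
  have hi : Integrable fun x => sideCoeff cp cm x * waveWithPotential p φ x |x| := by
    refine (hn.const_mul (|cp| + |cm|)).mono' (Measurable.aestronglyMeasurable ?_)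
      (Filter.Eventually.of_forall fun x => ?_)
    · exact measurable_sideCoeff.mul (measurable_comp_uncurry
        (measurable_waveWithPotential hpm h.smooth) measurable_id measurable_id.abs)
    · rw [norm_mul]
      exact mul_le_mul (abs_sideCoeff_le x) (hb _ _) (abs_nonneg _) (by positivity)
  have hz : ∀ x t, R ≤ |x| → waveWithPotential p φ x t = 0 := fun x t hx => by
    rw [waveWithPotential, h.wave_zero x t (Or.inl hx), h.support x t (Or.inl hx)]; simp
  rw [← intervalIntegral.integral_Iic_add_Ioi (b := 0) hi.integrableOn hi.integrableOn, add_comm]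
  congr 1
  · rw [← setIntegral_Ioi_eq_intervalIntegral hR fun x hx => hz x x (hx.trans (le_abs_self _)),
      ← integral_const_mul]
    refine setIntegral_congr_fun measurableSet_Ioi fun x hx => ?_
    have hx : 0 < x := hx
    simp only [sideCoeff, if_pos hx, abs_of_pos hx]
  · rw [← setIntegral_Ioi_eq_intervalIntegral hR fun x hx =>
      hz (-x) x (by rw [abs_neg]; exact hx.trans (le_abs_self _)), ← integral_const_mul]
    have := integral_comp_neg_Ioi (0 : ℝ)
      fun x => sideCoeff cp cm x * waveWithPotential p φ x |x|
    rw [neg_zero] at this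
    rw [← this]
    refine setIntegral_congr_fun measurableSet_Ioi fun x hx => ?_
    have hx : 0 < x := hx
    simp only [sideCoeff, if_neg (by linarith : ¬ 0 < -x), abs_neg, abs_of_pos hx]

/-- In characteristic coordinates the cone |x| < s is the open quadrant and the Jacobian is 2. The
cut-off s < T is invisible because the tested quantity vanishes for t ≥ T, and the support condition
shrinks the quadrant to (0, R]². -/
theorem integral_coneKernel_mul (hpm : Measurable p) (hp : Integrable p)
    (hu : Continuous (Function.uncurry u)) (hR : 0 ≤ R) (h : IsTest φ R)
    (hT : ∀ x t, T ≤ t → waveWithPotential p φ x t = 0) :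
    ∫ z : ℝ × ℝ, coneKernel u T z.1 z.2 * waveWithPotential p φ z.1 z.2
      = 2 * ∫ ξ in (0 : ℝ)..R, ∫ η in (0 : ℝ)..R,
          u ξ η * waveWithPotential p φ (ξ - η) (ξ + η) := by
  rw [integral_characteristic_coordinates
    (fun z => coneKernel u T z.1 z.2 * waveWithPotential p φ z.1 z.2) ((measurable_coneKernel hu).mul (measurable_waveWithPotential hpm h.smooth)).aestronglyMeasurable]
  have e : ∀ w : ℝ × ℝ, coneKernel u T (w.1 - w.2) (w.1 + w.2)
      * waveWithPotential p φ (w.1 - w.2) (w.1 + w.2) = (Ioc 0 R ×ˢ Ioc 0 R).indicator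
        (fun w : ℝ × ℝ => u w.1 w.2 * waveWithPotential p φ (w.1 - w.2) (w.1 + w.2)) w := by
    rintro ⟨ξ, η⟩
    have hz : R ≤ |ξ - η| ∨ R ≤ |ξ + η| → waveWithPotential p φ (ξ - η) (ξ + η) = 0 := fun h' => by
      rw [waveWithPotential, h.wave_zero _ _ h', h.support _ _ h']; simp
    simp only [coneKernel]
    have e1 : (ξ + η + (ξ - η)) / 2 = ξ := by ring
    have e2 : (ξ + η - (ξ - η)) / 2 = η := by ring
    rw [e1, e2]
    by_cases h1 : |ξ - η| < ξ + η
    · have h2 := abs_lt.1 h1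
      have hξ : 0 < ξ := by linarith
      have hη : 0 < η := by linarith
      have h3 : (if |ξ - η| < ξ + η ∧ ξ + η < T then u ξ η else 0)
          * waveWithPotential p φ (ξ - η) (ξ + η)
          = u ξ η * waveWithPotential p φ (ξ - η) (ξ + η) := by
        split_ifs with h4
        · rfl
        · rw [hT _ _ (not_lt.1 fun h5 => h4 ⟨h1, h5⟩)]; simp
      rw [h3]
      by_cases hm : (ξ, η) ∈ Ioc 0 R ×ˢ Ioc 0 R
      · rw [indicator_of_mem hm]
      · rw [indicator_of_notMem hm]
        have : R ≤ ξ ∨ R ≤ η := by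
          by_contra hc
          push Not at hc
          exact hm ⟨⟨hξ, hc.1.le⟩, hη, hc.2.le⟩
        rw [hz (this.elim le_abs_or_of_le_fst le_abs_or_of_le_snd), mul_zero]
    · rw [if_neg fun h2 => h1 h2.1, zero_mul, indicator_of_notMem]
      rintro ⟨hξ, hη⟩
      exact h1 (abs_lt.2 ⟨by linarith [hξ.1], by linarith [hη.1]⟩)
  simp only [e]
  rw [integral_indicator (measurableSet_Ioc.prod measurableSet_Ioc), Measure.volume_eq_prod]
  congr 1
  have hw : IntegrableOn (fun w : ℝ × ℝ => u w.1 w.2 * wave φ (w.1 - w.2) (w.1 + w.2))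
      (Ioc 0 R ×ˢ Ioc 0 R) (volume.prod volume) := by
    have hc : Continuous fun w : ℝ × ℝ => u w.1 w.2 * wave φ (w.1 - w.2) (w.1 + w.2) :=
      Continuous.mul hu (continuous_comp_uncurry (continuous_wave h.smooth) (by fun_prop)
        (by fun_prop))
    exact (hc.continuousOn.integrableOn_compact (isCompact_Icc.prod isCompact_Icc)).mono_set
      (prod_mono Ioc_subset_Icc_self Ioc_subset_Icc_self)
  have hv : IntegrableOn (fun w : ℝ × ℝ => u w.1 w.2 * (p (w.1 - w.2) * φ (w.1 - w.2) (w.1 + w.2)))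
      (Ioc 0 R ×ˢ Ioc 0 R) (volume.prod volume) := by
    have hc : Continuous (Function.uncurry fun ξ η => u ξ η * φ (ξ - η) (ξ + η)) :=
      Continuous.mul hu (continuous_comp_uncurry h.smooth.continuous (by fun_prop)
        (by fun_prop))
    obtain ⟨C, hC0, hC⟩ := exists_bound_Icc_prod hc R
    -- Integrability of the factor p(ξ - η) on the square is a convolution estimate: p plays the
    -- control, ξ the time and η the delay.
    have h1 := (integral_convolution_swap (ν := volume) (κ := (Ioc 0 R).indicator 1) (s := id)
      (X := id) (Λ := fun η ξ => (Ioc 0 R).indicator (fun ξ => u ξ η * φ (ξ - η) (ξ + η)) ξ)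
      (f := p) (N := (Ioc 0 R).indicator fun _ => C)
      (measurable_one.indicator measurableSet_Ioc) measurable_id measurable_id
      ((hc.comp continuous_swap).measurable.indicator
        (measurable_snd measurableSet_Ioc)) hp
      ((integrable_indicator_iff measurableSet_Ioc).2 (integrableOn_const (hs := by simp))) ?_).1
    · have h2 := h1.swap
      rw [← integrable_indicator_iff (measurableSet_Ioc.prod measurableSet_Ioc)]
      refine h2.congr (Filter.Eventually.of_forall ?_)
      rintro ⟨ξ, η⟩
      simp only [Function.comp_apply, Prod.swap_prod_mk, id]
      by_cases hξ : ξ ∈ Ioc 0 R <;> by_cases hη : η ∈ Ioc 0 R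
      all_goals
        simp only [indicator, mem_prod, hξ, hη, and_self, and_false, false_and, if_true, if_false,
          Pi.one_apply]
        ring
    · intro η ξ
      by_cases hη : η ∈ Ioc 0 R
      · rw [indicator_of_mem hη, indicator_of_mem hη, Pi.one_apply, one_mul]
        by_cases hξ : ξ ∈ Ioc 0 R
        · rw [indicator_of_mem hξ]
          exact hC ξ (Ioc_subset_Icc_self hξ) η (Ioc_subset_Icc_self hη)
        · rw [indicator_of_notMem hξ, abs_zero]; exact hC0
      · rw [indicator_of_notMem hη, indicator_of_notMem hη]; simp
  have hsum : IntegrableOn (fun w : ℝ × ℝ =>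
      u w.1 w.2 * waveWithPotential p φ (w.1 - w.2) (w.1 + w.2))
      (Ioc 0 R ×ˢ Ioc 0 R) (volume.prod volume) := by
    refine (hw.add hv).congr_fun (fun w _ => ?_) (measurableSet_Ioc.prod measurableSet_Ioc)
    simp only [Pi.add_apply, waveWithPotential]; ring
  rw [setIntegral_prod _ hsum, intervalIntegral.integral_of_le hR]
  simp only [intervalIntegral.integral_of_le hR]

/-- The state at time `t` of the wave with control `f`. -/
def stateFun (u : ℝ → ℝ → ℝ) (cp cm T : ℝ) (f : ℝ → ℝ) (t x : ℝ) : ℝ :=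
  sideCoeff cp cm x * f (t - |x|) + ∫ s, coneKernel u T x s * f (t - s)

/-- A pulse emitted at time σ is the fundamental solution tested against φ shifted by σ. -/
theorem weak_identity_translate (hpm : Measurable p) (hp : Integrable p)
    (hu : Continuous (Function.uncurry u))
    (hg : ∀ ξ η, 0 ≤ ξ → 0 ≤ η →
      u ξ η = -(1 / 2) * (cp * (∫ y in (0 : ℝ)..ξ, p y) + cm * ∫ y in (0 : ℝ)..η, p (-y))
        - ∫ a in (0 : ℝ)..ξ, ∫ b in (0 : ℝ)..η, p (a - b) * u a b)
    (hφ : ContDiff ℝ ∞ (Function.uncurry φ)) (hs : HasCompactSupport (Function.uncurry φ))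
    (hT : ∀ x t, T ≤ t → φ x t = 0) {σ : ℝ} (hσ : 0 < σ) :
    (∫ x, sideCoeff cp cm x * waveWithPotential p φ x (σ + |x|))
      + ∫ z : ℝ × ℝ, coneKernel u T z.1 z.2 * waveWithPotential p φ z.1 (σ + z.2)
      = -cp * fderiv ℝ (Function.uncurry φ) (0, σ) (-1, 1)
        - cm * fderiv ℝ (Function.uncurry φ) (0, σ) (1, 1) := by
  obtain ⟨R₀, hR₀⟩ := isTest_translate hφ hs σ
  have h := hR₀ (max R₀ 0) (le_max_left _ _)
  have hR : 0 ≤ max R₀ 0 := le_max_right _ _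
  have e : ∀ x t, waveWithPotential p φ x (σ + t)
      = waveWithPotential p (fun x t => φ x (t + σ)) x t := fun x t => by
    rw [waveWithPotential, waveWithPotential, wave_translate, add_comm σ]
  have hz : ∀ x t, T ≤ t → waveWithPotential p (fun x t => φ x (t + σ)) x t = 0 := fun x t ht => by
    -- Since σ > 0, t ≥ T gives t + σ > T strictly, so φ vanishes on a neighbourhood in time and its
    -- derivatives vanish too.
    rw [← e, waveWithPotential, wave_eq_zero_of_lt hT (by linarith), hT _ _ (by linarith)]
    simp
  simp only [e]
  rw [integral_sideCoeff_mul hpm hp hR h, integral_coneKernel_mul hpm hp hu hR h hz]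
  have key := goursat_weak_identity hpm hp hu hg hR h
  rw [fderiv_translate] at key
  simp only [waveWithPotential]
  rw [← key]
  ring

/-- The state is a superposition of pulses with weights f(σ). Fubini on the ray part and on the cone
part reduces the identity to the one for each pulse, needed only for σ in (0, T), where f lives. -/
theorem weak_identity_stateFun (hpm : Measurable p) (hp : Integrable p)
    (hu : Continuous (Function.uncurry u))
    (hg : ∀ ξ η, 0 ≤ ξ → 0 ≤ η →
      u ξ η = -(1 / 2) * (cp * (∫ y in (0 : ℝ)..ξ, p y) + cm * ∫ y in (0 : ℝ)..η, p (-y))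
        - ∫ a in (0 : ℝ)..ξ, ∫ b in (0 : ℝ)..η, p (a - b) * u a b)
    {f : ℝ → ℝ} (hf : Integrable f) (hfT : ∀ t, t ∉ Ioo 0 T → f t = 0)
    (hφ : ContDiff ℝ ∞ (Function.uncurry φ)) (hs : HasCompactSupport (Function.uncurry φ))
    (hT : ∀ x t, T ≤ t → φ x t = 0) :
    (∀ᵐ t, Integrable fun x => stateFun u cp cm T f t x * waveWithPotential p φ x t) ∧
      Integrable (fun t => ∫ x, stateFun u cp cm T f t x * waveWithPotential p φ x t) ∧
      ∫ t, ∫ x, stateFun u cp cm T f t x * waveWithPotential p φ x t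
        = ∫ σ, f σ * (-cp * fderiv ℝ (Function.uncurry φ) (0, σ) (-1, 1)
          - cm * fderiv ℝ (Function.uncurry φ) (0, σ) (1, 1)) := by
  obtain ⟨R₀, hR₀⟩ := exists_isTest hφ hs
  obtain ⟨n, hn, hnb⟩ := exists_integrable_bound hp hφ (hR₀ R₀ le_rfl)
  have hn0 : ∀ x, 0 ≤ n x := fun x => (abs_nonneg _).trans (hnb x 0)
  have hΛ := measurable_waveWithPotential hpm hφ
  obtain ⟨C, hC0, hC⟩ := exists_bound_coneKernel hu T
  obtain ⟨hA, hAi, hA'⟩ := integral_convolution_swap (ν := (volume : Measure ℝ))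
    (κ := sideCoeff cp cm) (s := fun x => |x|) (X := fun x => x) measurable_sideCoeff
    measurable_id.abs measurable_id hΛ hf (hn.const_mul (|cp| + |cm|)) (fun z t => by
      rw [abs_mul]
      exact mul_le_mul (abs_sideCoeff_le z) (hnb _ _) (abs_nonneg _) (by positivity))
  obtain ⟨hB, hBi, hB'⟩ := integral_convolution_swap (ν := (volume : Measure ℝ).prod volume)
    (κ := Function.uncurry (coneKernel u T)) (s := Prod.snd) (X := Prod.fst)
    (N := fun z => n z.1 * (Ioo 0 T).indicator (fun _ => C) z.2)
    (measurable_coneKernel hu) measurable_snd measurable_fst hΛ hf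
    (hn.mul_prod ((integrable_indicator_iff measurableSet_Ioo).2
      (integrableOn_const (hs := by simp)))) (fun z t => by
      rw [abs_mul, mul_comm]
      refine mul_le_mul (hnb _ _) ((hC z.1 z.2).trans ?_) (abs_nonneg _) (hn0 _)
      by_cases h1 : z.1 ∈ Ioo (-T) T <;> by_cases h2 : z.2 ∈ Ioo 0 T <;>
        simp only [indicator, h1, h2, if_true, if_false, Pi.one_apply] <;> linarith)
  have hBt : ∀ᵐ t, Integrable (fun x => (∫ s, coneKernel u T x s * f (t - s))
        * waveWithPotential p φ x t) ∧
      ∫ x, (∫ s, coneKernel u T x s * f (t - s)) * waveWithPotential p φ x t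
        = ∫ z : ℝ × ℝ, Function.uncurry (coneKernel u T) z * f (t - z.2)
            * waveWithPotential p φ z.1 t ∂(volume.prod volume) := by
    filter_upwards [hB.prod_left_ae] with t ht
    have e : (fun x => (∫ s, coneKernel u T x s * f (t - s)) * waveWithPotential p φ x t)
        = fun x => ∫ s, Function.uncurry (coneKernel u T) (x, s) * f (t - s)
            * waveWithPotential p φ x t := funext fun x => (integral_mul_const _ _).symm
    refine ⟨?_, ?_⟩
    · rw [e]; exact ht.integral_prod_left
    · rw [e, integral_prod _ ht]
  have hsplit : ∀ᵐ t, Integrable (fun x => stateFun u cp cm T f t x * waveWithPotential p φ x t) ∧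
      ∫ x, stateFun u cp cm T f t x * waveWithPotential p φ x t
        = (∫ x, sideCoeff cp cm x * f (t - |x|) * waveWithPotential p φ x t)
          + ∫ z : ℝ × ℝ, Function.uncurry (coneKernel u T) z * f (t - z.2)
            * waveWithPotential p φ z.1 t ∂(volume.prod volume) := by
    filter_upwards [hA.prod_left_ae, hBt] with t h1 h2
    simp only [stateFun, add_mul]
    exact ⟨h1.add h2.1, by rw [integral_add h1 h2.1, h2.2]⟩
  have hsplit' := hsplit.mono fun t ht => ht.2
  refine ⟨hsplit.mono fun t ht => ht.1, ?_, ?_⟩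
  · exact (hA.integral_prod_right.add hB.integral_prod_right).congr
      (hsplit'.mono fun t ht => ht.symm)
  · rw [integral_congr_ae hsplit', integral_add hA.integral_prod_right hB.integral_prod_right,
      hA', hB', ← integral_add hAi hBi]
    refine integral_congr_ae (Filter.Eventually.of_forall fun σ => ?_)
    beta_reduce
    by_cases hσ : σ ∈ Ioo 0 T
    · rw [← mul_add, ← weak_identity_translate hpm hp hu hg hφ hs hT hσ.1]
      rfl
    · simp [hfT σ hσ]

end WeakIdentity

/-! ### Existence of generalized solutions and the control operator -/

section GeneralizedSolution

/-- `u` solves the Goursat problem with potential `p` and side coefficients `cp`, `cm`. -/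
structure IsGoursatSolution (p : ℝ → ℝ) (cp cm : ℝ) (u : ℝ → ℝ → ℝ) : Prop where
  continuous : Continuous (Function.uncurry u)
  equation : ∀ ξ η, 0 ≤ ξ → 0 ≤ η →
      u ξ η = -(1 / 2) * (cp * (∫ y in (0 : ℝ)..ξ, p y) + cm * ∫ y in (0 : ℝ)..η, p (-y))
        - ∫ a in (0 : ℝ)..ξ, ∫ b in (0 : ℝ)..η, p (a - b) * u a b

/-- `L₂(ℝ)`. -/
abbrev LineSpace : Type := Lp ℝ 2 (volume : Measure ℝ)

/-- The map `g ↦ g(t - ·)` on `L₂(ℝ)`. -/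
def reflectAt (t : ℝ) : LineSpace →L[ℝ] LineSpace :=
  (Lp.compMeasurePreservingₗᵢ ℝ (fun s : ℝ => t - s)
    (Measure.measurePreserving_sub_left (volume : Measure ℝ) t)).toContinuousLinearMap

theorem reflectAt_apply (t : ℝ) (g : LineSpace) : reflectAt t g =ᵐ[volume] fun s => g (t - s) :=
  Lp.coeFn_compMeasurePreserving g (Measure.measurePreserving_sub_left (volume : Measure ℝ) t)

theorem continuous_reflectAt (g : LineSpace) : Continuous fun t => reflectAt t g := by
  have h : Continuous fun t : ℝ => (⟨fun s => t - s, by fun_prop⟩ : C(ℝ, ℝ)) :=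
    ContinuousMap.continuous_of_continuous_uncurry _ (by
      change Continuous fun z : ℝ × ℝ => z.1 - z.2
      fun_prop)
  exact Continuous.compMeasurePreservingLp (f := fun _ : ℝ => g) continuous_const h
    (fun t => Measure.measurePreserving_sub_left (volume : Measure ℝ) t) (by simp)

/-- The state at every time t is this one operator applied to s ↦ f(t - s), so continuity of the
solution in time reduces to continuity of reflections in L₂(ℝ). -/
theorem exists_stateOperator {u : ℝ → ℝ → ℝ} (hu : Continuous (Function.uncurry u))
    (cp cm T : ℝ) : ∃ V : LineSpace →L[ℝ] LineSpace, ∀ g, V g =ᵐ[volume]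
      fun x => sideCoeff cp cm x * g |x| + ∫ s, coneKernel u T x s * g s := by
  obtain ⟨C, hC0, hC⟩ := exists_bound_coneKernel hu T
  obtain ⟨A, hA⟩ := exists_evenExtension (measurable_sideCoeff (cp := cp) (cm := cm))
    (C := (|cp| + |cm|).toNNReal) (fun x => by
      rw [Real.coe_toNNReal _ (by positivity)]; exact abs_sideCoeff_le x)
  have hind : ∀ a b : ℝ, MemLp ((Ioo a b).indicator (1 : ℝ → ℝ)) 2 volume := fun a b =>
    memLp_indicator_const 2 measurableSet_Ioo (1 : ℝ) (Or.inr (by simp))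
  obtain ⟨B, hB⟩ := exists_kernelOperator (μ := (volume : Measure ℝ)) (ν := (volume : Measure ℝ))
    (κ := fun x s => coneKernel u T x s • ContinuousLinearMap.id ℝ ℝ)
    (a := fun x => C * (Ioo (-T) T).indicator 1 x) (b := (Ioo 0 T).indicator 1)
    ((measurable_coneKernel hu).stronglyMeasurable.smul stronglyMeasurable_const)
    ((hind (-T) T).const_mul C) (hind 0 T)
    (fun x => mul_nonneg hC0 (indicator_nonneg (fun _ _ => zero_le_one) _))
    (fun s => indicator_nonneg (fun _ _ => zero_le_one) _) (fun x s => by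
      rw [norm_smul, ContinuousLinearMap.norm_id, mul_one, mul_assoc]
      exact hC x s)
  refine ⟨A + B, fun g => ?_⟩
  rw [add_apply]
  filter_upwards [Lp.coeFn_add (A g) (B g), hA g, hB g] with x h1 h2 h3
  rw [h1, Pi.add_apply, h2, h3]
  simp

theorem stateOperator_reflectAt {u : ℝ → ℝ → ℝ} {cp cm T : ℝ} {V : LineSpace →L[ℝ] LineSpace}
    (hV : ∀ g, V g =ᵐ[volume]
      fun x => sideCoeff cp cm x * g |x| + ∫ s, coneKernel u T x s * g s)
    {g : LineSpace} {f : ℝ → ℝ} (hf : g =ᵐ[volume] f) (t : ℝ) :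
    V (reflectAt t g) =ᵐ[volume] stateFun u cp cm T f t := by
  have h1 : reflectAt t g =ᵐ[volume] fun s => f (t - s) :=
    (reflectAt_apply t g).trans
      ((Measure.measurePreserving_sub_left (volume : Measure ℝ) t).quasiMeasurePreserving.ae_eq hf)
  filter_upwards [hV (reflectAt t g), quasiMeasurePreserving_abs.ae h1] with x h2 h3
  rw [h2, h3, stateFun]
  congr 1
  refine integral_congr_ae ?_
  filter_upwards [h1] with s hs
  rw [hs]

theorem stateFun_eq_zero_of_nonpos {u : ℝ → ℝ → ℝ} {cp cm T : ℝ} {f : ℝ → ℝ}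
    (hf : ∀ t ≤ 0, f t = 0) {t : ℝ} (ht : t ≤ 0) (x : ℝ) : stateFun u cp cm T f t x = 0 := by
  have h1 : ∀ s, coneKernel u T x s * f (t - s) = 0 := by
    intro s
    rcases le_or_gt s 0 with hs | hs
    · rw [coneKernel, if_neg fun h => (h.1.trans_le hs).not_ge (abs_nonneg x), zero_mul]
    · rw [hf _ (by linarith), mul_zero]
  simp [stateFun, h1, hf (t - |x|) (by linarith [abs_nonneg x])]

/-- The extension by zero of a component of a control. -/
def controlCoord {T : ℝ} (F : ControlSpace T) (j : Fin 2) : ℝ → ℝ :=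
  (Ioo 0 T).indicator fun t => F t j

theorem controlCoord_of_mem {T : ℝ} (F : ControlSpace T) (j : Fin 2) {t : ℝ} (ht : t ∈ Ioo 0 T) :
    controlCoord F j t = F t j := indicator_of_mem ht _

theorem controlCoord_of_notMem {T : ℝ} (F : ControlSpace T) (j : Fin 2) (t : ℝ)
    (ht : t ∉ Ioo 0 T) : controlCoord F j t = 0 := indicator_of_notMem ht _

theorem integrable_controlCoord {T : ℝ} (F : ControlSpace T) (j : Fin 2) :
    Integrable (controlCoord F j) := by
  rw [controlCoord, integrable_indicator_iff measurableSet_Ioo]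
  have h : MemLp (fun t => F t j) 2 (volume.restrict (Ioo 0 T)) :=
    (EuclideanSpace.proj (𝕜 := ℝ) j).comp_memLp' (Lp.memLp F)
  exact h.integrable (by norm_num)

/-- The pulse identity leaves (cp - cm) φ_x - (cp + cm) φ_t on x = 0. The pair (1/2, -1/2) yields
φ_x, a unit jump of v, and (-1/2, -1/2) yields φ_t, a unit jump of v_x after differentiation in
time. -/
theorem weak_stateFun {q : ℝ → ℝ} {T : ℝ} (hT0 : 0 < T) (hpm : Measurable (linePotential q))
    (hp : Integrable (linePotential q)) {u₀ u₁ : ℝ → ℝ → ℝ}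
    (h₀ : IsGoursatSolution (linePotential q) (1 / 2) (-1 / 2) u₀)
    (h₁ : IsGoursatSolution (linePotential q) (-1 / 2) (-1 / 2) u₁) (F : ControlSpace T)
    {v : ℝ → LineSpace} (hv : ∀ t, v t =ᵐ[volume] fun x =>
      stateFun u₀ (1 / 2) (-1 / 2) T (controlCoord F 0) t x
      + stateFun u₁ (-1 / 2) (-1 / 2) T (controlCoord F 1) t x)
    {φ : ℝ → ℝ → ℝ} (hφ : ContDiff ℝ ∞ (Function.uncurry φ))
    (hs : HasCompactSupport (Function.uncurry φ)) (hφT : ∀ x t, T ≤ t → φ x t = 0) :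
    (∫ t in (0 : ℝ)..T, ∫ x, v t x *
        (iteratedDeriv 2 (fun τ => φ x τ) t - iteratedDeriv 2 (fun y => φ y t) x
          + linePotential q x * φ x t))
      = ∫ t in (0 : ℝ)..T,
          (F t 0 * deriv (fun y => φ y t) 0 + F t 1 * deriv (fun τ => φ 0 τ) t) := by
  obtain ⟨a₀, b₀, c₀⟩ := weak_identity_stateFun hpm hp h₀.continuous h₀.equation
    (integrable_controlCoord F 0) (controlCoord_of_notMem F 0) hφ hs hφT
  obtain ⟨a₁, b₁, c₁⟩ := weak_identity_stateFun hpm hp h₁.continuous h₁.equation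
    (integrable_controlCoord F 1) (controlCoord_of_notMem F 1) hφ hs hφT
  have hL : ∀ᵐ t, ∫ x, v t x *
        (iteratedDeriv 2 (fun τ => φ x τ) t - iteratedDeriv 2 (fun y => φ y t) x
          + linePotential q x * φ x t)
      = (∫ x, stateFun u₀ (1 / 2) (-1 / 2) T (controlCoord F 0) t x * waveWithPotential (linePotential q) φ x t)
        + ∫ x, stateFun u₁ (-1 / 2) (-1 / 2) T (controlCoord F 1) t x
          * waveWithPotential (linePotential q) φ x t := by
    filter_upwards [a₀, a₁] with t h1 h2
    rw [← integral_add h1 h2]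
    refine integral_congr_ae ?_
    filter_upwards [hv t] with x hx
    rw [hx, add_mul]
    rfl
  have hset : ∀ g : ℝ → ℝ, (∀ t, t ∉ Ioo 0 T → g t = 0) → ∫ t, g t = ∫ t in (0 : ℝ)..T, g t := by
    intro g hg
    rw [intervalIntegral.integral_of_le hT0.le, setIntegral_eq_integral_of_forall_compl_eq_zero]
    intro t ht
    exact hg t fun h => ht (Ioo_subset_Ioc_self h)
  have hvan : ∀ (u : ℝ → ℝ → ℝ) (cp cm : ℝ) (f : ℝ → ℝ), (∀ t, t ∉ Ioo 0 T → f t = 0) →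
      ∀ t, t ∉ Icc 0 T →
      ∫ x, stateFun u cp cm T f t x * waveWithPotential (linePotential q) φ x t = 0 := by
    intro u cp cm f hf t ht
    rcases le_or_gt t 0 with h | h
    · simp [stateFun_eq_zero_of_nonpos (u := u) (cp := cp) (cm := cm) (T := T)
        (fun s hs => hf s fun h => h.1.not_ge hs) h]
    · have h' : T < t := by
        by_contra h'
        exact ht ⟨h.le, not_lt.1 h'⟩
      simp [waveWithPotential, wave_eq_zero_of_lt hφT h', hφT _ _ h'.le]
  have hset' : ∀ g : ℝ → ℝ, (∀ t, t ∉ Icc 0 T → g t = 0) → ∫ t, g t = ∫ t in (0 : ℝ)..T, g t := by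
    intro g hg
    rw [intervalIntegral.integral_of_le hT0.le, ← integral_Icc_eq_integral_Ioc,
      setIntegral_eq_integral_of_forall_compl_eq_zero]
    exact hg
  rw [hset' _ (hvan _ _ _ _ (controlCoord_of_notMem F 0)), hset _ fun t ht => by rw [(controlCoord_of_notMem F 0) t ht, zero_mul]] at c₀
  rw [hset' _ (hvan _ _ _ _ (controlCoord_of_notMem F 1)), hset _ fun t ht => by rw [(controlCoord_of_notMem F 1) t ht, zero_mul]] at c₁
  rw [intervalIntegral.integral_congr_ae (hL.mono fun t ht _ => ht),
    intervalIntegral.integral_add b₀.intervalIntegrable b₁.intervalIntegrable, c₀, c₁,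
    ← intervalIntegral.integral_add]
  · refine intervalIntegral.integral_congr_ae ?_
    have : ∀ᵐ t : ℝ, t ≠ T := by simp [ae_iff]
    filter_upwards [this] with t ht ht'
    rw [uIoc_of_le hT0.le] at ht'
    have hm : t ∈ Ioo 0 T := ⟨ht'.1, lt_of_le_of_ne ht'.2 ht⟩
    rw [controlCoord_of_mem F 0 hm, controlCoord_of_mem F 1 hm, deriv_fst_eq_fderiv hφ,
      deriv_snd_eq_fderiv hφ]
    have e1 : ((1, 1) : ℝ × ℝ) = (1, 0) + (0, 1) := by simp
    have e2 : ((-1, 1) : ℝ × ℝ) = -(1, 0) + (0, 1) := by simp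
    rw [e1, e2, map_add, map_add, map_neg]
    ring
  all_goals
    refine (Integrable.intervalIntegrable ?_).mul_continuousOn (Continuous.continuousOn ?_)
    · first | exact integrable_controlCoord F 0 | exact integrable_controlCoord F 1
    · have hc : ∀ w : ℝ × ℝ, Continuous fun σ => fderiv ℝ (Function.uncurry φ) (0, σ) w :=
        fun w => (continuous_fderiv_apply hφ w).comp (Continuous.prodMk_right 0)
      exact (continuous_const.mul (hc _)).sub (continuous_const.mul (hc _))

theorem exists_coordExtension (T : ℝ) (j : Fin 2) :
    ∃ E : ControlSpace T →L[ℝ] LineSpace, ∀ F, E F =ᵐ[volume] controlCoord F j := by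
  obtain ⟨Z, hZ⟩ := exists_extendByZero (E := ℝ) (μ := (volume : Measure ℝ))
    (measurableSet_Ioo (a := (0 : ℝ)) (b := T))
  refine ⟨Z ∘L (EuclideanSpace.proj (𝕜 := ℝ) j).compLpL 2 _, fun F => ?_⟩
  rw [ContinuousLinearMap.comp_apply]
  refine (hZ _).trans ((ae_eq_restrict_iff_indicator_ae_eq measurableSet_Ioo).1 ?_)
  exact (EuclideanSpace.proj (𝕜 := ℝ) j).coeFn_compLpL F

theorem controlCoord_timeReversal {T : ℝ} (F : ControlSpace T) (j : Fin 2) :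
    (fun s => controlCoord (timeReversal T F) j (T - s)) =ᵐ[volume] controlCoord F j := by
  have h1 : controlCoord (timeReversal T F) j =ᵐ[volume]
      (Ioo 0 T).indicator fun t => F (T - t) j := by
    refine (ae_eq_restrict_iff_indicator_ae_eq measurableSet_Ioo).1 ?_
    filter_upwards [timeReversal_apply T F] with t ht
    rw [ht]
  have h2 := (Measure.measurePreserving_sub_left (volume : Measure ℝ)
    T).quasiMeasurePreserving.ae_eq h1
  refine h2.trans (Filter.Eventually.of_forall fun s => ?_)
  simp only [Function.comp_apply, controlCoord, indicator, mem_Ioo, sub_sub_cancel]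
  have : (0 < T - s ∧ T - s < T) ↔ (0 < s ∧ s < T) := by
    constructor <;> rintro ⟨h1, h2⟩ <;> constructor <;> linarith
  simp only [this]

/-- The final state is written for reversed controls because the reversal undoes the reflection s ↦
T - s: the rays then carry F(|x|) and the tail integrates F over s > |x|, which is a triangular
form. -/
theorem exists_control_solution {q : ℝ → ℝ} {T : ℝ} (hT0 : 0 < T)
    (hpm : Measurable (linePotential q))
    (hp : Integrable (linePotential q)) {u₀ u₁ : ℝ → ℝ → ℝ}
    (h₀ : IsGoursatSolution (linePotential q) (1 / 2) (-1 / 2) u₀)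
    (h₁ : IsGoursatSolution (linePotential q) (-1 / 2) (-1 / 2) u₁) :
    ∃ (v : ControlSpace T → ℝ → LineSpace) (W : ControlSpace T →L[ℝ] StateSpace T),
      (∀ F, IsGeneralizedSolution q T F (v F)) ∧
      (∀ F, (v F T : ℝ → ℝ) =ᵐ[volume.restrict (Ioo (-T) T)] W F) ∧
      ∀ F, W (timeReversal T F) =ᵐ[volume.restrict (Ioo (-T) T)] fun x =>
        (sideCoeff (1 / 2) (-1 / 2) x * controlCoord F 0 |x|
          + ∫ s, coneKernel u₀ T x s * controlCoord F 0 s)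
        + (sideCoeff (-1 / 2) (-1 / 2) x * controlCoord F 1 |x|
          + ∫ s, coneKernel u₁ T x s * controlCoord F 1 s) := by
  obtain ⟨E₀, hE₀⟩ := exists_coordExtension T 0
  obtain ⟨E₁, hE₁⟩ := exists_coordExtension T 1
  obtain ⟨V₀, hV₀⟩ := exists_stateOperator h₀.continuous (1 / 2) (-1 / 2) T
  obtain ⟨V₁, hV₁⟩ := exists_stateOperator h₁.continuous (-1 / 2) (-1 / 2) T
  set v : ControlSpace T → ℝ → LineSpace := fun F t =>
    V₀ (reflectAt t (E₀ F)) + V₁ (reflectAt t (E₁ F)) with hv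
  have hvt : ∀ F t, v F t =ᵐ[volume] fun x =>
      stateFun u₀ (1 / 2) (-1 / 2) T (controlCoord F 0) t x
      + stateFun u₁ (-1 / 2) (-1 / 2) T (controlCoord F 1) t x := by
    intro F t
    filter_upwards [Lp.coeFn_add (V₀ (reflectAt t (E₀ F))) (V₁ (reflectAt t (E₁ F))),
      stateOperator_reflectAt hV₀ (hE₀ F) t, stateOperator_reflectAt hV₁ (hE₁ F) t] with x h1 h2 h3
    rw [hv, h1, Pi.add_apply, h2, h3]
  refine ⟨v, LpToLpRestrictCLM ℝ ℝ ℝ volume 2 (Ioo (-T) T) ∘L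
    (V₀ ∘L reflectAt T ∘L E₀ + V₁ ∘L reflectAt T ∘L E₁), fun F => ⟨?_, ?_, ?_⟩, fun F => ?_,
    fun F => ?_⟩
  · exact ((V₀.continuous.comp (continuous_reflectAt _)).add
      (V₁.continuous.comp (continuous_reflectAt _))).continuousOn
  · refine Lp.ext ((hvt F 0).trans ?_)
    refine Filter.EventuallyEq.trans (Filter.Eventually.of_forall fun x => ?_)
      (Lp.coeFn_zero ℝ 2 volume).symm
    have hz : ∀ j, ∀ t ≤ 0, controlCoord F j t = 0 := fun j t ht =>
      controlCoord_of_notMem F j t fun h => h.1.not_ge ht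
    simp [stateFun_eq_zero_of_nonpos (hz 0) le_rfl, stateFun_eq_zero_of_nonpos (hz 1) le_rfl]
  · intro φ hφ hs hφT
    exact weak_stateFun hT0 hpm hp h₀ h₁ F (hvt F) hφ hs hφT
  · exact (LpToLpRestrictCLM_coeFn ℝ (Ioo (-T) T) (v F T)).symm
  · refine (LpToLpRestrictCLM_coeFn ℝ (Ioo (-T) T) _).trans (ae_restrict_of_ae ?_)
    have hr : ∀ (E : ControlSpace T →L[ℝ] LineSpace) (j : Fin 2),
        (∀ F, E F =ᵐ[volume] controlCoord F j) →
        reflectAt T (E (timeReversal T F)) =ᵐ[volume] controlCoord F j := fun E j hE =>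
      (reflectAt_apply T _).trans (((Measure.measurePreserving_sub_left (volume : Measure ℝ)
        T).quasiMeasurePreserving.ae_eq (hE _)).trans (controlCoord_timeReversal F j))
    have r₀ := hr E₀ 0 hE₀
    have r₁ := hr E₁ 1 hE₁
    filter_upwards [Lp.coeFn_add (V₀ (reflectAt T (E₀ (timeReversal T F))))
      (V₁ (reflectAt T (E₁ (timeReversal T F)))), hV₀ (reflectAt T (E₀ (timeReversal T F))),
      hV₁ (reflectAt T (E₁ (timeReversal T F))), quasiMeasurePreserving_abs.ae r₀,
      quasiMeasurePreserving_abs.ae r₁] with x h1 h2 h3 h4 h5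
    have i₀ : ∫ s, coneKernel u₀ T x s * reflectAt T (E₀ (timeReversal T F)) s
        = ∫ s, coneKernel u₀ T x s * controlCoord F 0 s :=
      integral_congr_ae (r₀.mono fun s hs => by beta_reduce; rw [hs])
    have i₁ : ∫ s, coneKernel u₁ T x s * reflectAt T (E₁ (timeReversal T F)) s
        = ∫ s, coneKernel u₁ T x s * controlCoord F 1 s :=
      integral_congr_ae (r₁.mono fun s hs => by beta_reduce; rw [hs])
    rw [h4, i₀] at h2
    rw [h5, i₁] at h3
    rw [← h2, ← h3]
    exact h1

end GeneralizedSolution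

/-! ### Tools for uniqueness: L₂ curves, cut-offs, twice integrated identities -/

section Uniqueness

/-- On the compact set carrying r, Θ(·, τ) tends to Θ(·, t) uniformly, so the products converge in
L₂ even though r is only square integrable. -/
theorem exists_continuous_Lp_mul {r : ℝ → ℝ} (hr : MemLp r 2 volume) {R : ℝ}
    (hR : ∀ x, x ∉ Icc (-R) R → r x = 0) {Θ : ℝ → ℝ → ℝ} (hΘ : Continuous (Function.uncurry Θ)) :
    ∃ w : ℝ → LineSpace, Continuous w ∧ ∀ t, w t =ᵐ[volume] fun x => r x * Θ x t := by
  have hmem : ∀ t, MemLp (fun x => r x * Θ x t) 2 volume := by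
    intro t
    obtain ⟨C, hC⟩ := (isCompact_Icc (a := -R) (b := R)).exists_bound_of_continuousOn
      (f := fun x => Θ x t) (continuous_comp_uncurry hΘ continuous_id continuous_const).continuousOn
    refine MemLp.of_le_mul (c := C) hr (hr.1.mul (continuous_comp_uncurry hΘ continuous_id
      continuous_const).aestronglyMeasurable) (Filter.Eventually.of_forall fun x => ?_)
    by_cases hx : x ∈ Icc (-R) R
    · rw [norm_mul, mul_comm]
      exact mul_le_mul_of_nonneg_right (hC x hx) (norm_nonneg _)
    · simp [hR x hx]
  refine ⟨fun t => (hmem t).toLp _, ?_, fun t => (hmem t).coeFn_toLp⟩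
  rw [continuous_iff_continuousAt]
  intro t
  rw [ContinuousAt, Metric.tendsto_nhds]
  intro ε hε
  set N := ‖hr.toLp r‖ with hN
  have hN0 : 0 ≤ N := norm_nonneg _
  obtain ⟨V, hV, hVK⟩ := (isCompact_Icc (a := -R) (b := R)).mem_uniformity_of_prod
    (f := fun t x => Θ x t) (s := univ) (q := t)
    (u := {z | dist z.1 z.2 < ε / (N + 1)})
    (continuous_comp_uncurry hΘ continuous_snd continuous_fst).continuousOn (mem_univ t)
    (Metric.dist_mem_uniformity (by positivity))
  rw [nhdsWithin_univ] at hV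
  filter_upwards [hV] with τ hτ
  rw [dist_eq_norm, ← MemLp.toLp_sub]
  have hle : ‖((hmem τ).sub (hmem t)).toLp _‖ ≤ ε / (N + 1) * ‖hr.toLp r‖ := by
    refine Lp.norm_le_mul_norm_of_ae_le_mul ?_
    filter_upwards [((hmem τ).sub (hmem t)).coeFn_toLp, hr.coeFn_toLp] with x h1 h2
    rw [h1, h2, Pi.sub_apply, ← mul_sub, norm_mul, mul_comm]
    by_cases hx : x ∈ Icc (-R) R
    · have := hVK τ hτ x hx
      simp only [mem_ofPred_eq, Real.dist_eq] at this
      exact mul_le_mul_of_nonneg_right this.le (norm_nonneg _)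
    · simp [hR x hx]
  refine hle.trans_lt ?_
  rw [← hN, div_mul_eq_mul_div, div_lt_iff₀ (by positivity)]
  nlinarith

theorem integrable_mul_and_integral_eq_inner {f w : LineSpace} {h : ℝ → ℝ}
    (hw : w =ᵐ[volume] h) :
    Integrable (fun x => f x * h x) ∧ ∫ x, f x * h x = inner ℝ f w := by
  have e : (fun x => inner ℝ (f x) (w x)) =ᵐ[volume] fun x => f x * h x := by
    filter_upwards [hw] with x hx
    rw [hx]; simp [mul_comm]
  exact ⟨(L2.integrable_inner f w).congr e, by rw [L2.inner_def]; exact (integral_congr_ae e).symm⟩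

/-- Test functions need compact support for negative times as well. The factor `smoothTransition (t
+ 2)` vanishes for t ≤ -2 and is 1 for t ≥ -1, hence near every t ≥ 0. -/
theorem exists_cutoff {B : ℝ → ℝ} (hB : ContDiff ℝ ∞ B) {T : ℝ} (hT : ∀ t, T ≤ t → B t = 0) :
    ∃ b : ℝ → ℝ, ContDiff ℝ ∞ b ∧ (∀ t, T ≤ t → b t = 0) ∧ HasCompactSupport b ∧
      ∀ t, 0 ≤ t → b t = B t ∧ deriv b t = deriv B t ∧ deriv (deriv b) t = deriv (deriv B) t := by
  refine ⟨fun t => Real.smoothTransition (t + 2) * B t,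
    (Real.smoothTransition.contDiff.comp (contDiff_id.add contDiff_const)).mul hB,
    fun t ht => by simp [hT t ht], ?_, fun t ht => ?_⟩
  · refine HasCompactSupport.intro (isCompact_Icc (a := -2) (b := T)) fun t ht => ?_
    rcases lt_or_ge t (-2) with h | h
    · rw [Real.smoothTransition.zero_of_nonpos (by linarith), zero_mul]
    · rw [hT t (le_of_not_ge fun h' => ht ⟨h, h'⟩), mul_zero]
  · have e : (fun t => Real.smoothTransition (t + 2) * B t) =ᶠ[nhds t] B := by
      filter_upwards [lt_mem_nhds (show -1 < t by linarith)] with s hs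
      rw [Real.smoothTransition.one_of_one_le (by linarith), one_mul]
    exact ⟨e.eq_of_nhds, e.deriv_eq, e.deriv.deriv_eq⟩

theorem hasDerivAt_integral {f : ℝ → ℝ} (hf : Continuous f) (a t : ℝ) :
    HasDerivAt (fun t => ∫ s in a..t, f s) (f t) t :=
  intervalIntegral.integral_hasDerivAt_right (hf.intervalIntegrable _ _)
    (hf.stronglyMeasurableAtFilter _ _) hf.continuousAt

theorem contDiff_integral {f : ℝ → ℝ} (hf : ContDiff ℝ ∞ f) (a : ℝ) :
    ContDiff ℝ ∞ fun t => ∫ s in a..t, f s := by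
  rw [contDiff_infty_iff_deriv]
  exact ⟨fun t => (hasDerivAt_integral hf.continuous a t).differentiableAt, by
    rwa [funext fun t => (hasDerivAt_integral hf.continuous a t).deriv]⟩

/-- A distributional second order identity on `(0, T)`, including the initial conditions, in its
twice integrated form. -/
theorem integrated_identity {T : ℝ} (hT0 : 0 < T) {H K P : ℝ → ℝ} (hH : Continuous H)
    (hK : Continuous K) (hP : Continuous P)
    (h : ∀ B : ℝ → ℝ, ContDiff ℝ ∞ B → (∀ t, T ≤ t → B t = 0) →
      ∫ t in (0 : ℝ)..T, (deriv (deriv B) t * H t - 2 * (deriv B t * K t) + B t * P t) = 0) :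
    ∀ t ∈ Ioo 0 T, H t + 2 * (∫ s in (0 : ℝ)..t, K s)
      + ∫ s in (0 : ℝ)..t, ∫ r in (0 : ℝ)..s, P r = 0 := by
  set K1 : ℝ → ℝ := fun t => ∫ s in (0 : ℝ)..t, K s with hK1
  set P1 : ℝ → ℝ := fun t => ∫ s in (0 : ℝ)..t, P s with hP1
  set P2 : ℝ → ℝ := fun t => ∫ s in (0 : ℝ)..t, P1 s with hP2
  have dK1 : ∀ t, HasDerivAt K1 (K t) t := hasDerivAt_integral hK 0
  have dP1 : ∀ t, HasDerivAt P1 (P t) t := hasDerivAt_integral hP 0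
  have cK1 : Continuous K1 := continuous_iff_continuousAt.2 fun t => (dK1 t).continuousAt
  have cP1 : Continuous P1 := continuous_iff_continuousAt.2 fun t => (dP1 t).continuousAt
  have dP2 : ∀ t, HasDerivAt P2 (P1 t) t := hasDerivAt_integral cP1 0
  have cP2 : Continuous P2 := continuous_iff_continuousAt.2 fun t => (dP2 t).continuousAt
  have hZ : Continuous fun t => H t + 2 * K1 t + P2 t := (hH.add (cK1.const_mul 2)).add cP2
  have hae : ∀ᵐ t, t ∈ Ioo 0 T → H t + 2 * K1 t + P2 t = 0 := by
    refine isOpen_Ioo.ae_eq_zero_of_integral_contDiff_smul_eq_zero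
      (hZ.locallyIntegrable.locallyIntegrableOn _) fun ψ hψ hψc hψs => ?_
    have hψT : ∀ t, T ≤ t → ψ t = 0 := fun t ht =>
      image_eq_zero_of_notMem_tsupport fun h' => ((hψs h').2.trans_le ht).false
    have hψ0 : ∀ t, t ≤ 0 → ψ t = 0 := fun t ht =>
      image_eq_zero_of_notMem_tsupport fun h' => ((hψs h').1.trans_le ht).false
    -- B is the second primitive of ψ taken from T, so it vanishes for t ≥ T but is free at t = 0.
    -- This freedom encodes the zero initial data and excludes an additive affine function in the
    -- conclusion.
    set A : ℝ → ℝ := fun t => ∫ s in T..t, ψ s with hA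
    set B : ℝ → ℝ := fun t => ∫ s in T..t, A s with hB
    have cA : ContDiff ℝ ∞ A := contDiff_integral hψ T
    have cB : ContDiff ℝ ∞ B := contDiff_integral cA T
    have dA : ∀ t, HasDerivAt A (ψ t) t := hasDerivAt_integral hψ.continuous T
    have dB : ∀ t, HasDerivAt B (A t) t := hasDerivAt_integral cA.continuous T
    have eB : deriv B = A := funext fun t => (dB t).deriv
    have eA : deriv A = ψ := funext fun t => (dA t).deriv
    have hAT : ∀ t, T ≤ t → A t = 0 := fun t ht => by
      rw [hA]
      refine intervalIntegral.integral_zero_ae (Filter.Eventually.of_forall fun s hs => ?_)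
      rw [uIoc_of_le ht] at hs
      exact hψT s hs.1.le
    have hBT : ∀ t, T ≤ t → B t = 0 := fun t ht => by
      rw [hB]
      refine intervalIntegral.integral_zero_ae (Filter.Eventually.of_forall fun s hs => ?_)
      rw [uIoc_of_le ht] at hs
      exact hAT s hs.1.le
    have key := h B cB hBT
    rw [eB, eA] at key
    have i1 : ∫ t in (0 : ℝ)..T, A t * K t = - ∫ t in (0 : ℝ)..T, ψ t * K1 t := by
      rw [intervalIntegral.integral_mul_deriv_eq_deriv_mul (fun t _ => dA t) (fun t _ => dK1 t)
        (hψ.continuous.intervalIntegrable _ _) (hK.intervalIntegrable _ _), hAT T le_rfl]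
      simp [hK1]
    have i2 : ∫ t in (0 : ℝ)..T, B t * P t = - ∫ t in (0 : ℝ)..T, A t * P1 t := by
      rw [intervalIntegral.integral_mul_deriv_eq_deriv_mul (fun t _ => dB t) (fun t _ => dP1 t)
        (cA.continuous.intervalIntegrable _ _) (hP.intervalIntegrable _ _), hBT T le_rfl]
      simp [hP1]
    have i3 : ∫ t in (0 : ℝ)..T, A t * P1 t = - ∫ t in (0 : ℝ)..T, ψ t * P2 t := by
      rw [intervalIntegral.integral_mul_deriv_eq_deriv_mul (fun t _ => dA t) (fun t _ => dP2 t)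
        (hψ.continuous.intervalIntegrable _ _) (cP1.intervalIntegrable _ _), hAT T le_rfl]
      simp [hP2]
    have I : ∀ {f : ℝ → ℝ}, Continuous f → IntervalIntegrable f volume 0 T :=
      fun hf => hf.intervalIntegrable _ _
    have cψ := hψ.continuous
    have cA' := cA.continuous
    have cB' := cB.continuous
    rw [intervalIntegral.integral_add (I (by fun_prop)) (I (by fun_prop)),
      intervalIntegral.integral_sub (I (by fun_prop)) (I (by fun_prop)),
      intervalIntegral.integral_const_mul, i1, i2, i3] at key
    have e : ∫ t, ψ t • (H t + 2 * K1 t + P2 t)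
        = ∫ t in (0 : ℝ)..T, (ψ t * H t + 2 * (ψ t * K1 t) + ψ t * P2 t) := by
      rw [intervalIntegral.integral_of_le hT0.le, setIntegral_eq_integral_of_forall_compl_eq_zero]
      · congr 1; ext t; rw [smul_eq_mul]; ring
      · intro t ht
        have : ψ t = 0 := by
          rcases le_or_gt t 0 with h1 | h1
          · exact hψ0 t h1
          · exact hψT t (le_of_not_ge fun h2 => ht ⟨h1, h2⟩)
        simp [this]
    rw [e, intervalIntegral.integral_add (I (by fun_prop)) (I (by fun_prop)),
      intervalIntegral.integral_add (I (by fun_prop)) (I (by fun_prop)),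
      intervalIntegral.integral_const_mul]
    linarith
  have hae' : (fun t => H t + 2 * K1 t + P2 t) =ᵐ[volume.restrict (Ioo 0 T)] fun _ => (0 : ℝ) :=
    (ae_restrict_iff' measurableSet_Ioo).2 hae
  exact Measure.eqOn_open_of_ae_eq hae' isOpen_Ioo hZ.continuousOn continuousOn_const

end Uniqueness

/-! ### Solutions of the free wave equation used as test functions -/

section DualSolution

/-- The solution of the wave equation with the data `0` and `-g` at time `t₁`. -/
def dualWave (g : ℝ → ℝ) (t₁ x t : ℝ) : ℝ :=
  ((∫ y in (0 : ℝ)..x + (t₁ - t), g y) - ∫ y in (0 : ℝ)..x - (t₁ - t), g y) / 2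

variable {g : ℝ → ℝ}

theorem dualWave_eq (hg : Continuous g) (t₁ x t : ℝ) :
    dualWave g t₁ x t = (∫ y in (x - (t₁ - t))..(x + (t₁ - t)), g y) / 2 := by
  rw [dualWave, intervalIntegral.integral_interval_sub_left
    (hg.intervalIntegrable _ _) (hg.intervalIntegrable _ _)]

/-- The explicit factor t₁ - t is what will allow differentiation at t₁ of a pairing with a curve
that is only continuous. -/
theorem dualWave_eq_mul (hg : Continuous g) (t₁ x t : ℝ) :
    dualWave g t₁ x t = (t₁ - t) * ((∫ θ in (-1 : ℝ)..1, g (x + (t₁ - t) * θ)) / 2) := by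
  rw [dualWave_eq hg, ← mul_div_assoc, intervalIntegral.mul_integral_comp_add_mul]
  congr 3 <;> ring

theorem contDiff_dualWave (hg : ContDiff ℝ ∞ g) (t₁ : ℝ) :
    ContDiff ℝ ∞ (Function.uncurry (dualWave g t₁)) := by
  have h := contDiff_integral hg 0
  have h1 : ContDiff ℝ ∞ fun z : ℝ × ℝ => z.1 + (t₁ - z.2) := by fun_prop
  have h2 : ContDiff ℝ ∞ fun z : ℝ × ℝ => z.1 - (t₁ - z.2) := by fun_prop
  exact ((h.comp h1).sub (h.comp h2)).div_const 2

theorem dualWave_eq_zero {L : ℝ} (hL : ∀ x, L < |x| → g x = 0) (hg : Continuous g) {t₁ x t : ℝ}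
    (h : L + |t₁ - t| < |x|) : dualWave g t₁ x t = 0 := by
  have h0 : ∀ y ∈ uIcc (x - (t₁ - t)) (x + (t₁ - t)), g y = 0 := by
    intro y hy
    have h1 : |y - x| ≤ |t₁ - t| := by
      rw [mem_uIcc] at hy
      rcases hy with hy | hy <;> rw [abs_le] <;> constructor <;>
        cases abs_cases (t₁ - t) <;> linarith
    apply hL
    have := abs_sub_abs_le_abs_sub x y
    rw [abs_sub_comm] at h1
    linarith
  rw [dualWave_eq hg, intervalIntegral.integral_congr (g := fun _ => 0) h0]
  simp

theorem wave_mul_dualWave (hg : ContDiff ℝ ∞ g) {b : ℝ → ℝ} (hb : ContDiff ℝ ∞ b) (t₁ x t : ℝ) :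
    wave (fun x t => b t * dualWave g t₁ x t) x t = deriv (deriv b) t * dualWave g t₁ x t
      - 2 * (deriv b t * ((g (x + (t₁ - t)) + g (x - (t₁ - t))) / 2)) := by
  have hG : ∀ y, HasDerivAt (fun y => ∫ s in (0 : ℝ)..y, g s) (g y) y :=
    hasDerivAt_integral hg.continuous 0
  have hg' : ∀ y, HasDerivAt g (deriv g y) y := fun y =>
    (hg.differentiable (by simp)).differentiableAt.hasDerivAt
  have hb1 : ∀ t, HasDerivAt b (deriv b t) t := fun y =>
    (hb.differentiable (by simp)).differentiableAt.hasDerivAt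
  have hb2 : ∀ t, HasDerivAt (deriv b) (deriv (deriv b) t) t := fun y =>
    ((contDiff_infty_iff_deriv.1 hb).2.differentiable (by simp)).differentiableAt.hasDerivAt
  have ht1 : ∀ t, HasDerivAt (fun t => x + (t₁ - t)) (-1) t := fun t =>
    ((hasDerivAt_id t).const_sub t₁).const_add x
  have ht2 : ∀ t, HasDerivAt (fun t => x - (t₁ - t)) 1 t := fun t =>
    (((hasDerivAt_id t).const_sub t₁).const_sub x).congr_deriv (by norm_num)
  have hx1 : ∀ x, HasDerivAt (fun x => x + (t₁ - t)) 1 x := fun x =>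
    (hasDerivAt_id x).add_const _
  have hx2 : ∀ x, HasDerivAt (fun x => x - (t₁ - t)) 1 x := fun x =>
    (hasDerivAt_id x).sub_const _
  have h3 : ∀ f : ℝ → ℝ, iteratedDeriv 2 f = deriv (deriv f) := fun f => by
    rw [iteratedDeriv_succ, iteratedDeriv_one]
  have dt : ∀ t, HasDerivAt (fun t => dualWave g t₁ x t)
      (-((g (x + (t₁ - t)) + g (x - (t₁ - t))) / 2)) t := fun t =>
    ((((hG _).comp t (ht1 t)).sub ((hG _).comp t (ht2 t))).div_const 2).congr_deriv (by ring)
  have dtt : ∀ t, HasDerivAt (fun t => -((g (x + (t₁ - t)) + g (x - (t₁ - t))) / 2))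
      ((deriv g (x + (t₁ - t)) - deriv g (x - (t₁ - t))) / 2) t := fun t =>
    ((((hg' _).comp t (ht1 t)).add ((hg' _).comp t (ht2 t))).div_const 2).neg.congr_deriv (by ring)
  have dx : ∀ x, HasDerivAt (fun x => b t * dualWave g t₁ x t)
      (b t * ((g (x + (t₁ - t)) - g (x - (t₁ - t))) / 2)) x := fun x =>
    (((((hG _).comp x (hx1 x)).sub ((hG _).comp x (hx2 x))).div_const 2).const_mul
      (b t)).congr_deriv (by ring)
  have dxx : ∀ x, HasDerivAt (fun x => b t * ((g (x + (t₁ - t)) - g (x - (t₁ - t))) / 2))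
      (b t * ((deriv g (x + (t₁ - t)) - deriv g (x - (t₁ - t))) / 2)) x := fun x =>
    (((((hg' _).comp x (hx1 x)).sub ((hg' _).comp x (hx2 x))).div_const 2).const_mul
      (b t)).congr_deriv (by ring)
  have dm : ∀ t, HasDerivAt (fun t => b t * dualWave g t₁ x t) (deriv b t * dualWave g t₁ x t
      + b t * (-((g (x + (t₁ - t)) + g (x - (t₁ - t))) / 2))) t := fun t => (hb1 t).mul (dt t)
  have dmm := ((hb2 t).mul (dt t)).add ((hb1 t).mul (dtt t))
  rw [wave, h3, h3, funext fun x => (dx x).deriv, (dxx x).deriv, funext fun t => (dm t).deriv]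
  erw [dmm.deriv]
  ring

/-- Cauchy–Schwarz against the indicator of (a, b]. The dual wave is thus bounded by the L₂ norm of
g alone, as the density argument requires. -/
theorem abs_integral_le_sqrt_mul_norm {gL : LineSpace} (hgL : gL =ᵐ[volume] g) {a b : ℝ}
    (hab : a ≤ b) : |∫ y in a..b, g y| ≤ ‖gL‖ * Real.sqrt (b - a) := by
  have h1 : ∫ y in a..b, g y = inner ℝ (indicatorConstLp 2 measurableSet_Ioc
      (by simp : volume (Ioc a b) ≠ ⊤) (1 : ℝ)) gL := by
    rw [L2.inner_indicatorConstLp_one, intervalIntegral.integral_of_le hab]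
    exact integral_congr_ae (ae_restrict_of_ae hgL.symm)
  rw [h1, mul_comm]
  refine (abs_real_inner_le_norm _ _).trans (mul_le_mul_of_nonneg_right ?_ (norm_nonneg _))
  refine norm_indicatorConstLp_le.trans ?_
  rw [norm_one, one_mul, Real.sqrt_eq_rpow, Measure.real, Real.volume_Ioc,
    ENNReal.toReal_ofReal (by linarith)]
  simp

theorem abs_dualWave_le (hg : Continuous g) {gL : LineSpace} (hgL : gL =ᵐ[volume] g)
    {T t₁ t : ℝ} (ht : 0 ≤ t) (ht₁ : t ≤ t₁) (hT : t₁ ≤ T) (x : ℝ) :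
    |dualWave g t₁ x t| ≤ ‖gL‖ * Real.sqrt (2 * T) := by
  rw [dualWave_eq hg, abs_div, abs_two]
  have h1 := abs_integral_le_sqrt_mul_norm hgL
    (show x - (t₁ - t) ≤ x + (t₁ - t) by linarith)
  have h2 : Real.sqrt (x + (t₁ - t) - (x - (t₁ - t))) ≤ Real.sqrt (2 * T) :=
    Real.sqrt_le_sqrt (by linarith)
  have h3 := mul_le_mul_of_nonneg_left h2 (norm_nonneg gL)
  have h4 := abs_nonneg (∫ y in (x - (t₁ - t))..(x + (t₁ - t)), g y)
  linarith

end DualSolution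

/-! ### A homogeneous generalized solution vanishes -/

section HomogeneousUniqueness

variable {p : ℝ → ℝ} {T L : ℝ} {v : ℝ → LineSpace} {g : ℝ → ℝ}

/-- The slope at t₁ is exactly -N(t), so continuity of N suffices. -/
theorem hasDerivAt_sub_mul {N : ℝ → ℝ} {t₁ : ℝ} (hN : ContinuousAt N t₁) :
    HasDerivAt (fun t => (t₁ - t) * N t) (-N t₁) t₁ := by
  rw [hasDerivAt_iff_tendsto_slope]
  refine (hN.neg.tendsto.mono_left nhdsWithin_le_nhds).congr' ?_
  filter_upwards [self_mem_nhdsWithin] with t ht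
  have : t - t₁ ≠ 0 := sub_ne_zero.2 ht
  rw [slope_def_field, Pi.neg_apply]
  field_simp
  ring

/-- Testing a homogeneous generalized solution against solutions of the free wave equation. -/
theorem abs_inner_le_of_homogeneous (hp : MemLp p 2 volume)
    (hpL : ∀ x, x ∉ Icc (-L) L → p x = 0) (hv : Continuous v)
    (hweak : ∀ φ : ℝ → ℝ → ℝ, ContDiff ℝ ∞ (Function.uncurry φ) →
      HasCompactSupport (Function.uncurry φ) → (∀ x t, T ≤ t → φ x t = 0) →
      ∫ t in (0 : ℝ)..T, ∫ x, v t x * waveWithPotential p φ x t = 0)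
    (hg : ContDiff ℝ ∞ g) (hgc : HasCompactSupport g) {gL : LineSpace} (hgL : gL =ᵐ[volume] g)
    {t₁ : ℝ} (ht₁ : t₁ ∈ Ioo 0 T) :
    |inner ℝ (v t₁) gL| ≤ ‖gL‖ * (Real.sqrt (2 * T) * ‖hp.toLp p‖ * ∫ t in (0 : ℝ)..t₁, ‖v t‖) := by
  have hT0 : 0 < T := ht₁.1.trans ht₁.2
  have hgc' := hg.continuous
  obtain ⟨M, hM⟩ := hgc.isCompact.isBounded.exists_norm_le
  have hgM : ∀ x, M < |x| → g x = 0 := fun x hx =>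
    image_eq_zero_of_notMem_tsupport fun h => (hM x h).not_gt hx
  -- Finite speed: g lives in |x| ≤ M and |t₁ - t| ≤ T, so the dual wave and its averages live in
  -- |x| ≤ R.
  set R := |M| + T with hR
  have habs : ∀ t ∈ Icc 0 T, |t₁ - t| ≤ T := fun t ht =>
    abs_le.2 ⟨by linarith [ht.2, ht₁.1], by linarith [ht.1, ht₁.2]⟩
  have hout : ∀ x, x ∉ Icc (-R) R → R < |x| := fun x hx => by
    by_contra h
    exact hx (abs_le.1 (not_lt.1 h))
  set r : ℝ → ℝ := (Icc (-R) R).indicator 1 with hr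
  have hrm : MemLp r 2 volume := memLp_indicator_const 2 measurableSet_Icc (1 : ℝ) (Or.inr (by simp))
  have hr0 : ∀ x, x ∉ Icc (-R) R → r x = 0 := fun x hx => indicator_of_notMem hx _
  have hr1 : ∀ x, x ∈ Icc (-R) R → r x = 1 := fun x hx => indicator_of_mem hx _
  set κ : ℝ → ℝ → ℝ := fun x t => (g (x + (t₁ - t)) + g (x - (t₁ - t))) / 2 with hκ
  set γ : ℝ → ℝ → ℝ := fun x t => (∫ θ in (-1 : ℝ)..1, g (x + (t₁ - t) * θ)) / 2 with hγ
  have cD : Continuous (Function.uncurry (dualWave g t₁)) := (contDiff_dualWave hg t₁).continuous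
  have cκ : Continuous (Function.uncurry κ) := by
    change Continuous fun z : ℝ × ℝ => (g (z.1 + (t₁ - z.2)) + g (z.1 - (t₁ - z.2))) / 2
    fun_prop
  have cγ : Continuous (Function.uncurry γ) := by
    refine Continuous.div_const (intervalIntegral.continuous_parametric_intervalIntegral_of_continuous'
      (f := fun (z : ℝ × ℝ) θ => g (z.1 + (t₁ - z.2) * θ)) ?_ _ _) _
    change Continuous fun w : (ℝ × ℝ) × ℝ => g (w.1.1 + (t₁ - w.1.2) * w.2)
    fun_prop
  have zD : ∀ t ∈ Icc 0 T, ∀ x, r x * dualWave g t₁ x t = dualWave g t₁ x t := fun t ht x => by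
    by_cases hx : x ∈ Icc (-R) R
    · rw [hr1 x hx, one_mul]
    · rw [dualWave_eq_zero hgM hgc' (by linarith [hout x hx, habs t ht, le_abs_self M]), mul_zero]
  have zκ : ∀ t ∈ Icc 0 T, ∀ x, r x * κ x t = κ x t := fun t ht x => by
    by_cases hx : x ∈ Icc (-R) R
    · rw [hr1 x hx, one_mul]
    · have h1 := hout x hx
      have h2 := habs t ht
      have h3 := le_abs_self M
      have h4 : M < |x + (t₁ - t)| := by
        have := abs_sub_abs_le_abs_sub x (-(t₁ - t))
        rw [sub_neg_eq_add, abs_neg] at this; linarith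
      have h5 : M < |x - (t₁ - t)| := by
        have := abs_sub_abs_le_abs_sub x (t₁ - t)
        linarith
      simp [hκ, hgM _ h4, hgM _ h5]
  have zγ : ∀ t ∈ Icc 0 T, ∀ x, r x * γ x t = γ x t := fun t ht x => by
    by_cases hx : x ∈ Icc (-R) R
    · rw [hr1 x hx, one_mul]
    · have h1 := hout x hx
      have h2 := habs t ht
      have h3 := le_abs_self M
      have : ∀ θ ∈ uIcc (-1 : ℝ) 1, g (x + (t₁ - t) * θ) = 0 := fun θ hθ => by
        rw [uIcc_of_le (by norm_num)] at hθ
        have h4 : |(t₁ - t) * θ| ≤ T := by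
          rw [abs_mul]
          have := abs_le.2 hθ
          nlinarith [abs_nonneg (t₁ - t), abs_nonneg θ]
        have := abs_sub_abs_le_abs_sub x (-((t₁ - t) * θ))
        rw [sub_neg_eq_add, abs_neg] at this
        exact hgM _ (by linarith)
      simp [hγ, intervalIntegral.integral_congr (g := fun _ => (0 : ℝ)) this]
  obtain ⟨wD, wDc, hwD⟩ := exists_continuous_Lp_mul hrm hr0 cD
  obtain ⟨wκ, wκc, hwκ⟩ := exists_continuous_Lp_mul hrm hr0 cκ
  obtain ⟨wγ, wγc, hwγ⟩ := exists_continuous_Lp_mul hrm hr0 cγ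
  obtain ⟨wP, wPc, hwP⟩ := exists_continuous_Lp_mul hp hpL cD
  -- Write D for the dual wave and κ = -D_t. Since D solves the free equation, testing with b(t) D
  -- leaves b''(v, D) - 2b'(v, κ) + b(v, pD).
  have key := integrated_identity hT0 (H := fun t => inner ℝ (v t) (wD t))
    (K := fun t => inner ℝ (v t) (wκ t)) (P := fun t => inner ℝ (v t) (wP t))
    (hv.inner wDc) (hv.inner wκc) (hv.inner wPc) fun B hB hBT => by
      obtain ⟨b, hb, hbT, hbc, hbB⟩ := exists_cutoff hB hBT
      have hφ : ContDiff ℝ ∞ (Function.uncurry fun x t => b t * dualWave g t₁ x t) :=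
        (hb.comp contDiff_snd).mul (contDiff_dualWave hg t₁)
      obtain ⟨S, hS⟩ := hbc.isCompact.isBounded.exists_norm_le
      have hbS : ∀ t, S < |t| → b t = 0 := fun t ht =>
        image_eq_zero_of_notMem_tsupport fun h => (hS t h).not_gt ht
      have hφc : HasCompactSupport (Function.uncurry fun x t => b t * dualWave g t₁ x t) := by
        refine HasCompactSupport.intro
          (isCompact_Icc (a := -(M + (|t₁| + S))) (b := M + (|t₁| + S)) |>.prod
            (isCompact_Icc (a := -S) (b := S))) fun z hz => ?_
        change b z.2 * dualWave g t₁ z.1 z.2 = 0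
        by_cases h2 : S < |z.2|
        · rw [hbS _ h2, zero_mul]
        · rw [dualWave_eq_zero hgM hgc', mul_zero]
          by_contra h3
          refine hz ⟨abs_le.1 ?_, abs_le.1 (not_lt.1 h2)⟩
          have := abs_sub t₁ z.2
          linarith
      refine Eq.trans ?_ (hweak _ hφ hφc fun x t ht => by simp [hbT t ht])
      apply intervalIntegral.integral_congr
      intro t ht
      rw [uIcc_of_le hT0.le] at ht
      obtain ⟨e0, e1, e2⟩ := hbB t ht.1
      obtain ⟨iD, eD⟩ := integrable_mul_and_integral_eq_inner (f := v t) (hwD t)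
      obtain ⟨iκ, eκ⟩ := integrable_mul_and_integral_eq_inner (f := v t) (hwκ t)
      obtain ⟨iP, eP⟩ := integrable_mul_and_integral_eq_inner (f := v t) (hwP t)
      simp only
      rw [← eD, ← eκ, ← eP]
      simp only [← integral_const_mul]
      have i1 := iD.const_mul (deriv (deriv B) t)
      have i2 := (iκ.const_mul (deriv B t)).const_mul 2
      have i3 : Integrable fun x => deriv (deriv B) t * (v t x * (r x * dualWave g t₁ x t))
        - 2 * (deriv B t * (v t x * (r x * κ x t))) := i1.sub i2
      rw [← integral_sub i1 i2, ← integral_add i3 (iP.const_mul _)]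
      congr 1
      ext x
      rw [waveWithPotential, wave_mul_dualWave hg hb, zD t ht, zκ t ht, e0, e1, e2]
      ring
  set N : ℝ → ℝ := fun t => inner ℝ (v t) (wγ t) with hN
  set P : ℝ → ℝ := fun t => inner ℝ (v t) (wP t) with hP
  have cP : Continuous P := hv.inner wPc
  have hHN : ∀ t ∈ Icc 0 T, inner ℝ (v t) (wD t) = (t₁ - t) * N t := fun t ht => by
    rw [hN, ← real_inner_smul_right]
    congr 1
    refine Lp.ext ?_
    filter_upwards [Lp.coeFn_smul (t₁ - t) (wγ t), hwD t, hwγ t] with x h1 h2 h3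
    rw [h1, h2, Pi.smul_apply, h3, zD t ht, zγ t ht, dualWave_eq_mul hgc', smul_eq_mul]
  have hat : ∀ f : ℝ → ℝ → ℝ, (∀ x, f x t₁ = g x) → (∀ t ∈ Icc 0 T, ∀ x, r x * f x t = f x t) →
      ∀ w : ℝ → LineSpace, (∀ t, w t =ᵐ[volume] fun x => r x * f x t) → w t₁ = gL := by
    intro f hf1 hf2 w hw
    refine Lp.ext ?_
    filter_upwards [hw t₁, hgL] with x h1 h2
    rw [h1, h2, hf2 t₁ (Ioo_subset_Icc_self ht₁), hf1]
  have eγ : wγ t₁ = gL := hat γ (fun x => by simp [hγ]; ring) zγ wγ hwγ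
  have eκ : wκ t₁ = gL := hat κ (fun x => by simp [hκ]) zκ wκ hwκ
  have d1 : HasDerivAt (fun t => inner ℝ (v t) (wD t)) (-inner ℝ (v t₁) gL) t₁ := by
    have := hasDerivAt_sub_mul (N := N) (t₁ := t₁) (hv.inner wγc).continuousAt
    simp only [hN, eγ] at this
    refine this.congr_of_eventuallyEq ?_
    filter_upwards [Ioo_mem_nhds ht₁.1 ht₁.2] with t ht using hHN t (Ioo_subset_Icc_self ht)
  have cPi : Continuous fun s => ∫ r in (0 : ℝ)..s, P r :=
    continuous_iff_continuousAt.2 fun t => (hasDerivAt_integral cP 0 t).continuousAt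
  have d2 := (d1.add ((hasDerivAt_integral (hv.inner wκc) 0 t₁).const_mul 2)).add
    (hasDerivAt_integral cPi 0 t₁)
  have d3 : HasDerivAt (fun _ : ℝ => (0 : ℝ)) 0 t₁ := hasDerivAt_const _ _
  -- The twice integrated identity is differentiated once, at t₁ only. There κ = g, so the first two
  -- terms add up to (v(t₁), g).
  have e : -inner ℝ (v t₁) gL + 2 * inner ℝ (v t₁) (wκ t₁) + (∫ r in (0 : ℝ)..t₁, P r) = 0 := by
    refine d2.unique (d3.congr_of_eventuallyEq ?_)
    filter_upwards [Ioo_mem_nhds ht₁.1 ht₁.2] with t ht using key t ht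
  rw [eκ] at e
  have e' : inner ℝ (v t₁) gL = -∫ r in (0 : ℝ)..t₁, P r := by linarith
  rw [e', abs_neg, ← mul_assoc, ← intervalIntegral.integral_const_mul]
  refine (intervalIntegral.abs_integral_le_integral_abs ht₁.1.le).trans
    (intervalIntegral.integral_mono_on ht₁.1.le (cP.abs.intervalIntegrable _ _)
      ((hv.norm.const_mul _).intervalIntegrable _ _) fun t ht => ?_)
  refine (abs_real_inner_le_norm _ _).trans ?_
  have : ‖wP t‖ ≤ ‖gL‖ * Real.sqrt (2 * T) * ‖hp.toLp p‖ := by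
    refine Lp.norm_le_mul_norm_of_ae_le_mul ?_
    filter_upwards [hwP t, hp.coeFn_toLp] with x h1 h2
    rw [h1, h2, norm_mul, mul_comm]
    exact mul_le_mul_of_nonneg_right (abs_dualWave_le hgc' hgL ht.1 ht.2 ht₁.2.le x) (norm_nonneg _)
  rw [mul_comm, ← mul_assoc]
  exact mul_le_mul_of_nonneg_right this (norm_nonneg _)

/-- The bound on (v(t), g) for smooth compactly supported g extends to all of L₂ by density. Taking
g = v(t) gives ‖v(t)‖ ≤ C ∫₀ᵗ ‖v‖, and Gronwall finishes. -/
theorem eq_zero_of_homogeneous (hT0 : 0 < T) (hp : MemLp p 2 volume)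
    (hpL : ∀ x, x ∉ Icc (-L) L → p x = 0) (hv : Continuous v)
    (hweak : ∀ φ : ℝ → ℝ → ℝ, ContDiff ℝ ∞ (Function.uncurry φ) →
      HasCompactSupport (Function.uncurry φ) → (∀ x t, T ≤ t → φ x t = 0) →
      ∫ t in (0 : ℝ)..T, ∫ x, v t x * waveWithPotential p φ x t = 0) :
    ∀ t ∈ Icc 0 T, v t = 0 := by
  set C := Real.sqrt (2 * T) * ‖hp.toLp p‖ with hC
  have h1 : ∀ t ∈ Ioo 0 T, ‖v t‖ ≤ C * ∫ s in (0 : ℝ)..t, ‖v s‖ := by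
    intro t ht
    have hI : 0 ≤ C * ∫ s in (0 : ℝ)..t, ‖v s‖ :=
      mul_nonneg (by positivity)
        (intervalIntegral.integral_nonneg ht.1.le fun _ _ => norm_nonneg _)
    have hall : ∀ w : LineSpace, |inner ℝ (v t) w| ≤ ‖w‖ * (C * ∫ s in (0 : ℝ)..t, ‖v s‖) := by
      intro w
      have hcl : IsClosed {w : LineSpace | |inner ℝ (v t) w|
          ≤ ‖w‖ * (C * ∫ s in (0 : ℝ)..t, ‖v s‖)} :=
        isClosed_le (by fun_prop) (by fun_prop)
      have hd := Lp.dense_hasCompactSupport_contDiff (E := ℝ) (F := ℝ) (μ := volume)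
        (p := 2) (by simp)
      refine (hcl.closure_subset_iff.2 ?_) (hd w)
      rintro w ⟨g, hw, hgc, hg⟩
      exact abs_inner_le_of_homogeneous hp hpL hv hweak hg hgc hw ht
    have h2 := hall (v t)
    rw [real_inner_self_eq_norm_mul_norm, abs_mul_self] at h2
    rcases (norm_nonneg (v t)).eq_or_lt with h3 | h3
    · rw [← h3]; exact hI
    · exact le_of_mul_le_mul_left h2 h3
  have h2 : ∀ t ∈ Icc 0 T, ‖v t‖ ≤ C * ∫ s in (0 : ℝ)..t, ‖v s‖ := by
    have hcl : IsClosed {t : ℝ | ‖v t‖ ≤ C * ∫ s in (0 : ℝ)..t, ‖v s‖} := by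
      refine isClosed_le hv.norm (Continuous.const_mul ?_ _)
      exact continuous_iff_continuousAt.2 fun t => (hasDerivAt_integral hv.norm 0 t).continuousAt
    rw [← closure_Ioo hT0.ne]
    exact hcl.closure_subset_iff.2 h1
  intro t ht
  exact norm_eq_zero.1 (eq_zero_of_le_mul_integral hv.norm.continuousOn
    (fun _ _ => norm_nonneg _) h2 t ht)

end HomogeneousUniqueness

/-! ### Integrability of the potential on the line -/

section LinePotential

variable {q : ℝ → ℝ}

theorem linePotential_eq (q : ℝ → ℝ) : linePotential q = fun x =>
    (Ioo 0 (2 * Real.pi)).indicator q x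
      + (Ioo 0 (2 * Real.pi)).indicator q (x + 2 * Real.pi) := by
  ext x
  have hpi := Real.pi_pos
  rw [linePotential]
  split_ifs with h1 h2
  · rw [indicator_of_mem (mem_Ioo.2 h1), indicator_of_notMem, add_zero]
    exact fun h => by linarith [(mem_Ioo.1 h).2, h1.1]
  · rw [indicator_of_notMem (fun h => h1 (mem_Ioo.1 h)), indicator_of_mem, zero_add]
    exact mem_Ioo.2 ⟨by linarith, by linarith⟩
  · rw [indicator_of_notMem (fun h => h1 (mem_Ioo.1 h)), indicator_of_notMem, zero_add]
    exact fun h => h2 ⟨by linarith [(mem_Ioo.1 h).1], by linarith [(mem_Ioo.1 h).2]⟩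

theorem measurable_linePotential (hq : ContinuousOn q (Ioo 0 (2 * Real.pi))) :
    Measurable (linePotential q) := by
  have h : Measurable ((Ioo 0 (2 * Real.pi)).indicator q) := by
    classical
    rw [← piecewise_eq_indicator]
    exact hq.measurable_piecewise continuousOn_const measurableSet_Ioo
  rw [linePotential_eq]
  exact h.add (h.comp (measurable_id.add_const _))

theorem memLp_linePotential (hq : MemLp q 2 (volume.restrict (Ioo 0 (2 * Real.pi)))) :
    MemLp (linePotential q) 2 volume := by
  have h : MemLp ((Ioo 0 (2 * Real.pi)).indicator q) 2 volume :=
    (memLp_indicator_iff_restrict measurableSet_Ioo).2 hq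
  rw [linePotential_eq]
  exact h.add (h.comp_measurePreserving (measurePreserving_add_right volume (2 * Real.pi)))

theorem integrable_linePotential (hq : MemLp q 2 (volume.restrict (Ioo 0 (2 * Real.pi)))) :
    Integrable (linePotential q) := by
  have h : Integrable ((Ioo 0 (2 * Real.pi)).indicator q) :=
    (integrable_indicator_iff measurableSet_Ioo).2 (hq.integrable (by norm_num))
  rw [linePotential_eq]
  exact h.add (h.comp_add_right (2 * Real.pi))

theorem linePotential_of_notMem (q : ℝ → ℝ) {x : ℝ}
    (hx : x ∉ Icc (-(2 * Real.pi)) (2 * Real.pi)) : linePotential q x = 0 := by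
  have hpi := Real.pi_pos
  rw [linePotential, if_neg fun h => hx ⟨by linarith, h.2.le⟩,
    if_neg fun h => hx ⟨h.1.le, by linarith⟩]

end LinePotential

/-! ### Uniqueness of the generalized solution -/

section GeneralizedSolutionUniqueness

variable {q : ℝ → ℝ} {T : ℝ}

theorem continuous_integral_mul_waveWithPotential {p : ℝ → ℝ} {L : ℝ} (hp : MemLp p 2 volume)
    (hpL : ∀ x, x ∉ Icc (-L) L → p x = 0) {φ : ℝ → ℝ → ℝ}
    (hφ : ContDiff ℝ ∞ (Function.uncurry φ)) (hs : HasCompactSupport (Function.uncurry φ)) :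
    (∀ t (f : LineSpace), Integrable fun x => f x * waveWithPotential p φ x t) ∧
      ∀ v : ℝ → LineSpace, Continuous v →
        Continuous fun t => ∫ x, v t x * waveWithPotential p φ x t := by
  obtain ⟨R, hR⟩ := exists_isTest hφ hs
  have hT := hR R le_rfl
  obtain ⟨w₁, c₁, h₁⟩ := exists_continuous_Lp_mul (r := (Icc (-R) R).indicator 1) (R := R)
    (memLp_indicator_const 2 measurableSet_Icc (1 : ℝ) (Or.inr (by simp)))
    (fun x hx => indicator_of_notMem hx _) (continuous_wave hφ)
  obtain ⟨w₂, c₂, h₂⟩ := exists_continuous_Lp_mul hp hpL hφ.continuous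
  have hw : ∀ t, (w₁ t + w₂ t : LineSpace) =ᵐ[volume] fun x => waveWithPotential p φ x t := by
    intro t
    filter_upwards [Lp.coeFn_add (w₁ t) (w₂ t), h₁ t, h₂ t] with x e0 e1 e2
    rw [e0, Pi.add_apply, e1, e2, waveWithPotential]
    congr 1
    by_cases hx : x ∈ Icc (-R) R
    · simp [indicator_of_mem hx]
    · rw [indicator_of_notMem hx, zero_mul, hT.wave_zero x t (Or.inl _)]
      by_contra h
      exact hx (abs_le.1 (not_le.1 h).le)
  refine ⟨fun t f => (integrable_mul_and_integral_eq_inner (hw t)).1, fun v hv => ?_⟩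
  rw [funext fun t => (integrable_mul_and_integral_eq_inner (f := v t) (hw t)).2]
  exact hv.inner (c₁.add c₂)

theorem IsGeneralizedSolution.unique (hT0 : 0 < T) (hp : MemLp (linePotential q) 2 volume)
    {F : ControlSpace T} {v v' : ℝ → LineSpace} (hv : IsGeneralizedSolution q T F v)
    (hv' : IsGeneralizedSolution q T F v') : ∀ t ∈ Icc 0 T, v t = v' t := by
  -- A solution is controlled only on [0, T]; constant extension makes it continuous on the line,
  -- and the weak identity sees only [0, T].
  have cont : ∀ {v : ℝ → LineSpace}, IsGeneralizedSolution q T F v →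
      Continuous (IccExtend hT0.le fun t : Icc (0 : ℝ) T => v t) := fun hv =>
    (continuousOn_iff_continuous_domRestrict.1 hv.continuousOn).Icc_extend'
  have ext : ∀ v : ℝ → LineSpace, ∀ t ∈ Icc 0 T,
      IccExtend hT0.le (fun t : Icc (0 : ℝ) T => v t) t = v t :=
    fun v t ht => IccExtend_of_mem _ _ ht
  have cv := cont hv
  have cv' := cont hv'
  set w := IccExtend hT0.le fun t : Icc (0 : ℝ) T => v t with hw
  set w' := IccExtend hT0.le fun t : Icc (0 : ℝ) T => v' t with hw'
  have h := eq_zero_of_homogeneous (v := fun t => w t - w' t) hT0 hp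
    (fun x hx => linePotential_of_notMem q hx) (cv.sub cv') fun φ hφ hs hφT => by
      obtain ⟨hi, hc⟩ := continuous_integral_mul_waveWithPotential hp
        (fun x hx => linePotential_of_notMem q hx) hφ hs
      have e : ∀ v : ℝ → LineSpace, IsGeneralizedSolution q T F v →
          (∫ t in (0 : ℝ)..T, ∫ x, IccExtend hT0.le (fun t : Icc (0 : ℝ) T => v t) t x
            * waveWithPotential (linePotential q) φ x t)
          = ∫ t in (0 : ℝ)..T,
            (F t 0 * deriv (fun y => φ y t) 0 + F t 1 * deriv (fun τ => φ 0 τ) t) := by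
        intro v hv
        rw [← hv.weak φ hφ hs hφT]
        apply intervalIntegral.integral_congr
        intro t ht
        rw [uIcc_of_le hT0.le] at ht
        simp only [ext v t ht]
        rfl
      have e1 : ∀ t, ∫ x, (w t - w' t : LineSpace) x * waveWithPotential (linePotential q) φ x t
          = (∫ x, w t x * waveWithPotential (linePotential q) φ x t)
            - ∫ x, w' t x * waveWithPotential (linePotential q) φ x t := by
        intro t
        rw [← integral_sub (hi t _) (hi t _)]
        refine integral_congr_ae ?_
        filter_upwards [Lp.coeFn_sub (w t) (w' t)] with x hx
        rw [hx, Pi.sub_apply, sub_mul]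
      simp only [e1]
      rw [intervalIntegral.integral_sub ((hc w cv).intervalIntegrable _ _)
        ((hc w' cv').intervalIntegrable _ _), e v hv, e v' hv', sub_self]
  intro t ht
  have := h t ht
  rwa [hw, hw', ext v t ht, ext v' t ht, sub_eq_zero] at this

end GeneralizedSolutionUniqueness

/-! ### Triangular integral operators on controls and their adjoints -/

section KernelOperators

/-- Real `2 × 2` matrices, as operators on the Euclidean plane. -/
abbrev PlaneEnd : Type := EuclideanSpace ℝ (Fin 2) →L[ℝ] EuclideanSpace ℝ (Fin 2)

theorem inner_kernelOperator {μ : Measure ℝ} [IsFiniteMeasure μ] {E : Type*}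
    [NormedAddCommGroup E] [InnerProductSpace ℝ E] [CompleteSpace E] {κ κ' : ℝ → ℝ → E →L[ℝ] E}
    (hκ : StronglyMeasurable (Function.uncurry κ)) {C : ℝ}
    (hC : ∀ x s, ‖κ x s‖ ≤ C) (hadj : ∀ x s u v, inner ℝ (κ x s u) v = inner ℝ u (κ' s x v))
    {A B : Lp E 2 μ →L[ℝ] Lp E 2 μ} (hA : ∀ F, A F =ᵐ[μ] fun x => ∫ s, κ x s (F s) ∂μ)
    (hκ' : StronglyMeasurable (Function.uncurry κ')) (hC' : ∀ x s, ‖κ' x s‖ ≤ C)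
    (hB : ∀ F, B F =ᵐ[μ] fun x => ∫ s, κ' x s (F s) ∂μ) (F G : Lp E 2 μ) :
    inner ℝ (A F) G = inner ℝ F (B G) := by
  have hi : ∀ F : Lp E 2 μ, Integrable F μ := fun F => (Lp.memLp F).integrable (by norm_num)
  have happ : ∀ {κ : ℝ → ℝ → E →L[ℝ] E}, StronglyMeasurable (Function.uncurry κ) →
      (∀ x s, ‖κ x s‖ ≤ C) → ∀ (F : Lp E 2 μ) x, Integrable (fun s => κ x s (F s)) μ := by
    intro κ hκ hC F x
    refine ((hi F).norm.const_mul C).mono' ?_ (Filter.Eventually.of_forall fun s => ?_)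
    · exact isBoundedBilinearMap_apply.continuous.comp_aestronglyMeasurable
        ((hκ.comp_measurable measurable_prodMk_left).aestronglyMeasurable.prodMk
          (Lp.aestronglyMeasurable F))
    · exact ((κ x s).le_opNorm _).trans (mul_le_mul_of_nonneg_right (hC x s) (norm_nonneg _))
  have hprod : Integrable (Function.uncurry fun x s => inner ℝ (κ x s (F s)) (G x)) (μ.prod μ) := by
    refine ((hi G).norm.mul_prod ((hi F).norm.const_mul C)).mono' ?_
      (Filter.Eventually.of_forall fun z => ?_)
    · have : AEStronglyMeasurable (fun z : ℝ × ℝ => κ z.1 z.2 (F z.2)) (μ.prod μ) :=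
        isBoundedBilinearMap_apply.continuous.comp_aestronglyMeasurable
          (hκ.aestronglyMeasurable.prodMk (Lp.aestronglyMeasurable F).comp_snd)
      exact this.inner (Lp.aestronglyMeasurable G).comp_fst
    · refine (norm_inner_le_norm _ _).trans ?_
      rw [mul_comm]
      exact mul_le_mul_of_nonneg_left (((κ z.1 z.2).le_opNorm _).trans
        (mul_le_mul_of_nonneg_right (hC z.1 z.2) (norm_nonneg _))) (norm_nonneg _)
  have e1 : inner ℝ (A F) G = ∫ x, ∫ s, inner ℝ (κ x s (F s)) (G x) ∂μ ∂μ := by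
    rw [L2.inner_def]
    refine integral_congr_ae ?_
    filter_upwards [hA F] with x hx
    rw [hx, real_inner_comm, ← integral_inner (happ hκ hC F x)]
    simp only [real_inner_comm]
  have e2 : inner ℝ F (B G) = ∫ s, ∫ x, inner ℝ (κ x s (F s)) (G x) ∂μ ∂μ := by
    rw [L2.inner_def]
    refine integral_congr_ae ?_
    filter_upwards [hB G] with s hs
    rw [hs, ← integral_inner (happ hκ' hC' G s)]
    simp only [hadj]
  rw [e1, e2, integral_integral_swap hprod]

theorem exists_triangularOperators {K L : ℝ → ℝ → PlaneEnd}
    (hK : Continuous (Function.uncurry K)) (hL : Continuous (Function.uncurry L))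
    (hadj : ∀ x s u v, inner ℝ (L x s u) v = inner ℝ u (K s x v)) (T : ℝ) :
    ∃ A B : ControlSpace T →L[ℝ] ControlSpace T,
      (∀ F, A F =ᵐ[volume.restrict (Ioo 0 T)] fun x => ∫ s in x..T, K x s (F s)) ∧
      (∀ F, B F =ᵐ[volume.restrict (Ioo 0 T)] fun x => ∫ s in (0 : ℝ)..x, L x s (F s)) ∧
      ∀ F G, inner ℝ (B F) G = inner ℝ F (A G) := by
  set μ : Measure ℝ := (volume : Measure ℝ).restrict (Ioo 0 T) with hμ
  have hbd : ∀ {K : ℝ → ℝ → PlaneEnd}, Continuous (Function.uncurry K) →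
      ∃ C, ∀ x ∈ Icc 0 T, ∀ s ∈ Icc 0 T, ‖K x s‖ ≤ C := by
    intro K hK
    obtain ⟨C, hC⟩ := ((isCompact_Icc (a := (0 : ℝ)) (b := T)).prod
      (isCompact_Icc (a := (0 : ℝ)) (b := T))).exists_bound_of_continuousOn hK.continuousOn
    exact ⟨C, fun x hx s hs => hC (x, s) ⟨hx, hs⟩⟩
  obtain ⟨C₁, hC₁⟩ := hbd hK
  obtain ⟨C₂, hC₂⟩ := hbd hL
  set C := max |C₁| |C₂| with hCdef
  have hC0 : 0 ≤ C := (abs_nonneg C₁).trans (le_max_left _ _)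
  -- The strict cut-offs of the two kernels are exchanged by (x, s) ↦ (s, x), so they remain
  -- pointwise adjoint.
  set κ : ℝ → ℝ → PlaneEnd := fun x s => if 0 < x ∧ x < s ∧ s < T then K x s else 0 with hκ
  set κ' : ℝ → ℝ → PlaneEnd := fun x s => if 0 < s ∧ s < x ∧ x < T then L x s else 0 with hκ'
  have mκ : StronglyMeasurable (Function.uncurry κ) := by
    refine StronglyMeasurable.ite ?_ hK.stronglyMeasurable stronglyMeasurable_const
    exact (measurableSet_lt measurable_const measurable_fst).inter
      ((measurableSet_lt measurable_fst measurable_snd).inter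
        (measurableSet_lt measurable_snd measurable_const))
  have mκ' : StronglyMeasurable (Function.uncurry κ') := by
    refine StronglyMeasurable.ite ?_ hL.stronglyMeasurable stronglyMeasurable_const
    exact (measurableSet_lt measurable_const measurable_snd).inter
      ((measurableSet_lt measurable_snd measurable_fst).inter
        (measurableSet_lt measurable_fst measurable_const))
  have bκ : ∀ x s, ‖κ x s‖ ≤ C := fun x s => by
    simp only [hκ]
    split_ifs with h
    · exact (hC₁ x ⟨h.1.le, by linarith⟩ s ⟨by linarith, h.2.2.le⟩).trans
        ((le_abs_self _).trans (le_max_left _ _))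
    · simpa using hC0
  have bκ' : ∀ x s, ‖κ' x s‖ ≤ C := fun x s => by
    simp only [hκ']
    split_ifs with h
    · exact (hC₂ x ⟨by linarith, h.2.2.le⟩ s ⟨h.1.le, by linarith⟩).trans
        ((le_abs_self _).trans (le_max_right _ _))
    · simpa using hC0
  obtain ⟨A, hA⟩ := exists_kernelOperator (μ := μ) (ν := μ) (κ := κ) mκ (a := fun _ => C)
    (b := fun _ => 1) (memLp_const C) (memLp_const 1) (fun _ => hC0) (fun _ => zero_le_one)
    (fun x s => by simpa using bκ x s)
  obtain ⟨B, hB⟩ := exists_kernelOperator (μ := μ) (ν := μ) (κ := κ') mκ' (a := fun _ => C)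
    (b := fun _ => 1) (memLp_const C) (memLp_const 1) (fun _ => hC0) (fun _ => zero_le_one)
    (fun x s => by simpa using bκ' x s)
  refine ⟨A, B, fun F => ?_, fun F => ?_, fun F G => ?_⟩
  · filter_upwards [hA F, ae_restrict_mem measurableSet_Ioo] with x h1 hx
    rw [h1, intervalIntegral.integral_of_le hx.2.le, integral_Ioc_eq_integral_Ioo]
    have e : (fun s => κ x s (F s)) = (Ioo x T).indicator fun s => K x s (F s) := by
      ext1 s
      by_cases h : s ∈ Ioo x T
      · rw [indicator_of_mem h]; simp only [hκ]; rw [if_pos ⟨hx.1, h.1, h.2⟩]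
      · rw [indicator_of_notMem h]; simp only [hκ]
        rw [if_neg fun h' => h (mem_Ioo.2 h'.2), zero_apply]
    rw [e, setIntegral_indicator measurableSet_Ioo]
    congr 2
    ext s; simp only [mem_inter_iff, mem_Ioo]
    exact ⟨fun h => h.2, fun h => ⟨⟨hx.1.trans h.1, h.2⟩, h⟩⟩
  · filter_upwards [hB F, ae_restrict_mem measurableSet_Ioo] with x h1 hx
    rw [h1, intervalIntegral.integral_of_le hx.1.le, integral_Ioc_eq_integral_Ioo]
    have e : (fun s => κ' x s (F s)) = (Ioo 0 x).indicator fun s => L x s (F s) := by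
      ext1 s
      by_cases h : s ∈ Ioo 0 x
      · rw [indicator_of_mem h]; simp only [hκ']; rw [if_pos ⟨h.1, h.2, hx.2⟩]
      · rw [indicator_of_notMem h]; simp only [hκ']
        rw [if_neg fun h' => h (mem_Ioo.2 ⟨h'.1, h'.2.1⟩), zero_apply]
    rw [e, setIntegral_indicator measurableSet_Ioo]
    congr 2
    ext s; simp only [mem_inter_iff, mem_Ioo]
    exact ⟨fun h => h.2, fun h => ⟨⟨h.1, h.2.trans hx.2⟩, h⟩⟩
  · refine inner_kernelOperator mκ' bκ' (fun x s u v => ?_) hB mκ bκ hA F G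
    simp only [hκ, hκ']
    split_ifs with h
    · exact hadj x s u v
    · simp

/-- The ring-valued identity is transferred to vectors: y is embedded as the rank-one operator Λ y :
z ↦ z₀ y, for which A Λ(y) = Λ(Ay), and evaluation at the first basis vector recovers y. -/
theorem integral_factoredKernel_apply {K L : ℝ → ℝ → PlaneEnd}
    (hK : Continuous (Function.uncurry K)) (hL : Continuous (Function.uncurry L))
    {f : ℝ → EuclideanSpace ℝ (Fin 2)} {s x : ℝ} (hx : x ∈ Ioo 0 s)
    (hf : IntervalIntegrable f volume 0 s) :
    ∫ α in (0 : ℝ)..s, factoredKernel K L x α (f α)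
      = (∫ α in x..s, K x α (f α)) + (∫ α in (0 : ℝ)..x, L x α (f α))
        + ∫ β in (0 : ℝ)..x, L x β (∫ α in β..s, K β α (f α)) := by
  let Λ : EuclideanSpace ℝ (Fin 2) →L[ℝ] PlaneEnd :=
    ContinuousLinearMap.smulRightL ℝ (EuclideanSpace ℝ (Fin 2)) (EuclideanSpace ℝ (Fin 2))
      (EuclideanSpace.proj 0)
  let ev : PlaneEnd →L[ℝ] EuclideanSpace ℝ (Fin 2) :=
    ContinuousLinearMap.apply ℝ _ (EuclideanSpace.single 0 1)
  have hev : ∀ y, ev (Λ y) = y := fun y => by simp [ev, Λ]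
  have hmul : ∀ (A : PlaneEnd) y, A * Λ y = Λ (A y) := fun A y => by
    ext1 z; simp [Λ]
  have hint : ∀ (g : ℝ → EuclideanSpace ℝ (Fin 2)) a b, ∫ t in a..b, Λ (g t) = Λ (∫ t in a..b, g t) := by
    intro g a b
    by_cases hg : IntervalIntegrable g volume a b
    · exact Λ.intervalIntegral_comp_comm hg
    · rw [intervalIntegral.integral_undef hg, map_zero, intervalIntegral.integral_undef]
      intro h
      apply hg
      have := ev.integrable_comp h.1
      have := ev.integrable_comp h.2
      simp only [hev] at *
      exact ⟨‹_›, ‹_›⟩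
  have hd : IntervalIntegrable (fun α => Λ (f α)) volume 0 s :=
    ⟨Λ.integrable_comp hf.1, Λ.integrable_comp hf.2⟩
  have key := congrArg ev (integral_factoredKernel_mul hK hL hx hd)
  simpa only [hmul, hint, ← map_add, hev] using key

/-- The two triangular branches match on the diagonal by `hdiag`. That is known only for nonnegative
arguments, hence the positive parts in the proof. -/
theorem continuousOn_factoredKernel {R : Type*} [NormedRing R] [NormedAlgebra ℝ R]
    [CompleteSpace R] {K L : ℝ → ℝ → R}
    (hK : Continuous (Function.uncurry K)) (hL : Continuous (Function.uncurry L))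
    (hdiag : ∀ x, 0 ≤ x → K x x = L x x) :
    ContinuousOn (Function.uncurry (factoredKernel K L)) (Ici 0 ×ˢ Ici 0) := by
  have c1 : Continuous fun z : ℝ × ℝ => if z.1 ≤ z.2 then K (max z.1 0) (max z.2 0)
      else L (max z.1 0) (max z.2 0) := by
    refine Continuous.if_le (continuous_comp_uncurry hK (by fun_prop) (by fun_prop))
      (continuous_comp_uncurry hL (by fun_prop) (by fun_prop)) continuous_fst continuous_snd ?_
    intro z hz
    rw [hz, hdiag _ (le_max_right _ _)]
  have c2 : Continuous fun z : ℝ × ℝ => ∫ β in (0 : ℝ)..min z.1 z.2, L z.1 β * K β z.2 := by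
    refine intervalIntegral.continuous_parametric_intervalIntegral_of_continuous
      (f := fun (z : ℝ × ℝ) β => L z.1 β * K β z.2) ?_ (by fun_prop)
    exact (continuous_comp_uncurry hL (Z := (ℝ × ℝ) × ℝ) (by fun_prop) (by fun_prop)).mul
      (continuous_comp_uncurry hK (by fun_prop) (by fun_prop))
  refine (c1.add c2).continuousOn.congr fun z hz => ?_
  have h1 : max z.1 0 = z.1 := max_eq_left hz.1
  have h2 : max z.2 0 = z.2 := max_eq_left hz.2
  change factoredKernel K L z.1 z.2 = (if z.1 ≤ z.2 then K (max z.1 0) (max z.2 0)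
    else L (max z.1 0) (max z.2 0)) + _
  rw [h1, h2]
  rfl

end KernelOperators

/-! ### The factorization of the reflected connecting operator -/

section ConnectingKernel

variable {T : ℝ}

theorem toEuclideanCLM_apply (M : Matrix (Fin 2) (Fin 2) ℝ) (v : EuclideanSpace ℝ (Fin 2))
    (i : Fin 2) : Matrix.toEuclideanCLM (n := Fin 2) (𝕜 := ℝ) M v i = ∑ j, M i j * v j := by
  rw [Matrix.ofLp_toEuclideanCLM]
  rfl

theorem toEuclideanCLM_symm_apply (A : PlaneEnd) (v : EuclideanSpace ℝ (Fin 2)) (i : Fin 2) :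
    ∑ j, (Matrix.toEuclideanCLM (n := Fin 2) (𝕜 := ℝ)).symm A i j * v j = A v i := by
  rw [← toEuclideanCLM_apply, StarAlgEquiv.apply_symm_apply]

theorem inner_toEuclideanCLM_transpose (M : Matrix (Fin 2) (Fin 2) ℝ)
    (u v : EuclideanSpace ℝ (Fin 2)) :
    inner ℝ (Matrix.toEuclideanCLM (n := Fin 2) (𝕜 := ℝ) M.transpose u) v
      = inner ℝ u (Matrix.toEuclideanCLM (n := Fin 2) (𝕜 := ℝ) M v) := by
  simp only [PiLp.inner_apply, toEuclideanCLM_apply, Fin.sum_univ_two, Matrix.transpose_apply,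
    RCLike.inner_apply, conj_trivial]
  ring

theorem continuous_toEuclideanCLM : Continuous (Matrix.toEuclideanCLM (n := Fin 2) (𝕜 := ℝ)) :=
  LinearMap.continuous_of_finiteDimensional
    (Matrix.toEuclideanCLM (n := Fin 2) (𝕜 := ℝ)).toAlgEquiv.toLinearMap

theorem continuous_toEuclideanCLM_symm :
    Continuous (Matrix.toEuclideanCLM (n := Fin 2) (𝕜 := ℝ)).symm :=
  LinearMap.continuous_of_finiteDimensional
    (Matrix.toEuclideanCLM (n := Fin 2) (𝕜 := ℝ)).symm.toAlgEquiv.toLinearMap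

/-- The matrix kernel of the reversed control operator, in terms of the jump and the mean of the
solution at the points `±x`. -/
def jumpMatrix (u₀ u₁ : ℝ → ℝ → ℝ) (x s : ℝ) : Matrix (Fin 2) (Fin 2) ℝ :=
  !![u₀ ((s + x) / 2) ((s - x) / 2) - u₀ ((s - x) / 2) ((s + x) / 2),
      u₁ ((s + x) / 2) ((s - x) / 2) - u₁ ((s - x) / 2) ((s + x) / 2);
    -(u₀ ((s + x) / 2) ((s - x) / 2) + u₀ ((s - x) / 2) ((s + x) / 2)),
      -(u₁ ((s + x) / 2) ((s - x) / 2) + u₁ ((s - x) / 2) ((s + x) / 2))]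

/-- `jumpMatrix` as an operator kernel. -/
def jumpKernel (u₀ u₁ : ℝ → ℝ → ℝ) (x s : ℝ) : PlaneEnd :=
  Matrix.toEuclideanCLM (n := Fin 2) (𝕜 := ℝ) (jumpMatrix u₀ u₁ x s)

/-- The adjoint kernel of `jumpKernel`. -/
def jumpKernelAdj (u₀ u₁ : ℝ → ℝ → ℝ) (x s : ℝ) : PlaneEnd :=
  Matrix.toEuclideanCLM (n := Fin 2) (𝕜 := ℝ) (jumpMatrix u₀ u₁ s x).transpose

variable {u₀ u₁ : ℝ → ℝ → ℝ}

theorem continuous_jumpMatrix (h₀ : Continuous (Function.uncurry u₀))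
    (h₁ : Continuous (Function.uncurry u₁)) :
    Continuous (Function.uncurry (jumpMatrix u₀ u₁)) := by
  have c : ∀ {u : ℝ → ℝ → ℝ}, Continuous (Function.uncurry u) →
      Continuous (fun z : ℝ × ℝ => u ((z.2 + z.1) / 2) ((z.2 - z.1) / 2)) ∧
      Continuous fun z : ℝ × ℝ => u ((z.2 - z.1) / 2) ((z.2 + z.1) / 2) := fun hu =>
    ⟨continuous_comp_uncurry hu (by fun_prop) (by fun_prop),
      continuous_comp_uncurry hu (by fun_prop) (by fun_prop)⟩
  refine continuous_matrix fun i j => ?_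
  fin_cases i <;> fin_cases j
  · exact (c h₀).1.sub (c h₀).2
  · exact (c h₁).1.sub (c h₁).2
  · exact ((c h₀).1.add (c h₀).2).neg
  · exact ((c h₁).1.add (c h₁).2).neg

theorem continuous_jumpKernel (h₀ : Continuous (Function.uncurry u₀))
    (h₁ : Continuous (Function.uncurry u₁)) :
    Continuous (Function.uncurry (jumpKernel u₀ u₁)) :=
  continuous_toEuclideanCLM.comp (continuous_jumpMatrix h₀ h₁)

theorem continuous_jumpKernelAdj (h₀ : Continuous (Function.uncurry u₀))
    (h₁ : Continuous (Function.uncurry u₁)) :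
    Continuous (Function.uncurry (jumpKernelAdj u₀ u₁)) :=
  continuous_toEuclideanCLM.comp
    (((continuous_jumpMatrix h₀ h₁).comp continuous_swap).matrix_transpose)

theorem intervalIntegrable_apply {A : ℝ → PlaneEnd} {f : ℝ → EuclideanSpace ℝ (Fin 2)} {a b : ℝ}
    (hA : ContinuousOn A (uIcc a b)) (hf : IntervalIntegrable f volume a b) :
    IntervalIntegrable (fun t => A t (f t)) volume a b := by
  obtain ⟨C, hC⟩ := isCompact_uIcc.exists_bound_of_continuousOn hA
  rw [intervalIntegrable_iff] at hf ⊢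
  refine (hf.norm.const_mul C).mono' ?_ ?_
  · exact isBoundedBilinearMap_apply.continuous.comp_aestronglyMeasurable
      (((hA.mono uIoc_subset_uIcc).aestronglyMeasurable measurableSet_uIoc).prodMk hf.1)
  · filter_upwards [ae_restrict_mem measurableSet_uIoc] with t ht
    exact ((A t).le_opNorm _).trans
      (mul_le_mul_of_nonneg_right (hC t (uIoc_subset_uIcc ht)) (norm_nonneg _))

theorem intervalIntegrable_control (F : ControlSpace T) {a b : ℝ} (ha : 0 ≤ a) (hab : a ≤ b)
    (hb : b ≤ T) : IntervalIntegrable F volume a b := by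
  rw [intervalIntegrable_iff_integrableOn_Ioo_of_le hab]
  have h : IntegrableOn F (Ioo 0 T) := (Lp.memLp F).integrable (by norm_num)
  exact h.mono_set (Ioo_subset_Ioo ha hb)

theorem timeReversal_timeReversal (F : ControlSpace T) : timeReversal T (timeReversal T F) = F := by
  refine Lp.ext ?_
  filter_upwards [timeReversal_apply T (timeReversal T F),
    (measurePreserving_reflect T).quasiMeasurePreserving.ae (timeReversal_apply T F)] with t h1 h2
  rw [h1, h2, sub_sub_cancel]

theorem inner_timeReversal (F G : ControlSpace T) :
    inner ℝ (timeReversal T F) G = inner ℝ F (timeReversal T G) := by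
  have h : ∀ F G : ControlSpace T, inner ℝ (timeReversal T F) (timeReversal T G) = inner ℝ F G :=
    fun F G => (Lp.compMeasurePreservingₗᵢ ℝ (fun t : ℝ => T - t)
      (measurePreserving_reflect T)).inner_map_map F G
  rw [← h, timeReversal_timeReversal]

/-- The integral equation satisfied by the reflected connecting operator. -/
theorem timeReversal_comp_eq {H : Type*} [NormedAddCommGroup H] [InnerProductSpace ℝ H]
    {W : ControlSpace T →L[ℝ] H} {A C K B : ControlSpace T →L[ℝ] ControlSpace T}
    (hA : ∀ F G, inner ℝ (A F) G = inner ℝ (W F) (W G))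
    (hC : A = (1 / 2 : ℝ) • (ContinuousLinearMap.id ℝ (ControlSpace T) + C))
    (hW : ∀ F G, inner ℝ (W (timeReversal T F)) (W (timeReversal T G))
      = 1 / 2 * inner ℝ (F + K F) (G + K G))
    (hB : ∀ F G, inner ℝ (B F) G = inner ℝ F (K G)) (F : ControlSpace T) :
    (timeReversal T ∘L C ∘L timeReversal T) F = K F + B F + B (K F) := by
  refine ext_inner_right ℝ fun G => ?_
  have h1 := hA (timeReversal T F) (timeReversal T G)
  have h2 : A (timeReversal T F)
      = (1 / 2 : ℝ) • (timeReversal T F + C (timeReversal T F)) := by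
    rw [hC]; rfl
  rw [hW, h2, real_inner_smul_left, inner_add_left, inner_timeReversal,
    timeReversal_timeReversal] at h1
  simp only [inner_add_left, inner_add_right, hB] at h1 ⊢
  change inner ℝ (timeReversal T (C (timeReversal T F))) G = _
  rw [inner_timeReversal]
  linarith

/-- The kernel of A + B + BA comes from the Fubini computation on the full interval (0, T), read one
coordinate at a time. -/
theorem hasKernel_of_factored {K L : ℝ → ℝ → PlaneEnd} (hK : Continuous (Function.uncurry K))
    (hL : Continuous (Function.uncurry L)) (hdiag : ∀ x, 0 ≤ x → K x x = L x x)
    {A B D : ControlSpace T →L[ℝ] ControlSpace T}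
    (hA : ∀ F, A F =ᵐ[volume.restrict (Ioo 0 T)] fun x => ∫ s in x..T, K x s (F s))
    (hB : ∀ F, B F =ᵐ[volume.restrict (Ioo 0 T)] fun x => ∫ s in (0 : ℝ)..x, L x s (F s))
    (hD : ∀ F, D F = A F + B F + B (A F)) :
    HasKernel T D fun t s =>
      (Matrix.toEuclideanCLM (n := Fin 2) (𝕜 := ℝ)).symm (factoredKernel K L t s) := by
  intro F
  rw [hD]
  have hA' : ∀ᵐ x, x ∈ Ioo 0 T → A F x = ∫ s in x..T, K x s (F s) :=
    (ae_restrict_iff' measurableSet_Ioo).1 (hA F)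
  filter_upwards [Lp.coeFn_add (A F + B F) (B (A F)), Lp.coeFn_add (A F) (B F), hA F, hB F,
    hB (A F), ae_restrict_mem measurableSet_Ioo] with t e1 e2 e3 e4 e5 ht i
  have hT : 0 ≤ T := ht.1.le.trans ht.2.le
  have e6 : ∫ s in (0 : ℝ)..t, L t s (A F s)
      = ∫ β in (0 : ℝ)..t, L t β (∫ α in β..T, K β α (F α)) := by
    refine intervalIntegral.integral_congr_ae ?_
    filter_upwards [hA'] with s hs hst
    rw [uIoc_of_le ht.1.le] at hst
    rw [hs ⟨hst.1, hst.2.trans_lt ht.2⟩]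
  have hc : ContinuousOn (fun s => factoredKernel K L t s) (uIcc 0 T) := by
    rw [uIcc_of_le hT]
    exact (continuousOn_factoredKernel hK hL hdiag).comp
      (f := fun s => (t, s)) (by fun_prop) fun s hs => ⟨ht.1.le, hs.1⟩
  simp only [toEuclideanCLM_symm_apply]
  have key := (EuclideanSpace.proj (𝕜 := ℝ) i).intervalIntegral_comp_comm
    (intervalIntegrable_apply hc (intervalIntegrable_control F le_rfl hT le_rfl))
  rw [integral_factoredKernel_apply hK hL ht (intervalIntegrable_control F le_rfl hT le_rfl), ← e6,
    ← e3, ← e4, ← e5] at key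
  rw [e1, Pi.add_apply, e2, Pi.add_apply]
  exact key.symm

end ConnectingKernel

/-! ### The state at time T as a triangular transform of the control -/

section StateInner

variable {T : ℝ} {u₀ u₁ : ℝ → ℝ → ℝ}

theorem integral_coneKernel_mul_controlCoord {u : ℝ → ℝ → ℝ} (F : ControlSpace T) (j : Fin 2) {x : ℝ}
    (hx : |x| < T) : ∫ s, coneKernel u T x s * controlCoord F j s
      = ∫ s in |x|..T, u ((s + x) / 2) ((s - x) / 2) * F s j := by
  rw [intervalIntegral.integral_of_le hx.le, integral_Ioc_eq_integral_Ioo,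
    ← integral_indicator measurableSet_Ioo]
  congr 1
  ext s
  by_cases h : s ∈ Ioo |x| T
  · rw [indicator_of_mem h, coneKernel, if_pos (mem_Ioo.1 h),
      controlCoord_of_mem F j (mem_Ioo.2 ⟨(abs_nonneg x).trans_lt h.1, h.2⟩)]
  · rw [indicator_of_notMem h, coneKernel, if_neg fun h' => h (mem_Ioo.2 h'), zero_mul]

theorem intervalIntegrable_mul_control {w : ℝ → ℝ} (hw : Continuous w) (F : ControlSpace T)
    (j : Fin 2) {x : ℝ} (hx : x ∈ Ioo 0 T) :
    IntervalIntegrable (fun s => w s * F s j) volume x T := by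
  have hF := intervalIntegrable_control F hx.1.le hx.2.le le_rfl
  have hj : IntervalIntegrable (fun s => F s j) volume x T :=
    ⟨(EuclideanSpace.proj (𝕜 := ℝ) j).integrable_comp hF.1,
      (EuclideanSpace.proj (𝕜 := ℝ) j).integrable_comp hF.2⟩
  exact hj.continuousOn_mul hw.continuousOn

theorem integral_jumpKernel_apply (h₀ : Continuous (Function.uncurry u₀))
    (h₁ : Continuous (Function.uncurry u₁)) (F : ControlSpace T) {x : ℝ} (hx : x ∈ Ioo 0 T)
    (i : Fin 2) : (∫ s in x..T, jumpKernel u₀ u₁ x s (F s)) i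
      = (∫ s in x..T, jumpMatrix u₀ u₁ x s i 0 * F s 0)
        + ∫ s in x..T, jumpMatrix u₀ u₁ x s i 1 * F s 1 := by
  have hc : Continuous fun s => jumpKernel u₀ u₁ x s :=
    continuous_comp_uncurry (continuous_jumpKernel h₀ h₁) continuous_const continuous_id
  have hm : ∀ j, Continuous fun s => jumpMatrix u₀ u₁ x s i j := fun j =>
    (continuous_comp_uncurry (continuous_jumpMatrix h₀ h₁) continuous_const
      continuous_id).matrix_elem i j
  have hi : IntervalIntegrable (fun s => jumpKernel u₀ u₁ x s (F s)) volume x T :=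
    intervalIntegrable_apply hc.continuousOn (intervalIntegrable_control F hx.1.le hx.2.le le_rfl)
  have key := (EuclideanSpace.proj (𝕜 := ℝ) i).intervalIntegral_comp_comm hi
  rw [← intervalIntegral.integral_add (intervalIntegrable_mul_control (hm 0) F 0 hx)
    (intervalIntegrable_mul_control (hm 1) F 1 hx)]
  refine key.symm.trans ?_
  congr 1
  ext s
  change jumpKernel u₀ u₁ x s (F s) i = _
  rw [jumpKernel, toEuclideanCLM_apply, Fin.sum_univ_two]

/-- The state at time `T`, for a reversed control. -/
def reversedState (u₀ u₁ : ℝ → ℝ → ℝ) (F : ControlSpace T) (x : ℝ) : ℝ :=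
  (sideCoeff (1 / 2) (-1 / 2) x * controlCoord F 0 |x|
      + ∫ s, coneKernel u₀ T x s * controlCoord F 0 s)
    + (sideCoeff (-1 / 2) (-1 / 2) x * controlCoord F 1 |x|
      + ∫ s, coneKernel u₁ T x s * controlCoord F 1 s)

/-- Passing from x to -x exchanges the two characteristic arguments of the tail. The coefficients
±1/2 on the rays make the difference keep only F₀(x) and the negative sum keep only F₁(x). -/
theorem reversedState_jump (h₀ : Continuous (Function.uncurry u₀))
    (h₁ : Continuous (Function.uncurry u₁)) (F : ControlSpace T) {x : ℝ} (hx : x ∈ Ioo 0 T) :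
    reversedState u₀ u₁ F x - reversedState u₀ u₁ F (-x)
        = F x 0 + (∫ s in x..T, jumpKernel u₀ u₁ x s (F s)) 0 ∧
      -(reversedState u₀ u₁ F x + reversedState u₀ u₁ F (-x))
        = F x 1 + (∫ s in x..T, jumpKernel u₀ u₁ x s (F s)) 1 := by
  have a1 : |x| = x := abs_of_pos hx.1
  have a2 : |-x| = x := by rw [abs_neg, a1]
  have c : ∀ {u : ℝ → ℝ → ℝ}, Continuous (Function.uncurry u) → ∀ j,
      IntervalIntegrable (fun s => u ((s + x) / 2) ((s - x) / 2) * F s j) volume x T ∧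
      IntervalIntegrable (fun s => u ((s - x) / 2) ((s + x) / 2) * F s j) volume x T :=
    fun hu j => ⟨intervalIntegrable_mul_control
        (continuous_comp_uncurry hu (by fun_prop) (by fun_prop)) F j hx,
      intervalIntegrable_mul_control
        (continuous_comp_uncurry hu (by fun_prop) (by fun_prop)) F j hx⟩
  have e : ∀ (u : ℝ → ℝ → ℝ) j, (∫ s, coneKernel u T x s * controlCoord F j s
        = ∫ s in x..T, u ((s + x) / 2) ((s - x) / 2) * F s j) ∧
      ∫ s, coneKernel u T (-x) s * controlCoord F j s
        = ∫ s in x..T, u ((s - x) / 2) ((s + x) / 2) * F s j := by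
    intro u j
    constructor
    · rw [integral_coneKernel_mul_controlCoord F j (by rw [a1]; exact hx.2), a1]
    · rw [integral_coneKernel_mul_controlCoord F j (by rw [a2]; exact hx.2), a2]
      simp only [sub_neg_eq_add, ← sub_eq_add_neg]
  rw [integral_jumpKernel_apply h₀ h₁ F hx, integral_jumpKernel_apply h₀ h₁ F hx]
  simp only [reversedState, sideCoeff, a1, a2, controlCoord_of_mem F _ hx, (e _ _).1, (e _ _).2,
    if_pos hx.1, if_neg (not_lt.2 (neg_nonpos.2 hx.1.le))]
  simp only [jumpMatrix, Matrix.of_apply, Matrix.cons_val', Matrix.cons_val_zero,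
    Matrix.cons_val_one, Matrix.cons_val_fin_one, sub_mul, add_mul, neg_mul,
    intervalIntegral.integral_neg]
  rw [intervalIntegral.integral_sub (c h₀ 0).1 (c h₀ 0).2,
    intervalIntegral.integral_sub (c h₁ 1).1 (c h₁ 1).2,
    intervalIntegral.integral_add (c h₀ 0).1 (c h₀ 0).2,
    intervalIntegral.integral_add (c h₁ 1).1 (c h₁ 1).2]
  constructor <;> ring

/-- Fold the integral over (-T, T) onto (0, T) and use ab + a'b' = 1/2 ((a - a')(b - b') + (a +
a')(b + b')) for the values at x and -x. -/
theorem inner_reversedState (hT : 0 < T) (h₀ : Continuous (Function.uncurry u₀))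
    (h₁ : Continuous (Function.uncurry u₁)) {W : ControlSpace T →L[ℝ] StateSpace T}
    (hW : ∀ F, W (timeReversal T F) =ᵐ[volume.restrict (Ioo (-T) T)] reversedState u₀ u₁ F)
    {A : ControlSpace T →L[ℝ] ControlSpace T}
    (hA : ∀ F, A F =ᵐ[volume.restrict (Ioo 0 T)] fun x => ∫ s in x..T, jumpKernel u₀ u₁ x s (F s))
    (F G : ControlSpace T) :
    inner ℝ (W (timeReversal T F)) (W (timeReversal T G))
      = 1 / 2 * inner ℝ (F + A F) (G + A G) := by
  set f := reversedState u₀ u₁ F with hf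
  set g := reversedState u₀ u₁ G with hg
  have e : (fun x => inner ℝ (W (timeReversal T F) x) (W (timeReversal T G) x))
      =ᵐ[volume.restrict (Ioo (-T) T)] fun x => f x * g x := by
    filter_upwards [hW F, hW G] with x h1 h2
    rw [h1, h2]
    simp [mul_comm, hf, hg]
  have hi : IntervalIntegrable (fun x => f x * g x) volume (-T) T := by
    rw [intervalIntegrable_iff_integrableOn_Ioo_of_le (by linarith)]
    exact (L2.integrable_inner _ _).congr e
  have hi1 : IntervalIntegrable (fun x => f x * g x) volume (-T) 0 :=
    hi.mono_set (by rw [uIcc_of_le (by linarith), uIcc_of_le (by linarith)]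
                    exact Icc_subset_Icc le_rfl hT.le)
  have hi2 : IntervalIntegrable (fun x => f x * g x) volume 0 T :=
    hi.mono_set (by rw [uIcc_of_le (by linarith), uIcc_of_le (by linarith)]
                    exact Icc_subset_Icc (by linarith) le_rfl)
  have hi1' : IntervalIntegrable (fun x => f (-x) * g (-x)) volume 0 T := by
    have := (IntervalIntegrable.iff_comp_neg (f := fun x => f x * g x)).1 hi1
    simpa using this.symm
  have e1 : inner ℝ (W (timeReversal T F)) (W (timeReversal T G))
      = ∫ x in (0 : ℝ)..T, (f (-x) * g (-x) + f x * g x) := by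
    rw [L2.inner_def, integral_congr_ae e, ← integral_Ioc_eq_integral_Ioo,
      ← intervalIntegral.integral_of_le (by linarith),
      ← intervalIntegral.integral_add_adjacent_intervals hi1 hi2,
      intervalIntegral.integral_add hi1' hi2,
      intervalIntegral.integral_comp_neg (fun x => f x * g x), neg_zero]
  rw [e1, L2.inner_def, intervalIntegral.integral_of_le hT.le, integral_Ioc_eq_integral_Ioo,
    ← integral_const_mul]
  refine integral_congr_ae ?_
  filter_upwards [Lp.coeFn_add F (A F), Lp.coeFn_add G (A G), hA F, hA G,
    ae_restrict_mem measurableSet_Ioo] with x a1 a2 a3 a4 hx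
  obtain ⟨j1, j2⟩ := reversedState_jump h₀ h₁ F hx
  obtain ⟨j3, j4⟩ := reversedState_jump h₀ h₁ G hx
  rw [a1, a2, Pi.add_apply, Pi.add_apply, a3, a4, PiLp.inner_apply, Fin.sum_univ_two]
  simp only [PiLp.add_apply, RCLike.inner_apply, conj_trivial]
  rw [← j1, ← j2, ← j3, ← j4]
  simp only [← hf, ← hg]
  ring

end StateInner

/-! ### A continuous kernel is determined by its operator -/

section KernelUniqueness

variable {T : ℝ}

/-- Apply D to the control given by row i of the difference e = k - k' at t₀. The two
representations agree for almost every t, hence by continuity at t₀, where the difference of the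
integrals is ∫ Σ e_j(t₀, s)² ds. -/
theorem HasKernel.eqOn (hT : 0 < T) {D : ControlSpace T →L[ℝ] ControlSpace T}
    {k k' : ℝ → ℝ → Matrix (Fin 2) (Fin 2) ℝ}
    (hk : ContinuousOn (Function.uncurry k) (Icc 0 T ×ˢ Icc 0 T))
    (hk' : ContinuousOn (Function.uncurry k') (Icc 0 T ×ˢ Icc 0 T))
    (h : HasKernel T D k) (h' : HasKernel T D k') :
    ∀ t ∈ Ioo 0 T, ∀ s ∈ Ioo 0 T, k t s = k' t s := by
  set c : ℝ → ℝ := fun t => (projIcc 0 T hT.le t : ℝ) with hc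
  have cc : Continuous c := continuous_subtype_val.comp continuous_projIcc
  have hcm : ∀ t, c t ∈ Icc 0 T := fun t => (projIcc 0 T hT.le t).2
  have hce : ∀ t ∈ Icc 0 T, c t = t := fun t ht => by
    simp only [hc]; rw [projIcc_of_mem hT.le ht]
  have ext : ∀ {k : ℝ → ℝ → Matrix (Fin 2) (Fin 2) ℝ},
      ContinuousOn (Function.uncurry k) (Icc 0 T ×ˢ Icc 0 T) →
      Continuous fun z : ℝ × ℝ => k (c z.1) (c z.2) := fun hk =>
    hk.comp_continuous (f := fun z : ℝ × ℝ => (c z.1, c z.2)) (by fun_prop)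
      fun z => ⟨hcm _, hcm _⟩
  have ck := ext hk
  have ck' := ext hk'
  intro t₀ ht₀ s₀ hs₀
  ext i j₀
  set e : Fin 2 → ℝ × ℝ → ℝ := fun j z => k (c z.1) (c z.2) i j - k' (c z.1) (c z.2) i j with he
  have ce : ∀ j, Continuous (e j) := fun j => (ck.matrix_elem i j).sub (ck'.matrix_elem i j)
  set r : ℝ → EuclideanSpace ℝ (Fin 2) := fun s => WithLp.toLp 2 fun j => e j (t₀, s) with hr
  have cr : Continuous r := by
    refine (PiLp.continuous_toLp 2 _).comp (continuous_pi fun j => ?_)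
    exact (ce j).comp (by fun_prop)
  have hrm : MemLp r 2 (volume.restrict (Ioo 0 T)) := by
    obtain ⟨M, hM⟩ := (isCompact_Icc (a := (0 : ℝ)) (b := T)).exists_bound_of_continuousOn
      cr.continuousOn
    refine MemLp.of_bound cr.aestronglyMeasurable M ?_
    filter_upwards [ae_restrict_mem measurableSet_Ioo] with s hs
    exact hM s (Ioo_subset_Icc_self hs)
  have hrF := hrm.coeFn_toLp
  set F : ControlSpace T := hrm.toLp r with hF
  have hFI : ∀ᵐ s, s ∈ Ioo 0 T → F s = r s := (ae_restrict_iff' measurableSet_Ioo).1 hrF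
  have hFT : ∀ᵐ s, s ∈ uIoc 0 T → F s = r s := by
    filter_upwards [hFI, (Set.countable_singleton T).ae_notMem volume] with s hs hsT hsu
    rw [uIoc_of_le hT.le] at hsu
    exact hs ⟨hsu.1, lt_of_le_of_ne hsu.2 hsT⟩
  have hrep : ∀ (k : ℝ → ℝ → Matrix (Fin 2) (Fin 2) ℝ), ∀ t ∈ Icc 0 T,
      ∫ s in (0 : ℝ)..T, ∑ j, k t s i j * F s j
        = ∫ s in (0 : ℝ)..T, ∑ j, k (c t) (c s) i j * e j (t₀, s) := by
    intro k t ht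
    refine intervalIntegral.integral_congr_ae ?_
    filter_upwards [hFT] with s hs hsu
    rw [hs hsu]
    rw [uIoc_of_le hT.le] at hsu
    rw [hce t ht, hce s (Ioc_subset_Icc_self hsu)]
  set φ : ℝ → ℝ := fun t => ∫ s in (0 : ℝ)..T, ∑ j, e j (t, s) * e j (t₀, s) with hφ
  have cφ : Continuous φ := by
    refine intervalIntegral.continuous_parametric_intervalIntegral_of_continuous'
      (f := fun t s => ∑ j, e j (t, s) * e j (t₀, s)) ?_ _ _
    change Continuous fun z : ℝ × ℝ => ∑ j, e j (z.1, z.2) * e j (t₀, z.2)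
    exact continuous_finsetSum _ fun j _ => ((ce j).comp (by fun_prop)).mul
      ((ce j).comp (g := e j) (f := fun z : ℝ × ℝ => (t₀, z.2)) (by fun_prop))
  have hcont : ∀ {k : ℝ → ℝ → Matrix (Fin 2) (Fin 2) ℝ},
      (Continuous fun z : ℝ × ℝ => k (c z.1) (c z.2)) → ∀ t,
      IntervalIntegrable (fun s => ∑ j, k (c t) (c s) i j * e j (t₀, s)) volume 0 T := by
    intro k hk t
    refine Continuous.intervalIntegrable (continuous_finsetSum _ fun j _ => Continuous.mul ?_ ?_) _ _
    · exact (hk.matrix_elem i j).comp (f := fun s => (t, s)) (by fun_prop)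
    · exact (ce j).comp (f := fun s => (t₀, s)) (by fun_prop)
  have hae : φ =ᵐ[volume.restrict (Ioo 0 T)] fun _ => (0 : ℝ) := by
    filter_upwards [h F, h' F, ae_restrict_mem measurableSet_Ioo] with t h1 h2 ht
    have h3 := (h1 i).symm.trans (h2 i)
    rw [hrep k t (Ioo_subset_Icc_self ht), hrep k' t (Ioo_subset_Icc_self ht), ← sub_eq_zero,
      ← intervalIntegral.integral_sub (hcont ck t) (hcont ck' t)] at h3
    rw [← h3]
    simp only [hφ, he, ← Finset.sum_sub_distrib, sub_mul]
  have hφ0 : φ t₀ = 0 := Measure.eqOn_open_of_ae_eq hae isOpen_Ioo cφ.continuousOn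
    continuousOn_const ht₀
  by_contra hne
  have hpos : 0 < φ t₀ := by
    refine intervalIntegral.integral_pos hT (Continuous.continuousOn ?_)
      (fun s _ => Finset.sum_nonneg fun j _ => mul_self_nonneg _)
      ⟨s₀, Ioo_subset_Icc_self hs₀, Finset.sum_pos' (fun j _ => mul_self_nonneg _)
        ⟨j₀, Finset.mem_univ _, mul_self_pos.2 ?_⟩⟩
    · exact continuous_finsetSum _ fun j _ =>
        ((ce j).comp (f := fun s => (t₀, s)) (by fun_prop)).mul
          ((ce j).comp (f := fun s => (t₀, s)) (by fun_prop))
    · simp only [he]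
      rw [hce t₀ (Ioo_subset_Icc_self ht₀), hce s₀ (Ioo_subset_Icc_self hs₀)]
      exact sub_ne_zero.2 hne
  exact hpos.ne' hφ0

end KernelUniqueness

/-! ### The kernel of C̃: diagonal values, existence and uniqueness -/

section GelfandLevitanKernel

variable {q : ℝ → ℝ} {T : ℝ} {p : ℝ → ℝ} {u₀ u₁ u : ℝ → ℝ → ℝ} {cp cm : ℝ}

theorem IsGoursatSolution.apply_zero_right (h : IsGoursatSolution p cp cm u) {x : ℝ} (hx : 0 ≤ x) :
    u x 0 = -(1 / 2) * (cp * ∫ y in (0 : ℝ)..x, p y) := by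
  rw [h.equation x 0 hx le_rfl]; simp

theorem IsGoursatSolution.apply_zero_left (h : IsGoursatSolution p cp cm u) {x : ℝ} (hx : 0 ≤ x) :
    u 0 x = -(1 / 2) * (cm * ∫ y in (0 : ℝ)..x, p (-y)) := by
  rw [h.equation 0 x le_rfl hx]; simp

/-- For s = x one characteristic argument is 0, where the double integral vanishes and only the
Goursat data remain. The off-diagonal entries coincide because `u₀` and `u₁` have opposite `cp` and
equal `cm`; this symmetry makes the kernel of C̃ continuous on the diagonal. -/
theorem jumpMatrix_self (h₀ : IsGoursatSolution p (1 / 2) (-1 / 2) u₀)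
    (h₁ : IsGoursatSolution p (-1 / 2) (-1 / 2) u₁) {x : ℝ} (hx : 0 ≤ x) :
    jumpMatrix u₀ u₁ x x =
      !![-(1 / 4) * ((∫ y in (0 : ℝ)..x, p y) + ∫ y in (0 : ℝ)..x, p (-y)),
          1 / 4 * ((∫ y in (0 : ℝ)..x, p y) - ∫ y in (0 : ℝ)..x, p (-y));
        1 / 4 * ((∫ y in (0 : ℝ)..x, p y) - ∫ y in (0 : ℝ)..x, p (-y)),
          -(1 / 4) * ((∫ y in (0 : ℝ)..x, p y) + ∫ y in (0 : ℝ)..x, p (-y))] := by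
  simp only [jumpMatrix, add_self_div_two, sub_self, zero_div, h₀.apply_zero_right hx,
    h₀.apply_zero_left hx, h₁.apply_zero_right hx, h₁.apply_zero_left hx]
  congr! 1
  ext i j
  fin_cases i <;> fin_cases j <;> simp <;> ring

theorem jumpKernel_self (h₀ : IsGoursatSolution p (1 / 2) (-1 / 2) u₀)
    (h₁ : IsGoursatSolution p (-1 / 2) (-1 / 2) u₁) {x : ℝ} (hx : 0 ≤ x) :
    jumpKernel u₀ u₁ x x = jumpKernelAdj u₀ u₁ x x := by
  rw [jumpKernel, jumpKernelAdj, jumpMatrix_self h₀ h₁ hx]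
  congr 1
  ext i j
  fin_cases i <;> fin_cases j <;> rfl

/-- The kernel of the reflected connecting operator. -/
def connectingKernel (u₀ u₁ : ℝ → ℝ → ℝ) (t s : ℝ) : Matrix (Fin 2) (Fin 2) ℝ :=
  (Matrix.toEuclideanCLM (n := Fin 2) (𝕜 := ℝ)).symm
    (factoredKernel (jumpKernel u₀ u₁) (jumpKernelAdj u₀ u₁) t s)

theorem continuousOn_connectingKernel (h₀ : IsGoursatSolution p (1 / 2) (-1 / 2) u₀)
    (h₁ : IsGoursatSolution p (-1 / 2) (-1 / 2) u₁) :
    ContinuousOn (Function.uncurry (connectingKernel u₀ u₁)) (Icc 0 T ×ˢ Icc 0 T) :=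
  continuous_toEuclideanCLM_symm.comp_continuousOn
    ((continuousOn_factoredKernel (continuous_jumpKernel h₀.continuous h₁.continuous)
      (continuous_jumpKernelAdj h₀.continuous h₁.continuous)
      fun _ hx => jumpKernel_self h₀ h₁ hx).mono
      (prod_mono (fun _ h => h.1) (fun _ h => h.1)))

theorem hasKernel_connectingKernel (hT : 0 < T) (h₀ : IsGoursatSolution p (1 / 2) (-1 / 2) u₀)
    (h₁ : IsGoursatSolution p (-1 / 2) (-1 / 2) u₁) {W : ControlSpace T →L[ℝ] StateSpace T}
    (hW : ∀ F, W (timeReversal T F) =ᵐ[volume.restrict (Ioo (-T) T)] reversedState u₀ u₁ F)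
    {A C : ControlSpace T →L[ℝ] ControlSpace T}
    (hA : ∀ F G, inner ℝ (A F) G = inner ℝ (W F) (W G))
    (hC : A = (1 / 2 : ℝ) • (ContinuousLinearMap.id ℝ (ControlSpace T) + C)) :
    HasKernel T (timeReversal T ∘L C ∘L timeReversal T) (connectingKernel u₀ u₁) := by
  have cK := continuous_jumpKernel h₀.continuous h₁.continuous
  have cL := continuous_jumpKernelAdj h₀.continuous h₁.continuous
  obtain ⟨U, V, hU, hV, hadj⟩ := exists_triangularOperators cK cL
    (fun x s u v => inner_toEuclideanCLM_transpose _ _ _) T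
  exact hasKernel_of_factored cK cL (fun _ hx => jumpKernel_self h₀ h₁ hx) hU hV
    (timeReversal_comp_eq hA hC (inner_reversedState hT h₀.continuous h₁.continuous hW hU) hadj)

/-- The connecting operator is W*W. Uniqueness of generalized solutions forces any other control
operator to equal W, so every admissible kernel represents an operator with the same factorization
and equals this one on the open square. -/
theorem exists_connectingKernel (hT : 0 < T)
    (hq : ContinuousOn q (Ioo 0 (2 * Real.pi)))
    (hq2 : MemLp q 2 (volume.restrict (Ioo 0 (2 * Real.pi)))) :
    ∃ u₀ u₁, IsGoursatSolution (linePotential q) (1 / 2) (-1 / 2) u₀ ∧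
      IsGoursatSolution (linePotential q) (-1 / 2) (-1 / 2) u₁ ∧
      IsGelfandLevitanKernel q T (connectingKernel u₀ u₁) ∧
      ∀ k, IsGelfandLevitanKernel q T k → ∀ t ∈ Ioo 0 T, ∀ s ∈ Ioo 0 T,
        k t s = connectingKernel u₀ u₁ t s := by
  have hpm := measurable_linePotential hq
  have hpi := integrable_linePotential hq2
  obtain ⟨u₀, c₀, e₀⟩ := exists_goursat_solution hpm hpi (1 / 2) (-1 / 2)
  obtain ⟨u₁, c₁, e₁⟩ := exists_goursat_solution hpm hpi (-1 / 2) (-1 / 2)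
  have h₀ : IsGoursatSolution (linePotential q) (1 / 2) (-1 / 2) u₀ := ⟨c₀, e₀⟩
  have h₁ : IsGoursatSolution (linePotential q) (-1 / 2) (-1 / 2) u₁ := ⟨c₁, e₁⟩
  obtain ⟨v, W, hv, hvW, hW⟩ := exists_control_solution hT hpm hpi h₀ h₁
  refine ⟨u₀, u₁, h₀, h₁, ⟨continuousOn_connectingKernel h₀ h₁,
    ContinuousLinearMap.adjoint W ∘L W,
    (2 : ℝ) • (ContinuousLinearMap.adjoint W ∘L W) - ContinuousLinearMap.id ℝ (ControlSpace T),
    ⟨W, fun F => ⟨⟨v F, hv F⟩, fun v' hv' => ?_⟩, fun F G => ?_⟩, ?_, ?_⟩, fun k hk => ?_⟩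
  · rw [hv'.unique hT (memLp_linePotential hq2) (hv F) T ⟨hT.le, le_rfl⟩]
    exact hvW F
  · exact ContinuousLinearMap.adjoint_inner_left W G (W F)
  · rw [add_sub_cancel, smul_smul]; norm_num
  · refine hasKernel_connectingKernel hT h₀ h₁ hW
      (A := ContinuousLinearMap.adjoint W ∘L W)
      (fun F G => ContinuousLinearMap.adjoint_inner_left W G (W F)) ?_
    rw [add_sub_cancel, smul_smul]; norm_num
  · obtain ⟨hkc, A, C, ⟨W', hW', hA⟩, hC, hkk⟩ := hk
    have hWW : ∀ F, W' F = W F := fun F =>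
      Lp.ext (((hW' F).2 (v F) (hv F)).symm.trans (hvW F))
    simp only [hWW] at hA
    exact hkk.eqOn hT hkc (continuousOn_connectingKernel h₀ h₁)
      (hasKernel_connectingKernel hT h₀ h₁ hW hA hC)

end GelfandLevitanKernel

/-! ### The equation on (0, π) and the operator equation on (0, s) -/

section GelfandLevitanEquation

variable {u₀ u₁ : ℝ → ℝ → ℝ} {k : ℝ → ℝ → Matrix (Fin 2) (Fin 2) ℝ}

/-- The entries of an operator of the plane, in the standard basis. -/
def planeEntry (i j : Fin 2) : PlaneEnd →L[ℝ] ℝ :=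
  (EuclideanSpace.proj i).comp
    (ContinuousLinearMap.apply ℝ (EuclideanSpace ℝ (Fin 2)) (EuclideanSpace.single j 1))

theorem planeEntry_eq (i j : Fin 2) (A : PlaneEnd) :
    planeEntry i j A = (Matrix.toEuclideanCLM (n := Fin 2) (𝕜 := ℝ)).symm A i j := by
  have h := toEuclideanCLM_symm_apply A (EuclideanSpace.single j 1) i
  rw [← (show A (EuclideanSpace.single j 1) i = planeEntry i j A from rfl), ← h]
  simp

theorem planeEntry_toEuclideanCLM (i j : Fin 2) (M : Matrix (Fin 2) (Fin 2) ℝ) :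
    planeEntry i j (Matrix.toEuclideanCLM (n := Fin 2) (𝕜 := ℝ) M) = M i j := by
  rw [planeEntry_eq, StarAlgEquiv.symm_apply_apply]

theorem eq_zero_of_planeEntry {A : PlaneEnd} (h : ∀ i j, planeEntry i j A = 0) : A = 0 := by
  have h1 : (Matrix.toEuclideanCLM (n := Fin 2) (𝕜 := ℝ)).symm A = 0 := by
    ext i j
    rw [← planeEntry_eq, h]; rfl
  rw [← StarAlgEquiv.apply_symm_apply (Matrix.toEuclideanCLM (n := Fin 2) (𝕜 := ℝ)) A, h1, map_zero]

theorem intervalIntegrable_toEuclideanCLM {n : ℝ → Matrix (Fin 2) (Fin 2) ℝ} {a b : ℝ}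
    (hn : ∀ i j, IntervalIntegrable (fun α => n α i j) volume a b) :
    IntervalIntegrable (fun α => Matrix.toEuclideanCLM (n := Fin 2) (𝕜 := ℝ) (n α)) volume a b := by
  have e : (fun α => Matrix.toEuclideanCLM (n := Fin 2) (𝕜 := ℝ) (n α)) = fun α =>
      ∑ i, ∑ j, n α i j • Matrix.toEuclideanCLM (n := Fin 2) (𝕜 := ℝ) (Matrix.single i j 1) := by
    ext1 α
    conv_lhs => rw [Matrix.matrix_eq_sum_single (n α)]
    simp only [map_sum]
    refine Finset.sum_congr rfl fun i _ => Finset.sum_congr rfl fun j _ => ?_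
    rw [← map_smul, Matrix.smul_single, smul_eq_mul, mul_one]
  rw [e]
  have : ∀ i j, IntervalIntegrable (fun α => n α i j •
      Matrix.toEuclideanCLM (n := Fin 2) (𝕜 := ℝ) (Matrix.single i j 1)) volume a b := fun i j =>
    ⟨(hn i j).1.smul_const _, (hn i j).2.smul_const _⟩
  simp only [Fin.sum_univ_two]
  exact ((this 0 0).add (this 0 1)).add ((this 1 0).add (this 1 1))

/-- For a triangular matrix function, the Gelfand–Levitan equation is the equation with the
factored kernel on the shorter interval. -/
theorem gelfandLevitan_equation_iff {K L : ℝ → ℝ → PlaneEnd} (hK : Continuous (Function.uncurry K))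
    (hL : Continuous (Function.uncurry L)) (hdiag : ∀ x, 0 ≤ x → K x x = L x x)
    (hk : ∀ t ∈ Ioo 0 Real.pi, ∀ s ∈ Ioo 0 Real.pi, k t s
      = (Matrix.toEuclideanCLM (n := Fin 2) (𝕜 := ℝ)).symm (factoredKernel K L t s))
    {n : ℝ → Matrix (Fin 2) (Fin 2) ℝ} {x s : ℝ} (hx : 0 < x) (hxs : x < s) (hs : s < Real.pi)
    (hn : ∀ i j, IntervalIntegrable (fun α => n α i j) volume 0 Real.pi)
    (hn0 : ∀ α, s < α → α < Real.pi → n α = 0) :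
    IntervalIntegrable (fun α => factoredKernel K L x α *
      Matrix.toEuclideanCLM (n := Fin 2) (𝕜 := ℝ) (n α)) volume 0 s ∧
    ((∀ i j, n x i j + k x s i j + ∫ α in (0 : ℝ)..Real.pi, (k x α * n α) i j = 0) ↔
      Matrix.toEuclideanCLM (n := Fin 2) (𝕜 := ℝ) (n x) + factoredKernel K L x s
        + ∫ α in (0 : ℝ)..s, factoredKernel K L x α *
          Matrix.toEuclideanCLM (n := Fin 2) (𝕜 := ℝ) (n α) = 0) := by
  have hs0 : 0 < s := hx.trans hxs
  have hxI : x ∈ Ioo 0 Real.pi := mem_Ioo.2 ⟨hx, hxs.trans hs⟩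
  have hns : ∀ i j, IntervalIntegrable (fun α => n α i j) volume 0 s := fun i j =>
    (hn i j).mono_set (by
      rw [uIcc_of_le hs0.le, uIcc_of_le Real.pi_pos.le]; exact Icc_subset_Icc le_rfl hs.le)
  have hc : ContinuousOn (fun α => factoredKernel K L x α) (uIcc 0 s) := by
    rw [uIcc_of_le hs0.le]
    exact (continuousOn_factoredKernel hK hL hdiag).comp
      (f := fun s => (x, s)) (by fun_prop) fun s hs => ⟨hx.le, hs.1⟩
  have hint := (intervalIntegrable_toEuclideanCLM hns).continuousOn_mul hc
  refine ⟨hint, ?_⟩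
  have key : ∀ i j, ∫ α in (0 : ℝ)..Real.pi, (k x α * n α) i j
      = planeEntry i j (∫ α in (0 : ℝ)..s, factoredKernel K L x α *
          Matrix.toEuclideanCLM (n := Fin 2) (𝕜 := ℝ) (n α)) := by
    intro i j
    -- The column vanishes on (s, π), which shortens the interval. The end point π, where nothing is
    -- known about n or k, is dropped as a null set.
    rw [← (planeEntry i j).intervalIntegral_comp_comm hint,
      intervalIntegral.integral_of_le Real.pi_pos.le, intervalIntegral.integral_of_le hs0.le,
      integral_Ioc_eq_integral_Ioo (y := Real.pi),
      setIntegral_eq_of_subset_of_forall_sdiff_eq_zero measurableSet_Ioo (s := Ioc 0 s)]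
    · refine setIntegral_congr_fun measurableSet_Ioc fun α hα => ?_
      rw [planeEntry_eq, map_mul, StarAlgEquiv.symm_apply_apply,
        ← hk x hxI α (mem_Ioo.2 ⟨hα.1, hα.2.trans_lt hs⟩)]
    · exact fun α hα => mem_Ioo.2 ⟨hα.1, hα.2.trans_lt hs⟩
    · intro α hα
      have h1 : s < α := by
        by_contra h
        exact hα.2 (mem_Ioc.2 ⟨hα.1.1, not_lt.1 h⟩)
      rw [hn0 α h1 hα.1.2, mul_zero]; rfl
  have hks : ∀ i j, k x s i j = planeEntry i j (factoredKernel K L x s) := fun i j => by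
    rw [planeEntry_eq, hk x hxI s (mem_Ioo.2 ⟨hs0, hs⟩)]
  constructor
  · intro h
    refine eq_zero_of_planeEntry fun i j => ?_
    rw [map_add, map_add, planeEntry_toEuclideanCLM, ← hks, ← key, h]
  · intro h i j
    rw [key, hks, ← planeEntry_toEuclideanCLM i j (n x), ← map_add, ← map_add, h, map_zero]

end GelfandLevitanEquation

/-! ### Differentiating the primitives of the potential -/

section Reconstruction

variable {q : ℝ → ℝ}

theorem hasDerivAt_integral_linePotential (hq : ContinuousOn q (Ioo 0 (2 * Real.pi)))
    (hq2 : MemLp q 2 (volume.restrict (Ioo 0 (2 * Real.pi)))) {x : ℝ}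
    (hx : x ∈ Ioo 0 (2 * Real.pi)) :
    HasDerivAt (fun y => ∫ z in (0 : ℝ)..y, linePotential q z) (q x) x := by
  have hp := integrable_linePotential hq2
  have he : linePotential q =ᶠ[nhds x] q := by
    filter_upwards [isOpen_Ioo.mem_nhds hx] with y hy
    rw [linePotential, if_pos (mem_Ioo.1 hy)]
  have hc : ContinuousAt (linePotential q) x :=
    (hq.continuousAt (isOpen_Ioo.mem_nhds hx)).congr he.symm
  have h := intervalIntegral.integral_hasDerivAt_right (a := 0) (b := x) hp.intervalIntegrable
    (measurable_linePotential hq).stronglyMeasurable.stronglyMeasurableAtFilter hc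
  rwa [he.eq_of_nhds] at h

/-- For 0 < y < 2π the shifted potential at -y is q(2π - y), so data travelling to the left of the
origin read q backwards from 2π. -/
theorem hasDerivAt_integral_linePotential_neg (hq : ContinuousOn q (Ioo 0 (2 * Real.pi)))
    (hq2 : MemLp q 2 (volume.restrict (Ioo 0 (2 * Real.pi)))) {x : ℝ}
    (hx : x ∈ Ioo 0 (2 * Real.pi)) :
    HasDerivAt (fun y => ∫ z in (0 : ℝ)..2 * Real.pi - y, linePotential q (-z)) (-q x) x := by
  have hp := (integrable_linePotential hq2).comp_neg
  have he : ∀ᶠ y in nhds (2 * Real.pi - x), linePotential q (-y) = q (2 * Real.pi - y) := by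
    have hx' : 2 * Real.pi - x ∈ Ioo 0 (2 * Real.pi) := mem_Ioo.2 ⟨by linarith [hx.2], by linarith [hx.1]⟩
    filter_upwards [isOpen_Ioo.mem_nhds hx'] with y hy
    have h1 := hy.1
    have h2 := hy.2
    rw [linePotential, if_neg fun h => by linarith [h.1], if_pos ⟨by linarith, by linarith⟩]
    congr 1; ring
  have hc : ContinuousAt (fun y => linePotential q (-y)) (2 * Real.pi - x) := by
    have h1 : ContinuousAt (fun y => q (2 * Real.pi - y)) (2 * Real.pi - x) := by
      refine ContinuousAt.comp (g := q) (f := fun y => 2 * Real.pi - y) ?_ (by fun_prop)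
      rw [sub_sub_cancel]
      exact hq.continuousAt (isOpen_Ioo.mem_nhds hx)
    exact h1.congr (he.mono fun _ h => h.symm)
  have h := intervalIntegral.integral_hasDerivAt_right (a := 0) (b := 2 * Real.pi - x)
    hp.intervalIntegrable ((measurable_linePotential hq).comp
      measurable_neg).stronglyMeasurable.stronglyMeasurableAtFilter hc
  rw [he.self_of_nhds, sub_sub_cancel] at h
  exact (h.comp x ((hasDerivAt_id x).const_sub (2 * Real.pi))).congr_deriv (by ring)

end Reconstruction

end PeriodicWave

end

/-! ### The Gelfand–Levitan theorem -/

theorem theorem5 (q : ℝ → ℝ)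
    (hq : ContDiffOn ℝ 2 q (Set.Ioo 0 (2 * Real.pi)))
    (hq2 : MeasureTheory.MemLp q 2
      (MeasureTheory.volume.restrict (Set.Ioo 0 (2 * Real.pi)))) :
    (∃ k, PeriodicWave.IsGelfandLevitanKernel q Real.pi k) ∧
    ∀ k, PeriodicWave.IsGelfandLevitanKernel q Real.pi k →
      ∃ m : ℝ → ℝ → Matrix (Fin 2) (Fin 2) ℝ,
        PeriodicWave.IsGelfandLevitanSolution k m ∧
        (∀ m' : ℝ → ℝ → Matrix (Fin 2) (Fin 2) ℝ,
          PeriodicWave.IsGelfandLevitanSolution k m' →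
            ∀ x ∈ Set.Ioo 0 Real.pi, ∀ s ∈ Set.Ioo 0 Real.pi, m' x s = m x s) ∧
        (∀ x ∈ Set.Ioo 0 Real.pi,
          DifferentiableAt ℝ (fun y => m y y 0 0 - m y y 0 1) x ∧
          q x = 2 * deriv (fun y => m y y 0 0 - m y y 0 1) x) ∧
        (∀ x ∈ Set.Ioo Real.pi (2 * Real.pi),
          DifferentiableAt ℝ (fun y => m (2 * Real.pi - y) (2 * Real.pi - y) 0 0
            + m (2 * Real.pi - y) (2 * Real.pi - y) 0 1) x ∧
          q x = -2 * deriv (fun y => m (2 * Real.pi - y) (2 * Real.pi - y) 0 0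
            + m (2 * Real.pi - y) (2 * Real.pi - y) 0 1) x) := by
  have hπ := Real.pi_pos
  have hqc := hq.continuousOn
  obtain ⟨u₀, u₁, h₀, h₁, hker, huniq⟩ := PeriodicWave.exists_connectingKernel hπ hqc hq2
  refine ⟨⟨_, hker⟩, fun k hk => ?_⟩
  -- From here on only the values of k on the open square matter, and they are those of the factored
  -- kernel.
  replace hk := huniq k hk
  set K := PeriodicWave.jumpKernel u₀ u₁ with hK
  set L := PeriodicWave.jumpKernelAdj u₀ u₁ with hL
  have cK : Continuous (Function.uncurry K) :=
    PeriodicWave.continuous_jumpKernel h₀.continuous h₁.continuous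
  have cL : Continuous (Function.uncurry L) :=
    PeriodicWave.continuous_jumpKernelAdj h₀.continuous h₁.continuous
  have hdiag : ∀ x, 0 ≤ x → K x x = L x x := fun x hx => PeriodicWave.jumpKernel_self h₀ h₁ hx
  obtain ⟨r, cr, hr⟩ := PeriodicWave.exists_volterra_resolvent cK hπ.le
  let Φ := Matrix.toEuclideanCLM (n := Fin 2) (𝕜 := ℝ)
  -- The solution is the resolvent kernel of I + K, cut to the upper triangle where the resolvent
  -- equation holds.
  set m : ℝ → ℝ → Matrix (Fin 2) (Fin 2) ℝ := fun x s => if x ≤ s then Φ.symm (r x s) else 0 with hm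
  have hmle : ∀ {x s}, x ≤ s → m x s = Φ.symm (r x s) := fun h => if_pos h
  have hmgt : ∀ {x s}, s < x → m x s = 0 := fun h => if_neg h.not_ge
  have cr' : Continuous fun z : ℝ × ℝ => Φ.symm (r z.1 z.2) :=
    PeriodicWave.continuous_toEuclideanCLM_symm.comp cr
  have hmi : ∀ s ∈ Set.Ioo 0 Real.pi, ∀ i j,
      IntervalIntegrable (fun α => m α s i j) MeasureTheory.volume 0 Real.pi := by
    intro s _ i j
    have e : (fun α => m α s i j) = (Set.Iic s).indicator fun α => Φ.symm (r α s) i j := by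
      ext1 α
      by_cases h : α ≤ s
      · rw [Set.indicator_of_mem (Set.mem_Iic.2 h), hmle h]
      · rw [Set.indicator_of_notMem (fun h' => h (Set.mem_Iic.1 h')), hmgt (not_le.1 h)]; rfl
    have c : Continuous fun α => Φ.symm (r α s) i j :=
      (cr'.comp (f := fun α => (α, s)) (by fun_prop)).matrix_elem i j
    rw [e]
    exact ⟨(c.intervalIntegrable 0 Real.pi).1.indicator measurableSet_Iic,
      (c.intervalIntegrable 0 Real.pi).2.indicator measurableSet_Iic⟩
  have hsol : PeriodicWave.IsGelfandLevitanSolution k m := by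
    refine ⟨cr'.continuousOn.congr fun z hz => hmle hz.2.1, fun x s _ h _ => hmgt h, hmi,
      fun x s hx hxs hs => ?_⟩
    refine ((PeriodicWave.gelfandLevitan_equation_iff cK cL hdiag hk hx hxs hs
      (hmi s (Set.mem_Ioo.2 ⟨hx.trans hxs, hs⟩)) fun α h _ => hmgt h).2).2 ?_
    have h := PeriodicWave.factoredKernel_resolvent cK cL cr hr (Set.mem_Ioo.2 ⟨hx, hxs⟩) hs.le
    rw [hmle hxs.le, StarAlgEquiv.apply_symm_apply]
    refine Eq.trans (congrArg _ (intervalIntegral.integral_congr fun α hα => ?_)) h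
    rw [Set.uIcc_of_le (hx.trans hxs).le] at hα
    rw [hmle hα.2, StarAlgEquiv.apply_symm_apply]
  -- At s = x the integral in the resolvent equation is over an empty interval.
  have hself : ∀ x ∈ Set.Ioo 0 Real.pi, m x x = -PeriodicWave.jumpMatrix u₀ u₁ x x := by
    intro x hx
    have h := hr x x hx.1.le le_rfl hx.2.le
    rw [intervalIntegral.integral_same, add_zero] at h
    rw [hmle le_rfl, eq_neg_of_add_eq_zero_left h, map_neg, hK, PeriodicWave.jumpKernel,
      StarAlgEquiv.symm_apply_apply]
  refine ⟨m, hsol, fun m' hm' => ?_, fun x hx => ?_, fun x hx => ?_⟩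
  · have hlt : ∀ x s, 0 < x → x < s → s < Real.pi → m' x s = m x s := by
      intro x s hx hxs hs
      have hs' : s ∈ Set.Ioo 0 Real.pi := Set.mem_Ioo.2 ⟨hx.trans hxs, hs⟩
      have eq : ∀ {n}, PeriodicWave.IsGelfandLevitanSolution k n → ∀ y ∈ Set.Ioo 0 s,
          IntervalIntegrable (fun α => PeriodicWave.factoredKernel K L y α * Φ (n α s))
            MeasureTheory.volume 0 s ∧
          Φ (n y s) + PeriodicWave.factoredKernel K L y s
            + ∫ α in (0 : ℝ)..s, PeriodicWave.factoredKernel K L y α * Φ (n α s) = 0 := by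
        intro n hn y hy
        have h := PeriodicWave.gelfandLevitan_equation_iff cK cL hdiag hk hy.1 hy.2 hs
          (hn.integrable s hs') fun α h h' => hn.triangular α s hs'.1 h h'
        exact ⟨h.1, h.2.1 (hn.equation y s hy.1 hy.2 hs)⟩
      have hint : ∀ {n}, PeriodicWave.IsGelfandLevitanSolution k n →
          IntervalIntegrable (fun α => Φ (n α s)) MeasureTheory.volume 0 s := fun hn =>
        PeriodicWave.intervalIntegrable_toEuclideanCLM fun i j =>
          (hn.integrable s hs' i j).mono_set (by
            rw [Set.uIcc_of_le hs'.1.le, Set.uIcc_of_le hπ.le]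
            exact Set.Icc_subset_Icc le_rfl hs.le)
      -- A competing solution may be unbounded as x → 0, so its column enters only as an integrable
      -- function.
      have h := PeriodicWave.eq_zero_of_factoredKernel cK cL ((hint hm').sub (hint hsol))
        (fun y hy => by
          obtain ⟨i1, e1⟩ := eq hm' y hy
          obtain ⟨i2, e2⟩ := eq hsol y hy
          simp only [mul_sub]
          rw [intervalIntegral.integral_sub i1 i2, eq_neg_of_add_eq_zero_right e1,
            eq_neg_of_add_eq_zero_right e2]
          abel) x (Set.mem_Ioo.2 ⟨hx, hxs⟩)
      exact Φ.injective (sub_eq_zero.1 h)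
    intro x hx s hs
    rcases lt_trichotomy x s with h | rfl | h
    · exact hlt x s hx.1 h hs.2
    -- The equation is imposed only for x < s; the diagonal values are limits as s decreases to x,
    -- by continuity on the closed triangle.
    · have hc : ∀ {n}, PeriodicWave.IsGelfandLevitanSolution k n →
          Filter.Tendsto (fun s => n x s) (nhdsWithin x (Set.Ioo x Real.pi)) (nhds (n x x)) := by
        intro n hn
        have h1 := hn.continuousOn (x, x) ⟨hx.1, le_rfl, hx.2⟩
        refine Filter.Tendsto.comp (f := fun s => (x, s)) h1
          (tendsto_nhdsWithin_of_tendsto_nhds_of_eventually_within _ ?_ ?_)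
        · exact (Continuous.tendsto (f := fun s : ℝ => (x, s)) (by fun_prop) x).mono_left
            nhdsWithin_le_nhds
        · filter_upwards [self_mem_nhdsWithin] with s hs
          exact ⟨hx.1, hs.1.le, hs.2⟩
      have : (nhdsWithin x (Set.Ioo x Real.pi)).NeBot := by
        rw [nhdsWithin_Ioo_eq_nhdsGT hx.2]; infer_instance
      refine tendsto_nhds_unique (hc hm') ((hc hsol).congr' ?_)
      filter_upwards [self_mem_nhdsWithin] with s hs
      exact (hlt x s hx.1 hs.1 hs.2).symm
    · rw [hm'.triangular x s hs.1 h hx.2, hmgt h]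
  -- On the diagonal m₁₁ - m₁₂ is half of ∫₀ˣ q̃(y) dy: the contributions of q̃(-y) cancel.
  · have h := (PeriodicWave.hasDerivAt_integral_linePotential hqc hq2
      (Set.mem_Ioo.2 ⟨hx.1, by linarith [hx.2]⟩)).const_mul (1 / 2)
    have h' : HasDerivAt (fun y => m y y 0 0 - m y y 0 1) (1 / 2 * q x) x := by
      refine h.congr_of_eventuallyEq ?_
      filter_upwards [isOpen_Ioo.mem_nhds hx] with y hy
      rw [hself y hy, PeriodicWave.jumpMatrix_self h₀ h₁ hy.1.le]
      simp
      ring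
    exact ⟨h'.differentiableAt, by rw [h'.deriv]; ring⟩
  -- On the diagonal m₁₁ + m₁₂ is half of the primitive of q̃(-y), evaluated here at 2π - x; the
  -- inner derivative -1 accounts for the sign in the formula.
  · have h := (PeriodicWave.hasDerivAt_integral_linePotential_neg hqc hq2
      (Set.mem_Ioo.2 ⟨by linarith [hx.1], hx.2⟩)).const_mul (1 / 2)
    have h' : HasDerivAt (fun y => m (2 * Real.pi - y) (2 * Real.pi - y) 0 0
            + m (2 * Real.pi - y) (2 * Real.pi - y) 0 1) (1 / 2 * -q x) x := by
      refine h.congr_of_eventuallyEq ?_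
      filter_upwards [isOpen_Ioo.mem_nhds hx] with y hy
      have hy1 := hy.1
      have hy2 := hy.2
      rw [hself _ (Set.mem_Ioo.2 ⟨by linarith, by linarith⟩),
        PeriodicWave.jumpMatrix_self h₀ h₁ (by linarith)]
      simp
      ring
    exact ⟨h'.differentiableAt, by rw [h'.deriv]; ring⟩
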